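/- \textbf{Setting.} Let $C$ be a CSS code with finite sets $X$, $Q$, $Z$ of $X$-checks, qubits and $Z$-checks and parity-check matrices $H_X, H_Z$ over $\mathbb{F}_2$, $H_XH_Z^T=0$. Fix a $\mathbb{Z}$-lift of $C$, i.e. integer matrices $\tilde\partial_1\in\mathbb{Z}^{X\times Q}$, $\tilde\partial_2\in\mathbb{Z}^{Q\times Z}$ with $\tilde\partial_1\tilde\partial_2=0$, $\tilde\partial_1\equiv H_X$ and $\tilde\partial_2\equiv H_Z^T \pmod 2$. The lifted Tanner graph $\widetilde T$ has vertex set $X\sqcup Q$ and $|(\tilde\partial_1)_{x,q}|$ parallel edges between $x$ and $q$. For $z\in Z$, $\widetilde T_z\subseteq\widetilde T$ is the subgraph formed by the qubits $q$ with $(\tilde\partial_2)_{q,z}\neq0$, the $x$ with $(\tilde\partial_1)_{x,q}\ne 0$ for such a $q$, and all edges of $\widetilde T$ at these qubits. A \emph{1-skeleton} for this $\mathbb{Z}$-lift is $\widetilde T$ together with finitely many additional edges ($Z$-type edges), each assigned to some $z\in Z$ and joining two vertices of $\widetilde T_z$; let $\Gamma_z$ be the union of $\widetilde T_z$ and the $Z$-type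 edges of $z$. A \emph{cellular realization} of $C$ (with the fixed $\mathbb{Z}$-lift) is a finite Hausdorff CW complex $L$ of dimension at most $5$ such that: \begin{itemize} \item its graph of $0$- and $1$-cells is a 1-skeleton as above; \item each $2$-cell is assigned to some $z\in Z$ and attached to $\Gamma_z$, and for every $z$ the union $\overline T_z$ of $\Gamma_z$ and the $2$-cells of $z$ is simply connected (in particular nonempty); \item the $3$-cells are indexed by $X$, the boundary of the $3$-cell $x$ being mapped to the vertex $x$; \item the $4$-cells are indexed by $Q$; the boundary of the $4$-cell $q$ is mapped to the union $N_q$ of the vertex $q$, the edges of $\widetilde T$ at $q$ and the $3$-cells of the adjacent $x$, by a based map (with base value the vertex $q$) that is homotopic in $N_q$, relative to the base point, to the standard map which, for each edge between $q$ and $x$, follows this edge from $q$ to $x$ and wraps once around the $3$-sphere of $x$ with degree $\operatorname{sgn}(\tilde\partial_1)_{x,q}$; \item the $5$-cells are indexed by $Z$; the boundary of the $5$-cell $z$ is mapped to the union of $\overline T_z$ and, for all $q$ with $(\tilde\partial_2)_{q,z}\ne0$, of $N_q$ and the closed $4$-cell $q$, and its incidence number (degree) with each $4$-cell $q\in Q$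 is $(\tilde\partial_2)_{q,z}$. \end{itemize} For a finite covering $p:L'\to L$ (a covering map with finite fibres), the cells of $L'$ are the lifts of the cells of $L$, and the \emph{cellular lift} of $C$ associated to $p$ is the pair of parity-check matrices given by the part $$\mathcal C_5(L',\mathbb{Z}_2)\xrightarrow{\partial'_5}\mathcal C_4(L',\mathbb{Z}_2)\xrightarrow{\partial'_4}\mathcal C_3(L',\mathbb{Z}_2)$$ of the cellular chain complex of $L'$, with its basis of cells; so the entries are the incidence numbers of cells of $L'$ modulo $2$. \textbf{Theorem.} Let $L_1$ and $L_2$ be two cellular realizations of $C$ for the same $\mathbb{Z}$-lift and with identical 1-skeletons (including the assignment of the $Z$-type edges to the $Z$-checks). Then: \begin{enumerate} \item For every finite covering $p_1:L_1'\to L_1$ there is a finite covering $p_2:L_2'\to L_2$ such that the associated cellular lifts are equal: there are bijections, over the identities of $X$, $Q$ and $Z$, between the $3$-, $4$- and $5$-cells of $L_1'$ and of $L_2'$ lying over the cells indexed by $X$, $Q$ and $Z$, under which the parity-check matrices of the two cellular lifts coincide. \item Consequently, up to labelling of checks and qubits, a pair of parity-check matrices is a cellular lift of $C$ associated to a finite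 covering of $L_1$ if and only if it is one associated to a finite covering of $L_2$. \end{enumerate} -/

import Mathlib

open Set Metric Topology CategoryTheory

universe u

noncomputable section

namespace CellularLift

/-! ## Disks, spheres and mapping degrees

As in Mathlib's CW complexes, `ℝⁿ = Fin n → ℝ` carries the sup norm, so the closed unit ball is the
cube `[-1,1]ⁿ` and the unit sphere is its boundary. -/

/-- The closed `n`-disk (a cube). -/
abbrev Disk (n : ℕ) : Type := closedBall (0 : Fin n → ℝ) 1

/-- The open `n`-disk. -/
abbrev OpenDisk (n : ℕ) : Type := ball (0 : Fin n → ℝ) 1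

/-- The `n`-sphere, as the boundary of the `(n+1)`-disk. -/
abbrev Sph (n : ℕ) : Type := sphere (0 : Fin (n + 1) → ℝ) 1

/-- The inclusion of the boundary sphere into the disk. -/
def sphToDisk (n : ℕ) : C(Sph n, Disk (n + 1)) where
  toFun y := ⟨y.1, sphere_subset_closedBall y.2⟩
  continuous_toFun := by fun_prop

/-- The inclusion of the open disk into the closed disk. -/
def openToDisk (n : ℕ) (v : OpenDisk n) : Disk n := ⟨v.1, ball_subset_closedBall v.2⟩

open Classical in
/-- The map collapsing the complement of an open cell. Given a map `τ` from the `n`-disk to `Y`,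
injective on the open disk, it sends `τ v` to `v` for `v` in the open disk and every point
outside the image of the open disk to `∞`. The target, the one-point compactification of the open
disk, is `Dⁿ / ∂Dⁿ`, an `n`-sphere. -/
def collapse {Y : Type*} {n : ℕ} (τ : Disk n → Y) (w : Y) : OnePoint (OpenDisk n) :=
  if h : ∃ v : OpenDisk n, τ (openToDisk n v) = w then ((h.choose : OpenDisk n) : OnePoint _)
  else OnePoint.infty

/-- The face of the cube `[-1,1]ⁿ⁺¹` on which the last coordinate is `1`. -/
def topFace (n : ℕ) (v : Disk n) : Sph n :=
  ⟨Fin.snoc (α := fun _ => ℝ) v.1 1, by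
    have hv : ‖v.1‖ ≤ 1 := mem_closedBall_zero_iff.1 v.2
    rw [mem_sphere_zero_iff_norm]
    apply le_antisymm
    · rw [pi_norm_le_iff_of_nonneg zero_le_one]
      intro i
      refine Fin.lastCases ?_ (fun j => ?_) i
      · simp
      · simpa using (norm_le_pi_norm v.1 j).trans hv
    · have h := norm_le_pi_norm (Fin.snoc (α := fun _ => ℝ) v.1 1) (Fin.last n)
      simpa using h⟩

/-- The reference map of degree one from `∂Dⁿ⁺¹` to `Dⁿ / ∂Dⁿ`: it collapses everything but the
interior of the top face. -/
def refCollapse (n : ℕ) : Sph n → OnePoint (OpenDisk n) := collapse (topFace n)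

theorem collapse_apply {Y : Type*} {n : ℕ} {τ : Disk n → Y}
    (hτ : ∀ v w : OpenDisk n, τ (openToDisk n v) = τ (openToDisk n w) → v = w) (v : OpenDisk n) :
    collapse τ (τ (openToDisk n v)) = (v : OnePoint (OpenDisk n)) := by
  have h : ∃ w : OpenDisk n, τ (openToDisk n w) = τ (openToDisk n v) := ⟨v, rfl⟩
  unfold collapse
  rw [dif_pos h, hτ _ _ h.choose_spec]

theorem continuous_refCollapse (n : ℕ) : Continuous (refCollapse n) := by
  have hcont : Continuous (fun v : OpenDisk n => topFace n (openToDisk n v)) := by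
    refine Continuous.subtype_mk ?_ _
    refine continuous_pi fun i => ?_
    refine Fin.lastCases ?_ (fun j => ?_) i
    · simp [continuous_const]
    · have h : Continuous fun v : OpenDisk n => v.1 j :=
        (continuous_apply j).comp continuous_subtype_val
      simpa [topFace, openToDisk] using h
  have hinit : ∀ v : OpenDisk n, Fin.init (α := fun _ => ℝ) (topFace n (openToDisk n v)).1 = v.1 :=
    fun v => by simp [topFace, openToDisk]
  have hinj : ∀ v w : OpenDisk n,
      topFace n (openToDisk n v) = topFace n (openToDisk n w) → v = w := by
    intro v w h
    apply Subtype.ext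
    rw [← hinit v, ← hinit w, h]
  have hmem : ∀ (S : Set (OpenDisk n)) (y : Sph n),
      (∃ v ∈ S, refCollapse n y = (v : OnePoint (OpenDisk n))) ↔
        y ∈ (fun v : OpenDisk n => topFace n (openToDisk n v)) '' S := by
    intro S y
    constructor
    · rintro ⟨v, hv, h⟩
      by_cases h' : ∃ w : OpenDisk n, topFace n (openToDisk n w) = y
      · obtain ⟨w, rfl⟩ := h'
        rw [refCollapse, collapse_apply hinj, OnePoint.coe_eq_coe] at h
        exact ⟨v, hv, by rw [h]⟩
      · simp [refCollapse, collapse, h'] at h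
    · rintro ⟨v, hv, rfl⟩
      exact ⟨v, hv, collapse_apply hinj v⟩
  have hlast : ∀ y : Sph n, y ∈ range (fun v : OpenDisk n => topFace n (openToDisk n v)) ↔
      (0 < y.1 (Fin.last n) ∧ Fin.init (α := fun _ => ℝ) y.1 ∈ ball (0 : Fin n → ℝ) 1) := by
    intro y
    constructor
    · rintro ⟨v, rfl⟩
      refine ⟨by simp [topFace], ?_⟩
      simp only [hinit]
      exact v.2
    · rintro ⟨h0, h1⟩
      refine ⟨⟨_, h1⟩, ?_⟩
      have hy : ‖y.1‖ = 1 := mem_sphere_zero_iff_norm.1 y.2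
      have hl : y.1 (Fin.last n) = 1 := by
        have hle : y.1 (Fin.last n) ≤ 1 :=
          (le_abs_self _).trans ((norm_le_pi_norm y.1 (Fin.last n)).trans hy.le)
        refine le_antisymm hle (not_lt.1 fun hlt => ?_)
        have : ‖y.1‖ < 1 := by
          rw [pi_norm_lt_iff zero_lt_one]
          intro i
          refine Fin.lastCases ?_ (fun j => ?_) i
          · rw [Real.norm_eq_abs, abs_of_pos h0]
            exact hlt
          · have h2 := (pi_norm_lt_iff (zero_lt_one' ℝ)).1 (mem_ball_zero_iff.1 h1) j
            exact h2
        linarith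
      apply Subtype.ext
      funext i
      refine Fin.lastCases ?_ (fun j => ?_) i
      · simp [topFace, hl]
      · simp [topFace, openToDisk, Fin.init]
  have hopen : IsOpen (range (fun v : OpenDisk n => topFace n (openToDisk n v))) := by
    have h1 : Continuous (fun y : Sph n => y.1 (Fin.last n)) :=
      (continuous_apply _).comp continuous_subtype_val
    have h2 : Continuous (fun y : Sph n => Fin.init (α := fun _ => ℝ) y.1) :=
      continuous_pi fun j => (continuous_apply (Fin.castSucc j)).comp continuous_subtype_val
    have h3 : range (fun v : OpenDisk n => topFace n (openToDisk n v)) =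
        {y : Sph n | 0 < y.1 (Fin.last n) ∧
          Fin.init (α := fun _ => ℝ) y.1 ∈ ball (0 : Fin n → ℝ) 1} := by
      ext y
      exact hlast y
    rw [h3]
    exact (isOpen_lt continuous_const h1).inter (isOpen_ball.preimage h2)
  rw [continuous_def]
  intro U hU
  rw [OnePoint.isOpen_def] at hU
  by_cases hinf : OnePoint.infty ∈ U
  · have hK := hU.1 hinf
    have heq : refCollapse n ⁻¹' U = ((fun v : OpenDisk n => topFace n (openToDisk n v)) ''
        ((fun v : OpenDisk n => (v : OnePoint (OpenDisk n))) ⁻¹' U)ᶜ)ᶜ := by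
      ext y
      rw [mem_compl_iff, ← hmem]
      constructor
      · rintro hy ⟨v, hv, h⟩
        rw [mem_preimage, h] at hy
        exact hv hy
      · intro hy
        rw [mem_preimage]
        rcases h : refCollapse n y with _ | v
        · exact hinf
        · by_contra hv
          exact hy ⟨v, hv, h⟩
    rw [heq]
    exact (hK.image hcont).isClosed.isOpen_compl
  · have heq : refCollapse n ⁻¹' U =
        range (fun v : OpenDisk n => topFace n (openToDisk n v)) ∩
          (fun y : Sph n => Fin.init (α := fun _ => ℝ) y.1) ⁻¹'
            (Subtype.val '' ((fun v : OpenDisk n => (v : OnePoint (OpenDisk n))) ⁻¹' U)) := by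
      ext y
      have h1 : y ∈ refCollapse n ⁻¹' U ↔ ∃ v ∈ ((fun v : OpenDisk n =>
          (v : OnePoint (OpenDisk n))) ⁻¹' U), refCollapse n y = (v : OnePoint (OpenDisk n)) := by
        constructor
        · intro hy
          rw [mem_preimage] at hy
          rcases h : refCollapse n y with _ | v
          · rw [h] at hy
            exact absurd hy hinf
          · rw [h] at hy
            exact ⟨v, hy, rfl⟩
        · rintro ⟨v, hv, h⟩
          rw [mem_preimage, h]
          exact hv
      rw [h1, hmem]
      constructor
      · rintro ⟨v, hv, rfl⟩
        exact ⟨⟨v, rfl⟩, v, hv, (hinit v).symm⟩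
      · rintro ⟨⟨v, rfl⟩, w, hw, h⟩
        simp only [hinit] at h
        rw [Subtype.ext h] at hw
        exact ⟨v, hw, rfl⟩
    rw [heq]
    refine hopen.inter ?_
    have h2 : Continuous (fun y : Sph n => Fin.init (α := fun _ => ℝ) y.1) :=
      continuous_pi fun j => (continuous_apply (Fin.castSucc j)).comp continuous_subtype_val
    exact (isOpen_ball.isOpenMap_subtype_val _ hU.2).preimage h2

/-- The map induced on the `n`-th singular homology group with integer coefficients. -/
def homologyMap (n : ℕ) {A B : Type} [TopologicalSpace A] [TopologicalSpace B] (f : C(A, B)) :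
    (((AlgebraicTopology.singularHomologyFunctor.{0} (ModuleCat.{0} ℤ) n).obj
      (ModuleCat.of ℤ ℤ)).obj (TopCat.of A)) ⟶
    (((AlgebraicTopology.singularHomologyFunctor.{0} (ModuleCat.{0} ℤ) n).obj
      (ModuleCat.of ℤ ℤ)).obj (TopCat.of B)) :=
  ((AlgebraicTopology.singularHomologyFunctor.{0} (ModuleCat.{0} ℤ) n).obj
    (ModuleCat.of ℤ ℤ)).map (TopCat.ofHom f)

/-- `f : ∂Dⁿ⁺¹ → Dⁿ / ∂Dⁿ` has degree `d`: on `n`-th homology, it is `d` times the reference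
collapse map. -/
def HasDegree {n : ℕ} (f : C(Sph n, OnePoint (OpenDisk n))) (d : ℤ) : Prop :=
  homologyMap n f = d • homologyMap n ⟨refCollapse n, continuous_refCollapse n⟩

open Classical in
/-- The degree of a map `∂Dⁿ⁺¹ → Dⁿ / ∂Dⁿ` (`0` if the map is not continuous). -/
def degree {n : ℕ} (f : Sph n → OnePoint (OpenDisk n)) : ℤ :=
  if h : ∃ (hf : Continuous f) (d : ℤ), HasDegree ⟨f, hf⟩ d then h.choose_spec.choose else 0

/-- The cellular incidence number of two cells of consecutive dimensions, given by their
characteristic maps `σ` and `τ`: the degree of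
`∂Dⁿ⁺¹ → Y → Y / (Y minus the open cell of τ) = Dⁿ / ∂Dⁿ`, the first map being the attaching map
of `σ`. -/
def incidence {Y : Type*} {n : ℕ} (σ : Disk (n + 1) → Y) (τ : Disk n → Y) : ℤ :=
  degree fun y => collapse τ (σ (sphToDisk n y))

/-! ## CSS codes, integral lifts, and the lifted Tanner graph -/

/-- A pair of binary parity-check matrices with `X`-checks, qubits and `Z`-checks indexed by
`X`, `Q`, `Z`; equivalently a pair of composable maps `𝔽₂Z → 𝔽₂Q → 𝔽₂X` of based spaces. -/
@[ext]
structure ParityChecks (X Q Z : Type*) where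
  /-- The parity-check matrix of the `X`-checks. -/
  HX : Matrix X Q (ZMod 2)
  /-- The parity-check matrix of the `Z`-checks. -/
  HZ : Matrix Z Q (ZMod 2)

/-- Relabelling of the checks and qubits. -/
def ParityChecks.reindex {X Q Z X' Q' Z' : Type*} (eX : X ≃ X') (eQ : Q ≃ Q') (eZ : Z ≃ Z')
    (P : ParityChecks X Q Z) : ParityChecks X' Q' Z' where
  HX := Matrix.reindex eX eQ P.HX
  HZ := Matrix.reindex eZ eQ P.HZ

/-- A CSS code, given by parity-check matrices that satisfy the orthogonality condition. -/
structure CSSCode (X Q Z : Type*) [Fintype Q] extends ParityChecks X Q Z where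
  orthogonal : HX * HZ.transpose = 0

/-- A `ℤ`-lift of a CSS code: a complex `ℤZ → ℤQ → ℤX` which reduces mod 2 to the complex
`𝔽₂Z → 𝔽₂Q → 𝔽₂X` of the code. -/
structure ZLift {X Q Z : Type*} [Fintype Q] (C : CSSCode X Q Z) where
  d1 : Matrix X Q ℤ
  d2 : Matrix Q Z ℤ
  d1_mul_d2 : d1 * d2 = 0
  d1_mod_two : d1.map (Int.cast : ℤ → ZMod 2) = C.HX
  d2_mod_two : d2.map (Int.cast : ℤ → ZMod 2) = C.HZ.transpose

section

variable {X Q Z : Type*} [Fintype X] [Fintype Q] [Fintype Z] {C : CSSCode X Q Z}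

/-- The legs of a qubit `q`, i.e. the edges at `q` of the lifted Tanner graph: `|(d1)_{x,q}|`
parallel edges from `x` to `q` for every `x`. -/
abbrev ZLift.Leg (D : ZLift C) (q : Q) : Type _ := Σ x : X, Fin (D.d1 x q).natAbs

/-- The edges of the lifted Tanner graph of `d1`. -/
abbrev ZLift.QEdge (D : ZLift C) : Type _ := Σ q : Q, D.Leg q

/-- The vertices of the subgraph of the lifted Tanner graph induced by `z`: the qubits in the
support of `z` and the `X`-checks adjacent to them. -/
def ZLift.inducedVertices (D : ZLift C) (z : Z) : Set (X ⊕ Q) :=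
  {v | Sum.elim (fun x => ∃ q, D.d2 q z ≠ 0 ∧ D.d1 x q ≠ 0) (fun q => D.d2 q z ≠ 0) v}

/-- The combinatorial data of the 1-skeleton of a cellular realization: besides the lifted Tanner
graph, which is determined by the `ℤ`-lift, a finite set of `Z`-type edges. Each of them belongs
to a `Z`-check `z` and joins two vertices of the subgraph induced by `z`. -/
structure OneSkeleton (D : ZLift C) where
  ZEdge : Type
  finite_ZEdge : Finite ZEdge
  check : ZEdge → Z
  src : ZEdge → X ⊕ Q
  tgt : ZEdge → X ⊕ Q
  src_mem : ∀ e, src e ∈ D.inducedVertices (check e)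
  tgt_mem : ∀ e, tgt e ∈ D.inducedVertices (check e)

/-- All edges of the 1-skeleton: the `Q`-type edges, which are those of the lifted Tanner graph,
and the `Z`-type edges. -/
abbrev OneSkeleton.Edge {D : ZLift C} (G : OneSkeleton D) : Type _ := D.QEdge ⊕ G.ZEdge

/-- The initial vertex of an edge; for an edge of the lifted Tanner graph, its `X`-vertex. -/
def OneSkeleton.initial {D : ZLift C} (G : OneSkeleton D) : G.Edge → X ⊕ Q :=
  Sum.elim (fun e => Sum.inl e.2.1) G.src

/-- The final vertex of an edge; for an edge of the lifted Tanner graph, its `Q`-vertex. -/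
def OneSkeleton.terminal {D : ZLift C} (G : OneSkeleton D) : G.Edge → X ⊕ Q :=
  Sum.elim (fun e => Sum.inr e.1) G.tgt

/-- The edges of the 1-skeleton that belong to the dressed cell of `z`: the edges of the subgraph
of the lifted Tanner graph induced by `z`, and the `Z`-type edges of `z`. -/
def OneSkeleton.edgesOf {D : ZLift C} (G : OneSkeleton D) (z : Z) : Set G.Edge :=
  {e | Sum.elim (fun e => D.d2 e.1 z ≠ 0) (fun e => G.check e = z) e}

/-! ## Cellular realizations -/

/-- The characteristic map of a cell of a CW complex, as a continuous map on the closed disk. -/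
def charMap {L : Type u} [TopologicalSpace L] [CWComplex (univ : Set L)] (n : ℕ)
    (c : RelCWComplex.cell (univ : Set L) n) : C(Disk n, L) where
  toFun v := RelCWComplex.map n c v.1
  continuous_toFun := (RelCWComplex.continuousOn n c).domRestrict

/-- The attaching map of a cell. -/
def attachMap {L : Type u} [TopologicalSpace L] [CWComplex (univ : Set L)] (n : ℕ)
    (c : RelCWComplex.cell (univ : Set L) (n + 1)) : C(Sph n, L) :=
  (charMap (n + 1) c).comp (sphToDisk n)

/-- A CW structure on `L` whose cells are labelled by the code: the 0-cells by `X ⊕ Q`, the 1-cells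
by the edges of the given 1-skeleton, the 3-, 4- and 5-cells by `X`, `Q`, `Z`. There are finitely
many 2-cells, each of them assigned to some `z`. -/
structure CellLabelling {D : ZLift C} (G : OneSkeleton D) (L : Type u) [TopologicalSpace L]
    [CWComplex (univ : Set L)] where
  cell0 : X ⊕ Q ≃ RelCWComplex.cell (univ : Set L) 0
  cell1 : G.Edge ≃ RelCWComplex.cell (univ : Set L) 1
  finite_cell2 : Finite (RelCWComplex.cell (univ : Set L) 2)
  label2 : RelCWComplex.cell (univ : Set L) 2 → Z
  cell3 : X ≃ RelCWComplex.cell (univ : Set L) 3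
  cell4 : Q ≃ RelCWComplex.cell (univ : Set L) 4
  cell5 : Z ≃ RelCWComplex.cell (univ : Set L) 5
  isEmpty_cell : ∀ n, 5 < n → IsEmpty (RelCWComplex.cell (univ : Set L) n)

namespace CellLabelling

variable {D : ZLift C} {G : OneSkeleton D} {L : Type u} [TopologicalSpace L]
  [CWComplex (univ : Set L)] (R : CellLabelling G L)

/-- The vertex of `L` labelled by an `X`-check or a qubit. -/
def vertex (v : X ⊕ Q) : L := RelCWComplex.map 0 (R.cell0 v) 0

/-- The graph of `z` in `L`: the subgraph of the lifted Tanner graph induced by `z`, together with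
the `Z`-type edges of `z`. -/
def graphOf (z : Z) : Set L :=
  R.vertex '' D.inducedVertices z ∪ ⋃ e ∈ G.edgesOf z, RelCWComplex.closedCell 1 (R.cell1 e)

/-- The graph of `z` together with the 2-cells assigned to `z`. -/
def twoComplexOf (z : Z) : Set L :=
  R.graphOf z ∪ ⋃ (c : RelCWComplex.cell (univ : Set L) 2) (_ : R.label2 c = z),
    RelCWComplex.closedCell 2 c

/-- The star of edges of the lifted Tanner graph at the vertex `q`, together with the 3-cells of
the adjacent `X`-checks. -/
def dressedStar (q : Q) : Set L :=
  {R.vertex (Sum.inr q)} ∪ ⋃ l : D.Leg q,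
    (RelCWComplex.closedCell 1 (R.cell1 (Sum.inl ⟨q, l⟩)) ∪
      RelCWComplex.closedCell 3 (R.cell3 l.1))

/-- The subcomplex to which the 5-cell of `z` is attached: the 2-complex of `z`, the 4-cells of the
qubits in the support of `z`, and the 3-cells of the adjacent `X`-checks. -/
def fourComplexOf (z : Z) : Set L :=
  R.twoComplexOf z ∪ ⋃ (q : Q) (_ : D.d2 q z ≠ 0),
    (R.dressedStar q ∪ RelCWComplex.closedCell 4 (R.cell4 q))

/-- The map from the cube `[-1,1]³` to `L` that follows a leg `l` of `q` inwards from the vertex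
`q` to the vertex `x` (on the shell `1/2 ≤ ‖v‖ ≤ 1`) and wraps the inner cube `‖v‖ ≤ 1/2` once
around the 3-cell of `x`, preserving or reversing the orientation according to the sign of
`(d1)_{x,q}`. -/
def legMap (q : Q) (l : D.Leg q) (v : Fin 3 → ℝ) : L :=
  open Classical in
  if ‖v‖ ≤ 1 / 2 then
    RelCWComplex.map 3 (R.cell3 l.1) ![2 * ((D.d1 l.1 q).sign : ℝ) * v 0, 2 * v 1, 2 * v 2]
  else RelCWComplex.map 1 (R.cell1 (Sum.inl ⟨q, l⟩)) (fun _ => 4 * ‖v‖ - 3)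

/-- The coordinate, in the `i`-th of `t` equal slabs of `[-1,1]`, rescaled so that the slab
becomes `[-1,1]`. -/
def slab (t : ℕ) (i : Fin t) (s : ℝ) : ℝ := t * (s + 1) - (2 * i + 1)

/-- `φ` is the standard attaching map of the 4-cell of `q`, a punctured 4-sphere with its cone of
edges: the top face of `∂[-1,1]⁴` is cut into as many slabs as `q` has legs, `φ` is given by
`legMap` on the slab of each leg, and it is constant, equal to the vertex `q`, elsewhere. -/
def IsStandardAttaching (q : Q) (φ : C(Sph 3, L)) : Prop :=
  (∀ (y : Sph 3) (l : D.Leg q), y.1 3 = 1 →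
    |slab _ (Fintype.equivFin (D.Leg q) l) (y.1 0)| ≤ 1 →
      φ y = R.legMap q l ![slab _ (Fintype.equivFin (D.Leg q) l) (y.1 0), y.1 1, y.1 2]) ∧
  (∀ y : Sph 3, (y.1 3 = 1 → IsEmpty (D.Leg q)) → φ y = R.vertex (Sum.inr q))

end CellLabelling

/-- The base point of the 3-sphere. -/
def basePoint : Sph 3 := ⟨fun _ => -1, by
  rw [mem_sphere_zero_iff_norm, pi_norm_const]
  simp⟩

/-- A cellular realization of a CSS code with a given `ℤ`-lift and a given 1-skeleton: a
5-dimensional finite CW complex `L` built as follows. -/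
structure CellularRealization {D : ZLift C} (G : OneSkeleton D) (L : Type u) [TopologicalSpace L]
    [CWComplex (univ : Set L)] extends CellLabelling G L where
  /-- Edges join their end points. -/
  map_initial : ∀ e, RelCWComplex.map 1 (cell1 e) (fun _ => -1) = toCellLabelling.vertex (G.initial e)
  map_terminal : ∀ e, RelCWComplex.map 1 (cell1 e) (fun _ => 1) = toCellLabelling.vertex (G.terminal e)
  /-- The 2-cells assigned to `z` are attached to the graph of `z`. -/
  attach2 : ∀ c, RelCWComplex.cellFrontier 2 c ⊆ toCellLabelling.graphOf (label2 c)
  /-- The 2-cells assigned to `z` make the graph of `z` simply connected. -/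
  simplyConnected : ∀ z, SimplyConnectedSpace (toCellLabelling.twoComplexOf z)
  /-- The boundary of the 3-cell of `x` is collapsed to the vertex `x`. -/
  attach3 : ∀ x y, attachMap 2 (cell3 x) y = toCellLabelling.vertex (Sum.inl x)
  /-- Up to a homotopy relative to the base point and inside the dressed star of `q`, the 4-cell
  of `q` is attached by the standard map. -/
  attach4 : ∀ q, ∃ φ : C(Sph 3, L), toCellLabelling.IsStandardAttaching q φ ∧
    (attachMap 3 (cell4 q)).HomotopicWith φ fun f =>
      f basePoint = toCellLabelling.vertex (Sum.inr q) ∧ range f ⊆ toCellLabelling.dressedStar q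
  /-- The 5-cell of `z` is attached to the subcomplex of `z` ... -/
  attach5 : ∀ z, range (attachMap 4 (cell5 z)) ⊆ toCellLabelling.fourComplexOf z
  /-- ... with the incidence numbers prescribed by the `ℤ`-lift. -/
  incidence5 : ∀ z q, incidence (charMap 5 (cell5 z)) (charMap 4 (cell4 q)) = D.d2 q z

end

/-! ## Coverings and cellular lifts -/

/-- A finite covering: a covering map with finite fibers. -/
def IsFiniteCovering {E L : Type*} [TopologicalSpace E] [TopologicalSpace L] (p : E → L) : Prop :=
  IsCoveringMap p ∧ ∀ b, (p ⁻¹' {b}).Finite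

/-- The cells of a covering space `E` of a CW complex that lie over a given cell, represented by
their characteristic maps: the lifts of the characteristic map of that cell. -/
def LiftedCell {E L : Type*} [TopologicalSpace E] [TopologicalSpace L] (p : E → L) {n : ℕ}
    (c : C(Disk n, L)) : Type _ :=
  {f : C(Disk n, E) // ∀ v, p (f v) = c v}

section

variable {X Q Z : Type*} [Fintype X] [Fintype Q] [Fintype Z] {C : CSSCode X Q Z}
  {D : ZLift C} {G : OneSkeleton D} {L : Type u} [TopologicalSpace L] [CWComplex (univ : Set L)]

/-- The cellular lift associated to a covering `p : E → L`: the part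
`𝒞₅(E, ℤ/2) → 𝒞₄(E, ℤ/2) → 𝒞₃(E, ℤ/2)` of the cellular chain complex of `E`, with its basis of
cells. -/
def CellularRealization.lift (R : CellularRealization G L) {E : Type*} [TopologicalSpace E]
    (p : E → L) :
    ParityChecks (Σ x : X, LiftedCell p (charMap 3 (R.cell3 x)))
      (Σ q : Q, LiftedCell p (charMap 4 (R.cell4 q)))
      (Σ z : Z, LiftedCell p (charMap 5 (R.cell5 z))) where
  HX := Matrix.of fun x q => ((incidence q.2.1 x.2.1 : ℤ) : ZMod 2)
  HZ := Matrix.of fun z q => ((incidence z.2.1 q.2.1 : ℤ) : ZMod 2)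

/-- `P` is, up to labelling of checks and qubits, a cellular lift of the code associated to some
finite covering of `L`. -/
def CellularRealization.IsCellularLift (R : CellularRealization G L) {X' Q' Z' : Type*}
    (P : ParityChecks X' Q' Z') : Prop :=
  ∃ (E : Type u) (_ : TopologicalSpace E) (p : E → L), IsFiniteCovering p ∧
    ∃ (eX : (Σ x : X, LiftedCell p (charMap 3 (R.cell3 x))) ≃ X')
      (eQ : (Σ q : Q, LiftedCell p (charMap 4 (R.cell4 q))) ≃ Q')
      (eZ : (Σ z : Z, LiftedCell p (charMap 5 (R.cell5 z))) ≃ Z'),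
      (R.lift p).reindex eX eQ eZ = P

end

end CellularLift

end

noncomputable section

set_option linter.unusedSectionVars false

namespace CellularLift

/-! ## Disks, spheres and quotient maps -/

/-! The incidence numbers of lifted 3-, 4- and 5-cells are determined by the way the fibres over the
vertices are joined through the 1-skeleton. Hence it suffices to find a finite covering of `L₂` that
looks like `p₁` over the common 1-skeleton, and then to compare incidence numbers.

Existence. Restrict `p₁` to the 1-skeleton and transport it to `L₂` along the identification `κ`.
The boundary of a 2-cell of `z` runs in the graph of `z`, and `p₁` is trivial there because the
graph lies in the simply connected 2-complex of `z` in `L₁`. So the covering extends over the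
2-cells. It extends over the higher cells because coverings of spheres of dimension at least two are
trivial. Coverings are not glued directly: a finite covering embedded fibrewise in `V` is a
continuous map to the space `FinSub V` of finite subsets, and such maps are extended cell by cell.
With `V` a space of sequences, any family of distinct points over a sphere extends to the disk
(`exists_extend_family`), so triviality of the covering over the boundary suffices
(`exists_extend_finSub`). The map classifying `p₁` is `fiberMap`, its extension to `L₂` is
`IsSkeletonMap.exists_classifying`, and the resulting covering is `IsSkeletonMap.exists_covering`.

Comparison of 4- and 3-cells. The homotopy from the attaching map to the standard map lifts, and
collapsing onto a lifted 3-cell stays continuous along it, so the incidence number may be computed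
from a lift of the standard map. That lift wraps around the lifted 3-cells at the far ends of the
lifted legs (`eq_lifted_standard_iff`). After collapsing, the maps of spheres obtained from the two
realizations are the same function (`incidence_four_three_eq`).

Comparison of 5- and 4-cells. A covering is trivial over the subcomplex of `z`
(`isTrivialOver_supportOf`), so the boundary of a lifted 5-cell stays in one sheet. The incidence
number is the prescribed one if the lifted 4-cell lies in that sheet, and otherwise the degree of a
constant map (`incidence_five_four`). Sheets correspond under the identification of the 1-skeletons.

No degree is ever evaluated, nor is its uniqueness used: equal or homotopic maps have equal degrees.
The second assertion follows from the first by exchanging the realizations. -/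

/-- A continuous function on a compact space which is constant on the fibres of a continuous
surjection onto a Hausdorff space descends to a continuous function. -/
theorem exists_continuous_descend {A B Y : Type*} [TopologicalSpace A] [TopologicalSpace B]
    [TopologicalSpace Y] [CompactSpace A] [T2Space B] {q : A → B} (hq : Continuous q)
    (hs : Function.Surjective q) {h : A → Y} (hh : Continuous h)
    (hc : ∀ a a', q a = q a' → h a = h a') : ∃ g : B → Y, Continuous g ∧ ∀ a, g (q a) = h a := by
  have hqm : IsQuotientMap q := hq.isClosedMap.isQuotientMap hq hs
  have hg : ∀ a, h (Function.surjInv hs (q a)) = h a := fun a =>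
    hc _ _ (Function.surjInv_eq hs (q a))
  refine ⟨fun b => h (Function.surjInv hs b), ?_, hg⟩
  rw [hqm.continuous_iff]
  exact hh.congr fun a => (hg a).symm

/-- A function is continuous on the image of a compact space if its pullback is continuous. -/
theorem continuousOn_range_of_comp {A B Y : Type*} [TopologicalSpace A] [TopologicalSpace B]
    [TopologicalSpace Y] [CompactSpace A] [T2Space B] {q : A → B} (hq : Continuous q)
    {h : B → Y} (hh : Continuous (h ∘ q)) : ContinuousOn h (range q) := by
  rw [continuousOn_iff_continuous_domRestrict]
  have hq' : Continuous (rangeFactorization q) := hq.subtype_mk _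
  have hqm : IsQuotientMap (rangeFactorization q) :=
    hq'.isClosedMap.isQuotientMap hq' rangeFactorization_surjective
  rw [hqm.continuous_iff]
  exact hh

instance contractibleSpace_disk (n : ℕ) : ContractibleSpace (Disk n) :=
  (convex_closedBall _ _).contractibleSpace ⟨0, by simp⟩

instance compactSpace_disk (n : ℕ) : CompactSpace (Disk n) :=
  isCompact_iff_compactSpace.1 (isCompact_closedBall _ _)

instance compactSpace_sph (n : ℕ) : CompactSpace (Sph n) :=
  isCompact_iff_compactSpace.1 (isCompact_sphere _ _)

/-- Clamping each coordinate to `[-1,1]` retracts `ℝⁿ` onto the cube, and local path connectedness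
passes to quotients. The lifting criterion for coverings requires it. -/
instance locallyPathConnectedSpace_disk (n : ℕ) : LocallyPathConnectedSpace (Disk n) := by
  have hmem : ∀ v : Fin n → ℝ, (fun i => max (-1) (min 1 (v i))) ∈ closedBall (0 : Fin n → ℝ) 1 := by
    intro v
    rw [mem_closedBall_zero_iff, pi_norm_le_iff_of_nonneg zero_le_one]
    intro i
    rw [Real.norm_eq_abs, abs_le]
    exact ⟨le_max_left _ _, max_le (by norm_num) (min_le_left _ _)⟩
  have hq : IsQuotientMap (fun v : Fin n → ℝ => (⟨_, hmem v⟩ : Disk n)) := by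
    refine IsQuotientMap.of_inverse continuous_subtype_val (by fun_prop) ?_
    intro v
    apply Subtype.ext
    funext i
    have h := (norm_le_pi_norm v.1 i).trans (mem_closedBall_zero_iff.1 v.2)
    rw [Real.norm_eq_abs, abs_le] at h
    simp [h.1, h.2]
  exact hq.locallyPathConnectedSpace

theorem preconnectedSpace_sph {n : ℕ} (hn : 1 ≤ n) : PreconnectedSpace (Sph n) := by
  refine Subtype.preconnectedSpace (isPreconnected_sphere ?_ _ _)
  rw [rank_fin_fun]
  exact_mod_cast Nat.lt_succ_of_le hn

/-- The corner `(-1, …, -1)` of the cube, as a point of its boundary. -/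
def corner (n : ℕ) : Sph n := ⟨fun _ => -1, by
  rw [mem_sphere_zero_iff_norm, pi_norm_const]
  simp⟩

/-- A point of the disk lies in the open disk or on the boundary sphere. -/
theorem disk_cases {n : ℕ} (v : Disk (n + 1)) :
    (∃ w : OpenDisk (n + 1), openToDisk _ w = v) ∨ ∃ y : Sph n, sphToDisk n y = v := by
  rcases (mem_closedBall_zero_iff.1 v.2).lt_or_eq with h | h
  · exact Or.inl ⟨⟨v.1, mem_ball_zero_iff.2 h⟩, rfl⟩
  · exact Or.inr ⟨⟨v.1, mem_sphere_zero_iff_norm.2 h⟩, rfl⟩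

theorem continuous_openToDisk (n : ℕ) : Continuous (openToDisk n) :=
  continuous_subtype_val.subtype_mk _

theorem isOpenMap_openToDisk (n : ℕ) : IsOpenMap (openToDisk n) := by
  intro U hU
  have h : openToDisk n '' U = Subtype.val ⁻¹' (Subtype.val '' U : Set (Fin n → ℝ)) := by
    ext v
    constructor
    · rintro ⟨w, hw, rfl⟩
      exact ⟨w, hw, rfl⟩
    · rintro ⟨w, hw, h⟩
      exact ⟨w, hw, Subtype.ext h⟩
  rw [h]
  exact (isOpen_ball.isOpenMap_subtype_val _ hU).preimage continuous_subtype_val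

theorem openToDisk_injective (n : ℕ) : Function.Injective (openToDisk n) := fun _ _ h =>
  Subtype.ext (congrArg (fun v : Disk n => v.1) h)

/-- The projection `Dⁿ → Dⁿ / ∂Dⁿ`. -/
theorem continuous_collapse_id (n : ℕ) : Continuous (collapse (id : Disk n → Disk n)) := by
  have hinj : ∀ v w : OpenDisk n, id (openToDisk n v) = id (openToDisk n w) → v = w :=
    fun _ _ h => openToDisk_injective n h
  have hmem : ∀ (S : Set (OpenDisk n)) (y : Disk n),
      (∃ v ∈ S, collapse id y = (v : OnePoint (OpenDisk n))) ↔ y ∈ openToDisk n '' S := by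
    intro S y
    constructor
    · rintro ⟨v, hv, h⟩
      by_cases h' : ∃ w : OpenDisk n, openToDisk n w = y
      · obtain ⟨w, rfl⟩ := h'
        rw [show openToDisk n w = id (openToDisk n w) from rfl, collapse_apply hinj,
          OnePoint.coe_eq_coe] at h
        exact ⟨v, hv, by rw [h]⟩
      · simp [collapse, h'] at h
    · rintro ⟨v, hv, rfl⟩
      exact ⟨v, hv, collapse_apply hinj v⟩
  rw [continuous_def]
  intro U hU
  rw [OnePoint.isOpen_def] at hU
  by_cases hinf : OnePoint.infty ∈ U
  · have heq : collapse (id : Disk n → Disk n) ⁻¹' U = (openToDisk n ''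
        ((fun v : OpenDisk n => (v : OnePoint (OpenDisk n))) ⁻¹' U)ᶜ)ᶜ := by
      ext y
      rw [mem_compl_iff, ← hmem]
      constructor
      · rintro hy ⟨v, hv, h⟩
        rw [mem_preimage, h] at hy
        exact hv hy
      · intro hy
        rw [mem_preimage]
        rcases h : collapse (id : Disk n → Disk n) y with _ | v
        · exact hinf
        · by_contra hv
          exact hy ⟨v, hv, h⟩
    rw [heq]
    exact ((hU.1 hinf).image (continuous_openToDisk n)).isClosed.isOpen_compl
  · have heq : collapse (id : Disk n → Disk n) ⁻¹' U = openToDisk n ''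
        ((fun v : OpenDisk n => (v : OnePoint (OpenDisk n))) ⁻¹' U) := by
      ext y
      rw [← hmem]
      constructor
      · intro hy
        rw [mem_preimage] at hy
        rcases h : collapse (id : Disk n → Disk n) y with _ | v
        · rw [h] at hy
          exact absurd hy hinf
        · rw [h] at hy
          exact ⟨v, hy, rfl⟩
      · rintro ⟨v, hv, h⟩
        rw [mem_preimage, h]
        exact hv
    rw [heq]
    exact isOpenMap_openToDisk n _ hU.2

theorem collapse_eq_coe_iff {Y : Type*} {n : ℕ} {τ : Disk n → Y}
    (hτ : ∀ v w : OpenDisk n, τ (openToDisk n v) = τ (openToDisk n w) → v = w) (y : Y)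
    (v : OpenDisk n) : collapse τ y = (v : OnePoint (OpenDisk n)) ↔ τ (openToDisk n v) = y := by
  constructor
  · intro h
    by_cases h' : ∃ w : OpenDisk n, τ (openToDisk n w) = y
    · obtain ⟨w, rfl⟩ := h'
      rw [collapse_apply hτ, OnePoint.coe_eq_coe] at h
      rw [h]
    · simp [collapse, h'] at h
  · rintro rfl
    exact collapse_apply hτ v

theorem collapse_eq_infty {Y : Type*} {n : ℕ} {τ : Disk n → Y} {y : Y}
    (h : ∀ v : OpenDisk n, τ (openToDisk n v) ≠ y) : collapse τ y = OnePoint.infty := by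
  unfold collapse
  rw [dif_neg]
  rintro ⟨v, hv⟩
  exact h v hv

/-- Two collapse maps agree at points which have the same preimages. -/
theorem collapse_eq_collapse {Y Y' : Type*} {n : ℕ} {τ : Disk n → Y} {τ' : Disk n → Y'}
    (hτ : ∀ v w : OpenDisk n, τ (openToDisk n v) = τ (openToDisk n w) → v = w)
    (hτ' : ∀ v w : OpenDisk n, τ' (openToDisk n v) = τ' (openToDisk n w) → v = w) {y : Y} {y' : Y'}
    (h : ∀ v : OpenDisk n, τ (openToDisk n v) = y ↔ τ' (openToDisk n v) = y') :
    collapse τ y = collapse τ' y' := by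
  rcases hc : collapse τ' y' with _ | v
  · refine collapse_eq_infty fun v hv => ?_
    rw [(collapse_eq_coe_iff hτ' y' v).2 ((h v).1 hv)] at hc
    exact OnePoint.coe_ne_infty _ hc
  · exact (collapse_eq_coe_iff hτ y v).2 ((h v).2 ((collapse_eq_coe_iff hτ' y' v).1 hc))

/-! ## Homotopy invariance of the degree -/

theorem homologyMap_eq_of_homotopic (n : ℕ) {A B : Type} [TopologicalSpace A] [TopologicalSpace B]
    {f g : C(A, B)} (h : f.Homotopic g) : homologyMap n f = homologyMap n g :=
  TopCat.Homotopy.congr_homologyMap_singularChainComplexFunctor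
    (f := TopCat.ofHom f) (g := TopCat.ofHom g) h.some (ModuleCat.of ℤ ℤ) n

theorem degree_eq_of_homotopic {n : ℕ} {f g : C(Sph n, OnePoint (OpenDisk n))}
    (h : f.Homotopic g) : degree (f : Sph n → OnePoint (OpenDisk n)) = degree g := by
  have hd : ∀ d, HasDegree f d ↔ HasDegree g d := fun d => by
    unfold HasDegree
    rw [homologyMap_eq_of_homotopic n h]
  -- `degree` is a chosen solution `d`. Equality of the two predicates as functions makes the
  -- choices equal, whether or not `d` is unique.
  have hkey : (fun d => HasDegree (⟨f, f.continuous⟩ : C(Sph n, OnePoint (OpenDisk n))) d) =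
      fun d => HasDegree (⟨g, g.continuous⟩ : C(Sph n, OnePoint (OpenDisk n))) d :=
    funext fun d => propext (hd d)
  unfold degree
  by_cases hg : ∃ d, HasDegree g d
  · obtain ⟨d, hg⟩ := hg
    rw [dif_pos ⟨f.continuous, d, (hd d).2 hg⟩, dif_pos ⟨g.continuous, d, hg⟩]
    congr 1
  · rw [dif_neg, dif_neg]
    · rintro ⟨_, d, hd'⟩
      exact hg ⟨d, hd'⟩
    · rintro ⟨_, d, hd'⟩
      exact hg ⟨d, (hd d).1 hd'⟩

/-! ## Covering maps, lifted cells and sections over spheres -/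

theorem t2Space_of_isCoveringMap {E L : Type*} [TopologicalSpace E] [TopologicalSpace L] [T2Space L]
    {p : E → L} (hp : IsCoveringMap p) : T2Space E := by
  refine ⟨fun a b hab => ?_⟩
  by_cases h : p a = p b
  · exact hp.isSeparatedMap a b h hab
  · obtain ⟨U, V, hU, hV, ha, hb, hd⟩ := t2_separation h
    exact ⟨_, _, hU.preimage hp.continuous, hV.preimage hp.continuous, ha, hb, hd.preimage p⟩

/-- The lifting criterion in the form used for disks and for the 2-complexes of the `Z`-checks. -/
theorem exists_lift_through {E L : Type*} [TopologicalSpace E] [TopologicalSpace L]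
    {p : E → L} (hp : IsCoveringMap p) {A : Type*} [TopologicalSpace A] [SimplyConnectedSpace A]
    [LocallyPathConnectedSpace A] (c : C(A, L)) (a : A) (e : E) (he : p e = c a) :
    ∃ f : C(A, E), (∀ v, p (f v) = c v) ∧ f a = e := by
  obtain ⟨F, ⟨h1, h2⟩, -⟩ := hp.existsUnique_continuousMap_lifts c a e he
  exact ⟨F, fun v => congrFun h2 v, h1⟩

theorem lift_unique {E L : Type*} [TopologicalSpace E] [TopologicalSpace L]
    {p : E → L} (hp : IsCoveringMap p) {A : Type*} [TopologicalSpace A] [PreconnectedSpace A]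
    {f g : A → E} (hf : Continuous f) (hg : Continuous g) (h : ∀ a, p (f a) = p (g a)) (a : A)
    (ha : f a = g a) (b : A) : f b = g b :=
  congrFun (hp.eq_of_comp_eq hf hg (funext h) a ha) b

/-- Evaluation of the lifts of a cell at a point is a bijection onto the fibre. -/
def liftedCellEquiv {E L : Type*} [TopologicalSpace E] [TopologicalSpace L]
    {p : E → L} (hp : IsCoveringMap p) {n : ℕ} (c : C(Disk n, L)) (v : Disk n) :
    LiftedCell p c ≃ p ⁻¹' {c v} :=
  Equiv.ofBijective (fun f => ⟨f.1 v, f.2 v⟩) <| by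
    constructor
    · intro f g h
      apply Subtype.ext
      ext w
      exact lift_unique hp f.1.continuous g.1.continuous (fun a => (f.2 a).trans (g.2 a).symm) v
        (congrArg Subtype.val h) w
    · rintro ⟨e, he⟩
      obtain ⟨f, h1, h2⟩ := exists_lift_through hp c v e he
      exact ⟨⟨f, h1⟩, Subtype.ext h2⟩

@[simp]
theorem liftedCellEquiv_coe {E L : Type*} [TopologicalSpace E] [TopologicalSpace L]
    {p : E → L} (hp : IsCoveringMap p) {n : ℕ} (c : C(Disk n, L)) (v : Disk n)
    (f : LiftedCell p c) : (liftedCellEquiv hp c v f : E) = f.1 v := rfl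

/-- A covering of a space obtained by gluing two disks along their boundaries has sections, if the
boundary is connected. -/
theorem exists_section_of_two_disks {E M : Type*} [TopologicalSpace E] [TopologicalSpace M]
    [T2Space M] {p : E → M} (hp : IsCoveringMap p) {m : ℕ} (hm : 1 ≤ m) (a b : C(Disk (m + 1), M))
    (hab : ∀ y, y ∈ range a ∨ y ∈ range b) (ha : Function.Injective a) (hb : Function.Injective b)
    (hbd : ∀ y, a (sphToDisk m y) = b (sphToDisk m y))
    (hint : ∀ v w, a v = b w → v = w ∧ ∃ y, sphToDisk m y = v)
    (e : E) (he : p e ∈ range a) : ∃ s : C(M, E), (∀ y, p (s y) = y) ∧ s (p e) = e := by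
  obtain ⟨v, hv⟩ := he
  obtain ⟨f, hf, hfv⟩ := exists_lift_through hp a v e hv.symm
  -- The second lift starts where the first one is at the corner. Since the common boundary is
  -- connected, the two lifts then agree on all of it and glue.
  obtain ⟨g, hg, hgv⟩ := exists_lift_through hp b (sphToDisk m (corner m))
    (f (sphToDisk m (corner m))) (by rw [hf, hbd])
  have := preconnectedSpace_sph hm
  have hfg : ∀ y, f (sphToDisk m y) = g (sphToDisk m y) := by
    intro y
    refine lift_unique hp (f := fun y => f (sphToDisk m y)) (g := fun y => g (sphToDisk m y))
      (by fun_prop) (by fun_prop) (fun y => ?_) (corner m) hgv.symm y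
    rw [hf, hg, hbd]
  have hsurj : Function.Surjective (Sum.elim (a : Disk (m + 1) → M) b) := by
    intro y
    rcases hab y with ⟨w, rfl⟩ | ⟨w, rfl⟩
    · exact ⟨Sum.inl w, rfl⟩
    · exact ⟨Sum.inr w, rfl⟩
  obtain ⟨s, hs, hsq⟩ := exists_continuous_descend
    (a.continuous.sumElim b.continuous) hsurj
    (f.continuous.sumElim g.continuous) <| by
      rintro (v | v) (w | w) h
      · rw [ha h]
      · obtain ⟨rfl, y, rfl⟩ := hint v w h
        exact hfg y
      · obtain ⟨rfl, y, rfl⟩ := hint w v h.symm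
        exact (hfg y).symm
      · rw [hb h]
  have hps : ∀ y, p (s y) = y := by
    intro y
    rcases hab y with ⟨w, rfl⟩ | ⟨w, rfl⟩
    · rw [show a w = Sum.elim (⇑a) (⇑b) (Sum.inl w) from rfl, hsq]
      exact hf w
    · rw [show b w = Sum.elim (⇑a) (⇑b) (Sum.inr w) from rfl, hsq]
      exact hg w
  refine ⟨⟨s, hs⟩, hps, ?_⟩
  have := hsq (Sum.inl v)
  simp only [Sum.elim_inl] at this
  rw [hv, hfv] at this
  exact this

/-! ### The sphere as two disks glued along their boundaries -/

theorem continuous_topFace (n : ℕ) : Continuous (topFace n) := by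
  refine Continuous.subtype_mk (continuous_pi fun i => ?_) _
  refine Fin.lastCases ?_ (fun j => ?_) i
  · simp [continuous_const]
  · simp only [Fin.snoc_castSucc]
    exact (continuous_apply j).comp continuous_subtype_val

theorem topFace_last (n : ℕ) (v : Disk n) : (topFace n v).1 (Fin.last n) = 1 := by simp [topFace]

theorem topFace_castSucc (n : ℕ) (v : Disk n) (j : Fin n) :
    (topFace n v).1 j.castSucc = v.1 j := by simp [topFace]

/-- The union of the faces of the cube other than the top face, as an image of a disk. -/
def bottomFaces (n : ℕ) (v : Disk n) : Sph n :=
  -- The cube of radius `1/2` is doubled onto the face at height `-1 = 4 * (1/2) - 3`. The shell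
  -- around it is pushed radially onto the side faces, with height rising to `1` at the boundary.
  ⟨Fin.snoc (α := fun _ => ℝ) ((max ‖v.1‖ (1 / 2))⁻¹ • v.1) (4 * max ‖v.1‖ (1 / 2) - 3), by
    have hv : ‖v.1‖ ≤ 1 := mem_closedBall_zero_iff.1 v.2
    have hm : (1 / 2 : ℝ) ≤ max ‖v.1‖ (1 / 2) := le_max_right _ _
    have hm1 : max ‖v.1‖ (1 / 2) ≤ 1 := max_le hv (by norm_num)
    have hw : ‖(max ‖v.1‖ (1 / 2))⁻¹ • v.1‖ ≤ 1 := by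
      rw [norm_smul, norm_inv, Real.norm_of_nonneg (by linarith), inv_mul_le_one₀ (by linarith)]
      exact le_max_left _ _
    have hlast : |4 * max ‖v.1‖ (1 / 2) - 3| ≤ 1 := by
      rw [abs_le]
      constructor <;> linarith
    rw [mem_sphere_zero_iff_norm]
    apply le_antisymm
    · rw [pi_norm_le_iff_of_nonneg zero_le_one]
      intro i
      refine Fin.lastCases ?_ (fun j => ?_) i
      · simpa using hlast
      · simpa using (norm_le_pi_norm _ j).trans hw
    · rcases le_total ‖v.1‖ (1 / 2) with h | h
      · refine le_trans ?_ (norm_le_pi_norm _ (Fin.last n))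
        rw [Fin.snoc_last, max_eq_right h]
        norm_num
      · have h0 : ‖v.1‖ ≠ 0 := by
          intro h0
          rw [h0] at h
          norm_num at h
        have h1 : ‖(max ‖v.1‖ (1 / 2))⁻¹ • v.1‖ = 1 := by
          rw [max_eq_left h, norm_smul, norm_inv, norm_norm, inv_mul_cancel₀ h0]
        refine h1.ge.trans ((pi_norm_le_iff_of_nonneg (norm_nonneg _)).2 fun j => ?_)
        refine le_trans (le_of_eq ?_) (norm_le_pi_norm _ j.castSucc)
        rw [Fin.snoc_castSucc]⟩

theorem bottomFaces_last (n : ℕ) (v : Disk n) :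
    (bottomFaces n v).1 (Fin.last n) = 4 * max ‖v.1‖ (1 / 2) - 3 := by simp [bottomFaces]

theorem bottomFaces_castSucc (n : ℕ) (v : Disk n) (j : Fin n) :
    (bottomFaces n v).1 j.castSucc = (max ‖v.1‖ (1 / 2))⁻¹ * v.1 j := by simp [bottomFaces]

theorem continuous_bottomFaces (n : ℕ) : Continuous (bottomFaces n) := by
  have hpos : ∀ v : Disk n, max ‖v.1‖ (1 / 2) ≠ 0 := fun v =>
    (lt_of_lt_of_le (by norm_num) (le_max_right _ _)).ne'
  have hc : Continuous fun v : Disk n => max ‖v.1‖ (1 / 2) := by fun_prop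
  refine Continuous.subtype_mk (continuous_pi fun i => ?_) _
  refine Fin.lastCases ?_ (fun j => ?_) i
  · simp only [Fin.snoc_last]
    fun_prop
  · simp only [Fin.snoc_castSucc, Pi.smul_apply, smul_eq_mul]
    exact (hc.inv₀ hpos).mul ((continuous_apply j).comp continuous_subtype_val)

theorem norm_sphToDisk {n : ℕ} (y : Sph n) : ‖(sphToDisk n y).1‖ = 1 :=
  mem_sphere_zero_iff_norm.1 y.2

theorem sph_mem_range_topFace_or_bottomFaces {n : ℕ} (y : Sph n) :
    y ∈ range (topFace n) ∨ y ∈ range (bottomFaces n) := by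
  have hy : ‖y.1‖ = 1 := mem_sphere_zero_iff_norm.1 y.2
  set u : Fin n → ℝ := Fin.init (α := fun _ => ℝ) y.1 with hu
  have hcoord : ∀ i, ‖y.1 i‖ ≤ 1 := fun i => (norm_le_pi_norm y.1 i).trans hy.le
  have hun : ‖u‖ ≤ 1 := (pi_norm_le_iff_of_nonneg zero_le_one).2 fun j => hcoord _
  have ht := abs_le.1 (hcoord (Fin.last n))
  rcases hun.lt_or_eq with h | h
  · have hlast : |y.1 (Fin.last n)| = 1 := by
      refine le_antisymm (hcoord _) (not_lt.1 fun hlt => ?_)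
      have : ‖y.1‖ < 1 := by
        rw [pi_norm_lt_iff zero_lt_one]
        intro i
        refine Fin.lastCases hlt (fun j => ?_) i
        exact (norm_le_pi_norm u j).trans_lt h
      linarith
    rcases eq_or_eq_neg_of_abs_eq hlast with h1 | h1
    · refine Or.inl ⟨⟨u, mem_closedBall_zero_iff.2 hun⟩, ?_⟩
      apply Subtype.ext
      funext i
      refine Fin.lastCases ?_ (fun j => ?_) i
      · rw [topFace_last, h1]
      · rw [topFace_castSucc]
        rfl
    · have hn : ‖(1 / 2 : ℝ) • u‖ ≤ 1 / 2 := by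
        rw [norm_smul, Real.norm_of_nonneg (by norm_num)]
        linarith
      refine Or.inr ⟨⟨(1 / 2 : ℝ) • u, mem_closedBall_zero_iff.2 (by linarith)⟩, ?_⟩
      apply Subtype.ext
      funext i
      refine Fin.lastCases ?_ (fun j => ?_) i
      · rw [bottomFaces_last, h1, max_eq_right hn]
        norm_num
      · rw [bottomFaces_castSucc, max_eq_right hn]
        simp [hu, Fin.init]
  · have hn : ‖((y.1 (Fin.last n) + 3) / 4) • u‖ = (y.1 (Fin.last n) + 3) / 4 := by
      rw [norm_smul, h, Real.norm_of_nonneg (by linarith), mul_one]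
    refine Or.inr ⟨⟨((y.1 (Fin.last n) + 3) / 4) • u,
      mem_closedBall_zero_iff.2 (by linarith)⟩, ?_⟩
    apply Subtype.ext
    funext i
    refine Fin.lastCases ?_ (fun j => ?_) i
    · rw [bottomFaces_last]
      simp only [hn]
      rw [max_eq_left (by linarith)]
      ring
    · rw [bottomFaces_castSucc]
      simp only [hn]
      rw [max_eq_left (by linarith)]
      simp only [Pi.smul_apply, smul_eq_mul]
      rw [inv_mul_cancel_left₀ (by linarith)]
      rfl

/-- The top face and the remaining faces are disks meeting in the rim of the top face, an
`(n-1)`-sphere, which is connected because `n ≥ 2`. This serves in place of simple connectivity of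
the sphere. -/
theorem exists_section_sphere {E : Type*} [TopologicalSpace E] {n : ℕ} (hn : 2 ≤ n)
    {p : E → Sph n} (hp : IsCoveringMap p) (e : E) :
    ∃ s : C(Sph n, E), (∀ y, p (s y) = y) ∧ s (p e) = e := by
  obtain ⟨m, rfl⟩ : ∃ m, n = m + 1 := ⟨n - 1, by omega⟩
  have hm : 1 ≤ m := by omega
  let a : C(Disk (m + 1), Sph (m + 1)) := ⟨topFace (m + 1), continuous_topFace _⟩
  let b : C(Disk (m + 1), Sph (m + 1)) := ⟨bottomFaces (m + 1), continuous_bottomFaces _⟩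
  have ha : Function.Injective a := by
    intro v w h
    apply Subtype.ext
    funext j
    have := congrArg (fun y : Sph (m + 1) => y.1 j.castSucc) h
    simpa only [a, ContinuousMap.coe_mk, topFace_castSucc] using this
  have hb : Function.Injective b := by
    intro v w h
    have h1 := congrArg (fun y : Sph (m + 1) => y.1 (Fin.last _)) h
    simp only [b, ContinuousMap.coe_mk, bottomFaces_last] at h1
    have h2 : max ‖v.1‖ (1 / 2) = max ‖w.1‖ (1 / 2) := by linarith
    have hpos : (max ‖w.1‖ (1 / 2))⁻¹ ≠ 0 :=
      inv_ne_zero (lt_of_lt_of_le (by norm_num) (le_max_right _ _)).ne'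
    apply Subtype.ext
    funext j
    have := congrArg (fun y : Sph (m + 1) => y.1 j.castSucc) h
    simp only [b, ContinuousMap.coe_mk, bottomFaces_castSucc, h2] at this
    exact mul_left_cancel₀ hpos this
  have hbd : ∀ y, a (sphToDisk m y) = b (sphToDisk m y) := by
    intro y
    apply Subtype.ext
    funext i
    simp only [a, b, ContinuousMap.coe_mk]
    refine Fin.lastCases ?_ (fun j => ?_) i
    · rw [topFace_last, bottomFaces_last, norm_sphToDisk]
      norm_num
    · rw [topFace_castSucc, bottomFaces_castSucc, norm_sphToDisk]
      norm_num
  have hint : ∀ v w, a v = b w → v = w ∧ ∃ y, sphToDisk m y = v := by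
    intro v w h
    have h1 := congrArg (fun y : Sph (m + 1) => y.1 (Fin.last _)) h
    simp only [a, b, ContinuousMap.coe_mk, topFace_last, bottomFaces_last] at h1
    have h2 : max ‖w.1‖ (1 / 2) = 1 := by linarith
    have h3 : ‖w.1‖ = 1 := by
      rcases max_choice ‖w.1‖ (1 / 2) with h | h
      · rw [← h, h2]
      · rw [h] at h2
        norm_num at h2
    have hw : ∃ y, sphToDisk m y = w := ⟨⟨w.1, mem_sphere_zero_iff_norm.2 h3⟩, rfl⟩
    have hvw : v = w := by
      obtain ⟨y, rfl⟩ := hw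
      rw [← hbd] at h
      exact ha h
    exact ⟨hvw, hvw ▸ hw⟩
  rcases sph_mem_range_topFace_or_bottomFaces (p e) with h | h
  · exact exists_section_of_two_disks hp hm a b sph_mem_range_topFace_or_bottomFaces ha hb hbd hint
      e h
  · refine exists_section_of_two_disks hp hm b a
      (fun y => (sph_mem_range_topFace_or_bottomFaces y).symm) hb ha (fun y => (hbd y).symm) ?_ e h
    intro v w h
    obtain ⟨h1, h2⟩ := hint w v h.symm
    exact ⟨h1.symm, h1 ▸ h2⟩

/-! ## The space of finite subsets as a classifying space for finite coverings -/

/-- Finite families of distinct points of `V`. -/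
abbrev Config (V : Type*) : Type _ := Σ k : ℕ, {w : Fin k → V // Function.Injective w}

/-- The finite subsets of `V`. -/
def FinSub (V : Type*) : Type _ := {S : Set V // S.Finite}

/-- The finite set of the members of a family. -/
def Config.toFinSub {V : Type*} (w : Config V) : FinSub V := ⟨range w.2.1, finite_range _⟩

/-- The finite set of the members of a finite family. -/
def FinSub.ofFamily {V ι : Type*} [Finite ι] (w : ι → V) : FinSub V := ⟨range w, finite_range w⟩

theorem FinSub.ext {V : Type*} {S S' : FinSub V} (h : S.1 = S'.1) : S = S' := Subtype.ext h

theorem Config.toFinSub_eq_iff {V : Type*} {w w' : Config V} : w.toFinSub = w'.toFinSub ↔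
    ∃ σ : Fin w.1 ≃ Fin w'.1, w'.2.1 ∘ σ = w.2.1 := by
  constructor
  · intro h
    have h' : range w.2.1 = range w'.2.1 := congrArg Subtype.val h
    refine ⟨(Equiv.ofInjective _ w.2.2).trans
      ((Equiv.setCongr h').trans (Equiv.ofInjective _ w'.2.2).symm), ?_⟩
    funext i
    simp [Equiv.apply_ofInjective_symm]
  · rintro ⟨σ, hσ⟩
    apply Subtype.ext
    change range w.2.1 = range w'.2.1
    rw [← hσ, σ.surjective.range_comp]

/-- The covering classified by a map to the finite subsets. -/
abbrev TotalSpace {V M : Type*} (f : M → FinSub V) : Type _ := {x : M × V // x.2 ∈ (f x.1).1}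

/-- The projection of the covering classified by `f`. -/
def TotalSpace.proj {V M : Type*} (f : M → FinSub V) (x : TotalSpace f) : M := x.1.1

theorem finite_fiber_proj {V M : Type*} (f : M → FinSub V) (b : M) :
    (TotalSpace.proj f ⁻¹' {b}).Finite := by
  refine Finite.of_finite_image (f := fun x : TotalSpace f => x.1.2) ((f b).2.subset ?_) ?_
  · rintro _ ⟨x, hx, rfl⟩
    rw [← show x.1.1 = b from hx]
    exact x.2
  · intro x hx y hy h
    exact Subtype.ext (Prod.ext ((show x.1.1 = b from hx).trans (show y.1.1 = b from hy).symm) h)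

variable {V : Type*} [TopologicalSpace V]

/-- The topology on the finite subsets for which they are locally the images of continuous families
of distinct points. -/
instance : TopologicalSpace (FinSub V) := .coinduced Config.toFinSub inferInstance

theorem continuous_toFinSub : Continuous (Config.toFinSub : Config V → FinSub V) :=
  continuous_coinduced_rng

/-- Two families list the same set exactly when they differ by a permutation, so the saturation of
an open set is the union of its permuted copies. -/
theorem isOpenMap_toFinSub : IsOpenMap (Config.toFinSub : Config V → FinSub V) := by
  intro O hO
  rw [isOpen_coinduced, isOpen_sigma_iff]
  intro k
  have h : Sigma.mk k ⁻¹' (Config.toFinSub ⁻¹' (Config.toFinSub '' O)) =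
      ⋃ σ : Equiv.Perm (Fin k), (fun w : {w : Fin k → V // Function.Injective w} =>
        (⟨k, ⟨w.1 ∘ σ, w.2.comp σ.injective⟩⟩ : Config V)) ⁻¹' O := by
    ext w
    simp only [mem_preimage, mem_image, mem_iUnion]
    constructor
    · rintro ⟨⟨l, w'⟩, hw', h⟩
      obtain ⟨σ, hσ⟩ := Config.toFinSub_eq_iff.1 h
      have hl : l = k := by simpa using Fintype.card_congr σ
      subst hl
      refine ⟨σ, ?_⟩
      convert hw'
    · rintro ⟨σ, hσ⟩
      exact ⟨_, hσ, Config.toFinSub_eq_iff.2 ⟨σ, rfl⟩⟩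
  rw [h]
  refine isOpen_iUnion fun σ => hO.preimage ?_
  refine continuous_sigmaMk.comp (Continuous.subtype_mk ?_ _)
  exact continuous_pi fun i => (continuous_apply (σ i)).comp continuous_subtype_val

/-- Near each point, the points of a finite subset can be listed continuously. -/
theorem FinSub.exists_local_listing [T2Space V] (S : FinSub V) : ∃ (N : Set (FinSub V)) (k : ℕ)
    (t : Fin k → FinSub V → V), IsOpen N ∧ S ∈ N ∧ (∀ i, ContinuousOn (t i) N) ∧
      ∀ S' ∈ N, Function.Injective (fun i => t i S') ∧ range (fun i => t i S') = S'.1 := by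
  have : Finite S.1 := S.2
  obtain ⟨k, ⟨e⟩⟩ := Finite.exists_equiv_fin S.1
  let w₀ : Fin k → V := fun i => (e.symm i : V)
  have hw₀ : Function.Injective w₀ := Subtype.val_injective.comp e.symm.injective
  have hr₀ : Config.toFinSub ⟨k, ⟨w₀, hw₀⟩⟩ = S := by
    apply Subtype.ext
    change range w₀ = S.1
    ext v
    exact ⟨by rintro ⟨i, rfl⟩; exact (e.symm i).2, fun hv => ⟨e ⟨v, hv⟩, by simp [w₀]⟩⟩
  obtain ⟨O, hO, hd⟩ := Set.Finite.t2_separation (s := S.1) S.2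
  -- The `i`-th point is confined to a neighbourhood of the `i`-th point of `S`, and these
  -- neighbourhoods are disjoint. No nontrivial permutation is then possible, so `toFinSub` is an
  -- open embedding on `Ω` and its inverse lists the points.
  let Ω : Set {w : Fin k → V // Function.Injective w} := {w | ∀ i, w.1 i ∈ O (w₀ i)}
  have hΩ : IsOpen Ω := by
    have : Ω = ⋂ i, (fun w : {w : Fin k → V // Function.Injective w} => w.1 i) ⁻¹' O (w₀ i) := by
      ext w
      simp [Ω]
    rw [this]
    exact isOpen_iInter_of_finite fun i => (hO _).2.preimage
      ((continuous_apply i).comp continuous_subtype_val)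
  let φ : Ω → FinSub V := fun w => Config.toFinSub ⟨k, w.1⟩
  have hφc : Continuous φ :=
    continuous_toFinSub.comp (continuous_sigmaMk.comp continuous_subtype_val)
  have hφo : IsOpenMap φ :=
    isOpenMap_toFinSub.comp (isOpenMap_sigmaMk.comp (hΩ.isOpenMap_subtype_val))
  have hφi : Function.Injective φ := by
    intro w w' h
    obtain ⟨σ, hσ⟩ := Config.toFinSub_eq_iff.1 h
    apply Subtype.ext
    apply Subtype.ext
    funext i
    have h1 : w'.1.1 (σ i) = w.1.1 i := congrFun hσ i
    have h2 : σ i = i := by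
      by_contra hne
      have h3 : w₀ (σ i) ≠ w₀ i := fun h => hne (hw₀ h)
      refine (hd (e.symm (σ i)).2 (e.symm i).2 h3).le_bot ⟨w'.2 (σ i), ?_⟩
      rw [h1]
      exact w.2 i
    rw [← h1, h2]
  have hφ : IsOpenEmbedding φ := .of_continuous_injective_isOpenMap hφc hφi hφo
  have : Nonempty Ω := ⟨⟨⟨w₀, hw₀⟩, fun i => (hO _).1⟩⟩
  let ψ := hφ.toOpenPartialHomeomorph φ
  have hψ : ∀ S' ∈ range φ, φ (ψ.symm S') = S' := fun S' hS' =>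
    ψ.right_inv (by simpa [ψ] using hS')
  refine ⟨range φ, k, fun i S' => (ψ.symm S').1.1 i, hφ.isOpen_range, ?_, fun i => ?_, ?_⟩
  · exact ⟨⟨⟨w₀, hw₀⟩, fun i => (hO _).1⟩, hr₀⟩
  · have h1 : ContinuousOn ψ.symm (range φ) := by
      have := ψ.continuousOn_symm
      simpa [ψ] using this
    exact ((continuous_apply i).comp
      (continuous_subtype_val.comp continuous_subtype_val)).comp_continuousOn h1
  · intro S' hS'
    exact ⟨(ψ.symm S').1.2, congrArg Subtype.val (hψ S' hS')⟩

/-- A finite family of functions with distinct values gives a continuous map to the finite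
subsets. -/
theorem continuous_range_family {M ι : Type*} [TopologicalSpace M] [Finite ι] {w : ι → M → V}
    (hw : ∀ i, Continuous (w i)) (hi : ∀ b, Function.Injective fun i => w i b) :
    Continuous fun b => FinSub.ofFamily fun i => w i b := by
  obtain ⟨k, ⟨e⟩⟩ := Finite.exists_equiv_fin ι
  have h : (fun b => FinSub.ofFamily fun i => w i b) = fun b =>
      Config.toFinSub ⟨k, ⟨fun i => w (e.symm i) b, (hi b).comp e.symm.injective⟩⟩ := by
    funext b
    apply Subtype.ext
    exact (e.symm.surjective.range_comp (fun i => w i b)).symm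
  rw [h]
  exact continuous_toFinSub.comp (continuous_sigmaMk.comp
    (Continuous.subtype_mk (continuous_pi fun i => hw _) _))

/-- Over an open set on which the points are listed continuously, recording the index of a point
trivializes the projection. -/
theorem isCoveringMap_proj [T2Space V] {M : Type*} [TopologicalSpace M] {f : M → FinSub V}
    (hf : Continuous f) : IsCoveringMap (TotalSpace.proj f) := by
  intro b
  obtain ⟨N, k, t, hN, hbN, htc, ht⟩ := (f b).exists_local_listing
  have hpc : Continuous (TotalSpace.proj f) := continuous_fst.comp continuous_subtype_val
  have hU : IsOpen (f ⁻¹' N) := hN.preimage hf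
  have hex : ∀ x : TotalSpace.proj f ⁻¹' (f ⁻¹' N), ∃ i, t i (f x.1.1.1) = x.1.1.2 := by
    intro x
    have := x.1.2
    rw [← (ht (f x.1.1.1) x.2).2] at this
    exact this
  choose idx hidx using hex
  have hcont : ∀ i, Continuous fun x : TotalSpace.proj f ⁻¹' (f ⁻¹' N) => t i (f x.1.1.1) := by
    intro i
    exact (htc i).comp_continuous (hf.comp (hpc.comp continuous_subtype_val)) fun x => x.2
  -- The points with index in `s` form a finite union of sets where two continuous maps to a
  -- Hausdorff space agree. Hence every preimage under `idx` is closed.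
  have hidxc : Continuous idx := by
    refine continuous_iff_isClosed.2 fun s _ => ?_
    have : idx ⁻¹' s = ⋃ i ∈ s, {x | t i (f x.1.1.1) = x.1.1.2} := by
      ext x
      simp only [mem_preimage, mem_iUnion, mem_ofPred_eq, exists_prop]
      refine ⟨fun h => ⟨_, h, hidx x⟩, ?_⟩
      rintro ⟨i, hi, h⟩
      rwa [(ht _ x.2).1 ((hidx x).trans h.symm)]
    rw [this]
    refine (toFinite s).isClosed_biUnion fun i _ => isClosed_eq (hcont i) ?_
    exact continuous_snd.comp (continuous_subtype_val.comp continuous_subtype_val)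
  refine IsEvenlyCovered.to_isEvenlyCovered_preimage (I := Fin k) ⟨inferInstance, f ⁻¹' N, hbN, hU,
    hU.preimage hpc, ⟨⟨fun x => (⟨x.1.1.1, x.2⟩, idx x), fun y => ⟨⟨(y.1.1, t y.2 (f y.1.1)), ?_⟩,
      y.1.2⟩, ?_, ?_⟩, ?_, ?_⟩, fun x => rfl⟩
  · rw [← (ht (f y.1.1) y.1.2).2]
    exact ⟨y.2, rfl⟩
  · intro x
    apply Subtype.ext
    apply Subtype.ext
    exact Prod.ext rfl (hidx x)
  · rintro ⟨y, i⟩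
    refine Prod.ext rfl ((ht _ y.2).1 ?_)
    exact hidx ⟨⟨(y.1, t i (f y.1)), _⟩, y.2⟩
  · exact (Continuous.subtype_mk (hpc.comp continuous_subtype_val) _).prodMk hidxc
  · refine Continuous.subtype_mk (Continuous.subtype_mk (Continuous.prodMk ?_ ?_) _) _
    · exact continuous_subtype_val.comp continuous_fst
    · have h : Continuous fun z : Fin k × f ⁻¹' N => t z.1 (f z.2.1) := by
        refine continuous_prod_of_discrete_left.2 fun i => ?_
        exact (htc i).comp_continuous (hf.comp continuous_subtype_val) fun x => x.2
      exact h.comp continuous_swap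

/-! ## Extending families of distinct points from spheres to disks -/

/-- The cone parametrization of the disk. -/
theorem exists_cone_param (n : ℕ) : ∃ q : C(Sph n × unitInterval, Disk (n + 1)),
    Function.Surjective q ∧ (∀ y, q (y, 1) = sphToDisk n y) ∧
      ∀ a a', q a = q a' → a = a' ∨ (a.2 = 0 ∧ a'.2 = 0) := by
  have hmem : ∀ a : Sph n × unitInterval, (a.2 : ℝ) • a.1.1 ∈ closedBall (0 : Fin (n + 1) → ℝ) 1 := by
    intro a
    have h1 : ‖a.1.1‖ = 1 := mem_sphere_zero_iff_norm.1 a.1.2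
    rw [mem_closedBall_zero_iff, norm_smul, h1, mul_one, Real.norm_of_nonneg a.2.2.1]
    exact a.2.2.2
  have hnorm : ∀ a : Sph n × unitInterval, ‖(a.2 : ℝ) • a.1.1‖ = a.2 := by
    intro a
    have h1 : ‖a.1.1‖ = 1 := mem_sphere_zero_iff_norm.1 a.1.2
    rw [norm_smul, h1, mul_one, Real.norm_of_nonneg a.2.2.1]
  refine ⟨⟨fun a => ⟨(a.2 : ℝ) • a.1.1, hmem a⟩, by fun_prop⟩, ?_, ?_, ?_⟩
  · intro v
    by_cases h0 : v.1 = 0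
    · exact ⟨(corner n, 0), Subtype.ext (by simp [h0])⟩
    · have hv : ‖v.1‖ ≠ 0 := norm_ne_zero_iff.2 h0
      refine ⟨(⟨‖v.1‖⁻¹ • v.1, ?_⟩, ⟨‖v.1‖, norm_nonneg _, mem_closedBall_zero_iff.1 v.2⟩), ?_⟩
      · rw [mem_sphere_zero_iff_norm, norm_smul, norm_inv, norm_norm, inv_mul_cancel₀ hv]
      · exact Subtype.ext (smul_inv_smul₀ hv v.1)
  · intro y
    exact Subtype.ext (one_smul ℝ y.1)
  · intro a a' h
    have h1 : (a.2 : ℝ) • a.1.1 = (a'.2 : ℝ) • a'.1.1 := congrArg Subtype.val h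
    have h2 : (a.2 : ℝ) = a'.2 := by rw [← hnorm a, ← hnorm a', h1]
    by_cases h0 : (a.2 : ℝ) = 0
    · exact Or.inr ⟨Subtype.ext h0, Subtype.ext (h2 ▸ h0)⟩
    · rw [← h2] at h1
      exact Or.inl (Prod.ext (Subtype.ext (smul_right_injective _ h0 h1)) (Subtype.ext h2))

variable {W : Type*} [AddCommGroup W] [Module ℝ W] [TopologicalSpace W] [IsTopologicalAddGroup W]
  [ContinuousSMul ℝ W]

/-- The shift operator on sequences. -/
def shift {W : Type*} [Zero W] (x : ℕ → W) : ℕ → W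
  | 0 => 0
  | n + 1 => x n

/-- A finite family of distinct points in a space of sequences, parametrized by a sphere, extends
to the disk: the sequences are deformed linearly into their shifts, and then linearly into multiples
of a vector supported in the first coordinate. -/
theorem exists_extend_family [Nontrivial W] {n k : ℕ} (w : Fin k → C(Sph n, ℕ → W))
    (hw : ∀ y, Function.Injective fun i => w i y) : ∃ w' : Fin k → C(Disk (n + 1), ℕ → W),
      (∀ v, Function.Injective fun i => w' i v) ∧ ∀ i y, w' i (sphToDisk n y) = w i y := by
  obtain ⟨q, hq, hq1, hq0⟩ := exists_cone_param n
  obtain ⟨u, hu⟩ := exists_ne (0 : W)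
  -- The parameter runs inwards from `t = 1` on the boundary to `t = 0` at the centre. For `t ≥ 1/2`
  -- the weights are `2t-1` on `w` and `2-2t` on its shift, with `c = 0`. For `t ≤ 1/2` they are
  -- `2t` on the shift and `1-2t` on `i • u` in coordinate zero, with `a = 0`.
  let a : ℝ → ℝ := fun t => max 0 (2 * t - 1)
  let b : ℝ → ℝ := fun t => min (2 * t) (2 - 2 * t)
  let c : ℝ → ℝ := fun t => max 0 (1 - 2 * t)
  let H : Fin k → Sph n × unitInterval → ℕ → W := fun i x m =>
    a x.2 • w i x.1 m + b x.2 • shift (w i x.1) m + Nat.casesOn m ((c x.2 * i) • u) fun _ => 0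
  have hH : ∀ i, Continuous (H i) := by
    intro i
    have hwc : ∀ m, Continuous fun x : Sph n × unitInterval => w i x.1 m := fun m =>
      (continuous_apply m).comp ((w i).continuous.comp continuous_fst)
    have ha : Continuous fun x : Sph n × unitInterval => a x.2 := by fun_prop
    have hb : Continuous fun x : Sph n × unitInterval => b x.2 := by fun_prop
    have hc : Continuous fun x : Sph n × unitInterval => c x.2 := by fun_prop
    refine continuous_pi fun m => ?_
    refine ((ha.smul (hwc m)).add (hb.smul ?_)).add ?_
    · rcases m with _ | m
      · exact continuous_const
      · exact hwc m
    · rcases m with _ | m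
      · exact (hc.mul continuous_const).smul continuous_const
      · exact continuous_const
  have hzero : ∀ i y y', H i (y, 0) = H i (y', 0) := by
    intro i y y'
    funext m
    simp [H, a, b]
  have hone : ∀ i y, H i (y, 1) = w i y := by
    intro i y
    funext m
    rcases m with _ | m
    · simp [H, a, b, c]
      norm_num
    · simp [H, a, b, c]
      norm_num
  have hinj : ∀ x, Function.Injective fun i => H i x := by
    rintro ⟨y, t⟩ i j hij
    have h0 := congrFun hij 0
    -- In the inner half the shift vanishes in coordinate zero, where only `(c t * i) • u` remains,
    -- and it determines `i`.
    by_cases ht : (t : ℝ) < 1 / 2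
    · have ha : a t = 0 := max_eq_left (by linarith)
      have hc : c t ≠ 0 := (lt_of_lt_of_le (by linarith) (le_max_right _ _)).ne'
      simp only [H, ha, shift, zero_smul, smul_zero, zero_add] at h0
      have := mul_left_cancel₀ hc (smul_left_injective ℝ hu h0)
      exact Fin.ext (by exact_mod_cast this)
    · push Not at ht
      have ha : a t = 2 * t - 1 := max_eq_right (by linarith)
      have hb : b t = 2 - 2 * t := min_eq_right (by linarith)
      have hc : c t = 0 := max_eq_left (by linarith)
      have hm : ∀ m, a t • w i y m + b t • shift (w i y) m =
          a t • w j y m + b t • shift (w j y) m := by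
        intro m
        have := congrFun hij m
        rcases m with _ | m <;> simpa [H, hc] using this
      apply hw y
      funext m
      -- At `t = 1/2` the family is the shift itself, which is injective. Otherwise the coordinates
      -- of `w` are recovered one after another, since coordinate `m + 1` is `a • w (m+1) + b • w m`
      -- with `a ≠ 0`.
      by_cases ha0 : a t = 0
      · have hb1 : b t = 1 := by linarith
        simpa [ha0, hb1, shift] using hm (m + 1)
      · induction m with
        | zero =>
          have := hm 0
          simp only [shift, smul_zero, add_zero] at this
          exact smul_right_injective _ ha0 this
        | succ m ih =>
          have := hm (m + 1)
          simp only [shift] at this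
          simp only at ih
          rw [ih] at this
          exact smul_right_injective _ ha0 (add_right_cancel this)
  have hdesc : ∀ i, ∃ g : Disk (n + 1) → ℕ → W, Continuous g ∧ ∀ x, g (q x) = H i x := by
    intro i
    refine exists_continuous_descend q.continuous hq (hH i) ?_
    intro x x' h
    rcases hq0 x x' h with rfl | ⟨h1, h2⟩
    · rfl
    · obtain ⟨y, t⟩ := x
      obtain ⟨y', t'⟩ := x'
      simp only at h1 h2
      subst h1 h2
      exact hzero i y y'
  choose g hgc hg using hdesc
  refine ⟨fun i => ⟨g i, hgc i⟩, fun v => ?_, fun i y => ?_⟩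
  · obtain ⟨x, rfl⟩ := hq v
    intro i j hij
    apply hinj x
    simpa only [ContinuousMap.coe_mk, hg] using hij
  · rw [← hq1, ContinuousMap.coe_mk, hg, hone]

/-- A map from a sphere to the finite subsets of a space of sequences extends to the disk, if the
covering which it classifies is trivial. -/
theorem exists_extend_finSub [Nontrivial W] [T2Space W] {n : ℕ} (hn : 1 ≤ n)
    {F : Sph n → FinSub (ℕ → W)} (hF : Continuous F)
    (hs : ∀ y₀, ∀ v ∈ (F y₀).1, ∃ s : C(Sph n, ℕ → W), (∀ y, s y ∈ (F y).1) ∧ s y₀ = v) :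
    ∃ h : Disk (n + 1) → FinSub (ℕ → W), Continuous h ∧ ∀ y, h (sphToDisk n y) = F y := by
  have := preconnectedSpace_sph hn
  -- Continuous selections from `F` are sections of the covering classified by `F`, so two that
  -- agree at one point of the connected sphere agree everywhere.
  have huniq : ∀ s s' : C(Sph n, ℕ → W), (∀ y, s y ∈ (F y).1) → (∀ y, s' y ∈ (F y).1) →
      ∀ y₀, s y₀ = s' y₀ → ∀ y, s y = s' y := by
    intro s s' h h' y₀ h₀ y
    have := lift_unique (isCoveringMap_proj hF)
      (f := fun y => (⟨(y, s y), h y⟩ : TotalSpace F))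
      (g := fun y => (⟨(y, s' y), h' y⟩ : TotalSpace F)) (by fun_prop) (by fun_prop)
      (fun _ => rfl) y₀ (Subtype.ext (Prod.ext rfl h₀)) y
    exact congrArg (fun x : TotalSpace F => x.1.2) this
  have : Finite (F (corner n)).1 := (F (corner n)).2
  obtain ⟨k, ⟨e⟩⟩ := Finite.exists_equiv_fin (F (corner n)).1
  choose s hsF hs0 using fun i => hs (corner n) (e.symm i).1 (e.symm i).2
  have hinj : ∀ y, Function.Injective fun i => s i y := by
    intro y i j hij
    have := huniq (s i) (s j) (hsF i) (hsF j) y hij (corner n)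
    rw [hs0, hs0] at this
    exact e.symm.injective (Subtype.ext this)
  obtain ⟨w', hw', hws⟩ := exists_extend_family s hinj
  refine ⟨fun v => FinSub.ofFamily fun i => w' i v,
    continuous_range_family (fun i => (w' i).continuous) hw', fun y => FinSub.ext ?_⟩
  change range (fun i => w' i (sphToDisk n y)) = _
  simp only [hws]
  refine subset_antisymm (range_subset_iff.2 fun i => hsF i y) fun v hv => ?_
  obtain ⟨r, hr, hrv⟩ := hs y v hv
  refine ⟨e ⟨r (corner n), hr _⟩, ?_⟩
  simp only
  rw [huniq _ r (hsF _) hr (corner n) (by rw [hs0]; simp) y, hrv]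

/-- Any map from a sphere of dimension at least 2 to the finite subsets of a space of sequences
extends to the disk. -/
theorem exists_extend_finSub_of_two_le [Nontrivial W] [T2Space W] {n : ℕ} (hn : 2 ≤ n)
    {F : Sph n → FinSub (ℕ → W)} (hF : Continuous F) :
    ∃ h : Disk (n + 1) → FinSub (ℕ → W), Continuous h ∧ ∀ y, h (sphToDisk n y) = F y := by
  refine exists_extend_finSub (by omega) hF fun y₀ v hv => ?_
  obtain ⟨s, hs, hs0⟩ := exists_section_sphere hn (isCoveringMap_proj hF) ⟨(y₀, v), hv⟩
  refine ⟨⟨fun y => (s y).1.2, by fun_prop⟩, fun y => ?_, ?_⟩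
  · have h1 : (s y).1.1 = y := hs y
    have h2 := (s y).2
    rwa [h1] at h2
  · exact congrArg (fun x : TotalSpace F => x.1.2) hs0

/-! ## Gluing along the cells of a CW complex -/

section CW

variable {L : Type u} [TopologicalSpace L] [CWComplex (univ : Set L)]

local notation "Cell" => RelCWComplex.cell (univ : Set L)

theorem range_charMap (n : ℕ) (c : Cell n) : range (charMap n c) = RelCWComplex.closedCell n c := by
  rw [RelCWComplex.closedCell, image_eq_range]
  rfl

theorem charMap_mem_closedCell (n : ℕ) (c : Cell n) (v : Disk n) :
    charMap n c v ∈ RelCWComplex.closedCell n c := range_charMap n c ▸ mem_range_self v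

theorem mem_openCell_iff {n : ℕ} {c : Cell n} {w : L} :
    w ∈ RelCWComplex.openCell n c ↔ ∃ v : OpenDisk n, charMap n c (openToDisk n v) = w := by
  constructor
  · rintro ⟨v, hv, rfl⟩
    exact ⟨⟨v, hv⟩, rfl⟩
  · rintro ⟨v, rfl⟩
    exact ⟨v.1, v.2, rfl⟩

theorem charMap_openToDisk_mem {n : ℕ} (c : Cell n) (v : OpenDisk n) :
    charMap n c (openToDisk n v) ∈ RelCWComplex.openCell n c := mem_openCell_iff.2 ⟨v, rfl⟩

theorem charMap_sphToDisk_mem {n : ℕ} (c : Cell (n + 1)) (y : Sph n) :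
    charMap (n + 1) c (sphToDisk n y) ∈ RelCWComplex.cellFrontier (n + 1) c := ⟨y.1, y.2, rfl⟩

theorem charMap_openToDisk_injective {n : ℕ} (c : Cell n) (v w : OpenDisk n)
    (h : charMap n c (openToDisk n v) = charMap n c (openToDisk n w)) : v = w := by
  apply Subtype.ext
  refine (RelCWComplex.map n c).injOn ?_ ?_ h
  · rw [RelCWComplex.source_eq]
    exact v.2
  · rw [RelCWComplex.source_eq]
    exact w.2

theorem cell_eq_of_mem_openCell {n : ℕ} {c c' : Cell n} {w : L}
    (h : w ∈ RelCWComplex.openCell n c) (h' : w ∈ RelCWComplex.openCell n c') : c = c' := by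
  by_contra hne
  have hne' : (⟨n, c⟩ : Σ n, Cell n) ≠ ⟨n, c'⟩ := fun h => hne (by simpa using h)
  exact (RelCWComplex.disjoint_openCell_of_ne hne').le_bot ⟨h, h'⟩

/-- Functions on a closed set and on finitely many cells attached to it glue. -/
theorem exists_glue [T2Space L] {Y ι : Type*} [TopologicalSpace Y] [Finite ι] {n : ℕ}
    {c : ι → Cell n} (hc : Function.Injective c) {A : Set L} (hA : IsClosed A) {s : L → Y}
    (hs : ContinuousOn s A) (hfr : ∀ i, RelCWComplex.cellFrontier n (c i) ⊆ A)
    (hd : ∀ i, Disjoint A (RelCWComplex.openCell n (c i))) (h : ι → C(Disk n, Y))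
    (hh : ∀ i v, charMap n (c i) v ∈ A → h i v = s (charMap n (c i) v)) :
    ∃ s' : L → Y, EqOn s' s A ∧ (∀ i v, s' (charMap n (c i) v) = h i v) ∧
      ContinuousOn s' (A ∪ ⋃ i, RelCWComplex.closedCell n (c i)) := by
  classical
  -- The chosen cell and point are unique, because open cells are disjoint and characteristic maps
  -- are injective on the open disk. Continuity is checked on finitely many closed pieces.
  let s' : L → Y := fun w => if hw : ∃ x : ι × OpenDisk n,
    charMap n (c x.1) (openToDisk n x.2) = w then h hw.choose.1 (openToDisk n hw.choose.2) else s w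
  have hsA : EqOn s' s A := by
    intro w hw
    simp only [s']
    rw [dif_neg]
    rintro ⟨x, rfl⟩
    exact (hd x.1).le_bot ⟨hw, charMap_openToDisk_mem _ _⟩
  have hso : ∀ i v, s' (charMap n (c i) (openToDisk n v)) = h i (openToDisk n v) := by
    intro i v
    have hex : ∃ x : ι × OpenDisk n, charMap n (c x.1) (openToDisk n x.2) =
      charMap n (c i) (openToDisk n v) := ⟨(i, v), rfl⟩
    simp only [s']
    rw [dif_pos hex]
    have h1 := hex.choose_spec
    have h2 : hex.choose.1 = i := hc (cell_eq_of_mem_openCell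
      (mem_openCell_iff.2 ⟨_, h1⟩) (charMap_openToDisk_mem (c i) v))
    generalize hex.choose = x at h1 h2
    obtain ⟨j, w⟩ := x
    subst h2
    rw [charMap_openToDisk_injective _ _ _ h1]
  have hsc : ∀ i v, s' (charMap n (c i) v) = h i v := by
    intro i v
    rcases lt_or_eq_of_le (mem_closedBall_zero_iff.1 v.2) with hlt | heq
    · exact hso i ⟨v.1, mem_ball_zero_iff.2 hlt⟩
    · have hmem : charMap n (c i) v ∈ A := hfr i ⟨v.1, mem_sphere_zero_iff_norm.2 heq, rfl⟩
      rw [hsA hmem, hh i v hmem]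
  refine ⟨s', hsA, hsc, ?_⟩
  have hcell : ContinuousOn s' (⋃ i, RelCWComplex.closedCell n (c i)) := by
    refine (locallyFinite_of_finite _).continuousOn_iUnion
      (fun i => RelCWComplex.isClosed_closedCell) fun i => ?_
    rw [← range_charMap]
    refine continuousOn_range_of_comp (charMap n (c i)).continuous ?_
    exact (h i).continuous.congr fun v => (hsc i v).symm
  refine ContinuousOn.union_of_isClosed (hs.congr hsA) hcell hA ?_
  exact isClosed_iUnion_of_finite fun i => RelCWComplex.isClosed_closedCell

/-! ## Sections of coverings over subsets -/

/-- `s` is a continuous section of `p` over `A`. -/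
def IsSectionOn {E L : Type*} [TopologicalSpace E] [TopologicalSpace L] (p : E → L) (A : Set L)
    (s : L → E) : Prop := ContinuousOn s A ∧ ∀ a ∈ A, p (s a) = a

/-- `A` is connected, and `p` has continuous sections over `A` through all points over `A`. -/
def IsTrivialOver {E L : Type*} [TopologicalSpace E] [TopologicalSpace L] (p : E → L) (A : Set L) :
    Prop := IsPreconnected A ∧ ∀ e, p e ∈ A → ∃ s, IsSectionOn p A s ∧ s (p e) = e

theorem IsTrivialOver.eqOn {E L : Type*} [TopologicalSpace E] [TopologicalSpace L] {p : E → L}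
    (hp : IsCoveringMap p) {A : Set L} (hA : IsTrivialOver p A) {s s' : L → E}
    (hs : IsSectionOn p A s) (hs' : IsSectionOn p A s') {a : L} (ha : a ∈ A) (h : s a = s' a) :
    EqOn s s' A :=
  hp.eqOn_of_comp_eqOn hA.1 hs.1 hs'.1 (fun b hb => (hs.2 b hb).trans (hs'.2 b hb).symm) ha h

variable {E : Type*} [TopologicalSpace E] {p : E → L} [T2Space L]

/-- A section over `A` extends to the cells of dimension at least two attached to `A`. -/
theorem IsSectionOn.exists_extend (hp : IsCoveringMap p) {ι : Type*} [Finite ι] {m : ℕ}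
    (hm : 1 ≤ m) {c : ι → Cell (m + 1)} (hc : Function.Injective c) {A : Set L} (hA : IsClosed A)
    (hfr : ∀ i, RelCWComplex.cellFrontier (m + 1) (c i) ⊆ A)
    (hd : ∀ i, Disjoint A (RelCWComplex.openCell (m + 1) (c i))) {s : L → E}
    (hs : IsSectionOn p A s) :
    ∃ s', IsSectionOn p (A ∪ ⋃ i, RelCWComplex.closedCell (m + 1) (c i)) s' ∧ EqOn s' s A := by
  have := preconnectedSpace_sph hm
  have hbd : ∀ i y, charMap (m + 1) (c i) (sphToDisk m y) ∈ A := fun i y =>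
    hfr i (charMap_sphToDisk_mem _ _)
  -- Each cell is lifted so as to match `s` at the corner. Its boundary sphere is connected for `m ≥
  -- 1`, so the lift matches `s` on the whole boundary.
  choose h hlift hcor using fun i => exists_lift_through hp (charMap (m + 1) (c i))
    (sphToDisk m (corner m)) (s (charMap (m + 1) (c i) (sphToDisk m (corner m))))
    (hs.2 _ (hbd i _))
  have hhs : ∀ i y, h i (sphToDisk m y) = s (charMap (m + 1) (c i) (sphToDisk m y)) := by
    intro i y
    refine lift_unique hp (f := fun y => h i (sphToDisk m y))
      (g := fun y => s (charMap (m + 1) (c i) (sphToDisk m y))) (by fun_prop) ?_ ?_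
      (corner m) (hcor i) y
    · exact hs.1.comp_continuous (by fun_prop) (hbd i)
    · intro y
      rw [hlift, hs.2 _ (hbd i y)]
  obtain ⟨s', h1, h2, h3⟩ := exists_glue hc hA hs.1 hfr hd h <| by
    intro i v hv
    rcases disk_cases v with ⟨w, rfl⟩ | ⟨y, rfl⟩
    · exact ((hd i).le_bot ⟨hv, charMap_openToDisk_mem _ _⟩).elim
    · exact hhs i y
  refine ⟨s', ⟨h3, ?_⟩, h1⟩
  rintro a (ha | ha)
  · rw [h1 ha, hs.2 a ha]
  · obtain ⟨i, hi⟩ := mem_iUnion.1 ha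
    rw [← range_charMap] at hi
    obtain ⟨v, rfl⟩ := hi
    rw [h2, hlift]

/-- A point over a new cell lies on a lift of that cell. The section through a boundary point of
this lift extends, and by uniqueness of lifts on the disk its extension passes through the given
point. -/
theorem IsTrivialOver.extend (hp : IsCoveringMap p) {ι : Type*} [Finite ι] {m : ℕ}
    (hm : 1 ≤ m) {c : ι → Cell (m + 1)} (hc : Function.Injective c) {A : Set L} (hA : IsClosed A)
    (hne : A.Nonempty) (hfr : ∀ i, RelCWComplex.cellFrontier (m + 1) (c i) ⊆ A)
    (hd : ∀ i, Disjoint A (RelCWComplex.openCell (m + 1) (c i))) (h : IsTrivialOver p A) :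
    IsTrivialOver p (A ∪ ⋃ i, RelCWComplex.closedCell (m + 1) (c i)) := by
  have hbd : ∀ i y, charMap (m + 1) (c i) (sphToDisk m y) ∈ A := fun i y =>
    hfr i (charMap_sphToDisk_mem _ _)
  have hsub : ∀ i, RelCWComplex.closedCell (m + 1) (c i) ⊆
      A ∪ ⋃ i, RelCWComplex.closedCell (m + 1) (c i) := fun i =>
    (subset_iUnion (fun i => RelCWComplex.closedCell (m + 1) (c i)) i).trans subset_union_right
  constructor
  · obtain ⟨a, ha⟩ := hne
    refine isPreconnected_of_forall a ?_
    rintro b (hb | hb)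
    · exact ⟨A, subset_union_left, ha, hb, h.1⟩
    · obtain ⟨i, hi⟩ := mem_iUnion.1 hb
      refine ⟨A ∪ RelCWComplex.closedCell (m + 1) (c i), union_subset subset_union_left (hsub i),
        Or.inl ha, Or.inr hi, ?_⟩
      refine h.1.union _ (hbd i (corner m)) (charMap_mem_closedCell _ _ _) ?_
      rw [← range_charMap]
      exact isPreconnected_range (charMap _ _).continuous
  · rintro e (he | he)
    · obtain ⟨s, hs, hse⟩ := h.2 e he
      obtain ⟨s', hs', hss⟩ := hs.exists_extend hp hm hc hA hfr hd
      exact ⟨s', hs', (hss he).trans hse⟩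
    · obtain ⟨i, hi⟩ := mem_iUnion.1 he
      rw [← range_charMap] at hi
      obtain ⟨v, hv⟩ := hi
      obtain ⟨g, hg, hgv⟩ := exists_lift_through hp (charMap (m + 1) (c i)) v e hv.symm
      have hpg : p (g (sphToDisk m (corner m))) ∈ A := by
        rw [hg]
        exact hbd i _
      obtain ⟨s, hs, hse⟩ := h.2 _ hpg
      obtain ⟨s', hs', hss⟩ := hs.exists_extend hp hm hc hA hfr hd
      refine ⟨s', hs', ?_⟩
      rw [← hv, ← hgv]
      refine lift_unique hp (f := fun v => s' (charMap (m + 1) (c i) v)) (g := g) ?_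
        g.continuous ?_ (sphToDisk m (corner m)) ?_ v
      · exact hs'.1.comp_continuous (charMap _ _).continuous
          fun v => hsub i (charMap_mem_closedCell _ _ _)
      · intro v
        rw [hs'.2 _ (hsub i (charMap_mem_closedCell _ _ _)), hg]
      · rw [← hg, hss hpg, hse]

end CW

/-! ## The subcomplexes of a cellular realization -/

namespace CellularRealization

variable {X Q Z : Type*} [Fintype X] [Fintype Q] [Fintype Z] {C : CSSCode X Q Z}
  {D : ZLift C} {G : OneSkeleton D} {L : Type u} [TopologicalSpace L] [CWComplex (univ : Set L)]
  (R : CellularRealization G L)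

include R in
theorem finite_cell (n : ℕ) : Finite (RelCWComplex.cell (univ : Set L) n) := by
  have := G.finite_ZEdge
  have := R.finite_cell2
  rcases n with _ | _ | _ | _ | _ | _ | n
  · exact Finite.of_equiv _ R.cell0
  · exact Finite.of_equiv _ R.cell1
  · infer_instance
  · exact Finite.of_equiv _ R.cell3
  · exact Finite.of_equiv _ R.cell4
  · exact Finite.of_equiv _ R.cell5
  · have := R.isEmpty_cell (n + 6) (by omega)
    infer_instance

theorem vertex_mem_openCell (v : X ⊕ Q) : R.vertex v ∈ RelCWComplex.openCell 0 (R.cell0 v) :=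
  RelCWComplex.map_zero_mem_openCell _ _

theorem charMap_zero (v : X ⊕ Q) (w : Disk 0) : charMap 0 (R.cell0 v) w = R.vertex v :=
  congrArg (RelCWComplex.map 0 (R.cell0 v)) (Subsingleton.elim _ _)

theorem closedCell_zero (v : X ⊕ Q) : RelCWComplex.closedCell 0 (R.cell0 v) = {R.vertex v} := by
  rw [← range_charMap]
  ext w
  constructor
  · rintro ⟨v, rfl⟩
    exact R.charMap_zero _ _
  · rintro rfl
    exact ⟨⟨0, by simp⟩, rfl⟩

/-- The initial and final points of the interval `[-1,1]`. -/
def _root_.CellularLift.endpoint (b : Bool) : Disk 1 :=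
  ⟨fun _ => if b then 1 else -1, by
    rw [mem_closedBall_zero_iff, pi_norm_const]
    cases b <;> simp⟩

theorem charMap_endpoint_false (e : G.Edge) :
    charMap 1 (R.cell1 e) (endpoint false) = R.vertex (G.initial e) := by
  rw [← R.map_initial]
  rfl

theorem charMap_endpoint_true (e : G.Edge) :
    charMap 1 (R.cell1 e) (endpoint true) = R.vertex (G.terminal e) := by
  rw [← R.map_terminal]
  rfl

theorem _root_.CellularLift.eq_endpoint_of_norm_eq_one {v : Disk 1} (hv : ‖v.1‖ = 1) :
    v = endpoint false ∨ v = endpoint true := by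
  have h0 : v.1 = fun _ => v.1 0 := funext fun i => by rw [Subsingleton.elim i 0]
  rw [h0, pi_norm_const, Real.norm_eq_abs] at hv
  rcases eq_or_eq_neg_of_abs_eq hv with h | h
  · exact Or.inr (Subtype.ext (by rw [h0, h]; rfl))
  · exact Or.inl (Subtype.ext (by rw [h0, h]; rfl))

theorem cellFrontier_three (x : X) :
    RelCWComplex.cellFrontier 3 (R.cell3 x) ⊆ {R.vertex (Sum.inl x)} := by
  rintro _ ⟨v, hv, rfl⟩
  exact R.attach3 x ⟨v, hv⟩

/-- The predicate carried by the homotopy already holds at time zero, where the map is the attaching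
map itself. -/
theorem range_attachMap_four (q : Q) : range (attachMap 3 (R.cell4 q)) ⊆ R.dressedStar q := by
  obtain ⟨φ, -, ⟨F⟩⟩ := R.attach4 q
  have h := (F.prop 0).2
  rintro _ ⟨y, rfl⟩
  refine h ⟨y, ?_⟩
  exact F.apply_zero y

theorem attachMap_four_basePoint (q : Q) :
    attachMap 3 (R.cell4 q) basePoint = R.vertex (Sum.inr q) := by
  obtain ⟨φ, -, ⟨F⟩⟩ := R.attach4 q
  rw [← (F.prop 0).1]
  exact (F.apply_zero _).symm

theorem cellFrontier_four (q : Q) :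
    RelCWComplex.cellFrontier 4 (R.cell4 q) ⊆ R.dressedStar q := by
  rintro _ ⟨v, hv, rfl⟩
  exact R.range_attachMap_four q ⟨⟨v, hv⟩, rfl⟩

theorem initial_mem {z : Z} {e : G.Edge} (he : e ∈ G.edgesOf z) :
    G.initial e ∈ D.inducedVertices z := by
  rcases e with ⟨q, x, i⟩ | e
  · refine ⟨q, he, fun h => ?_⟩
    exact absurd i.2 (by simp [show D.d1 x q = 0 from h])
  · exact (show G.check e = z from he) ▸ G.src_mem e

include R in
-- A simply connected space is nonempty. Without induced vertices there would be no edges of `z`,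
-- hence no 2-cells of `z` either, since their nonempty frontiers lie in the graph.
theorem nonempty_inducedVertices (z : Z) : (D.inducedVertices z).Nonempty := by
  have := R.simplyConnected z
  obtain ⟨⟨w, hw⟩⟩ : Nonempty (R.twoComplexOf z) := inferInstance
  by_contra hne
  rw [not_nonempty_iff_eq_empty] at hne
  have hg : R.graphOf z = ∅ := by
    rw [CellLabelling.graphOf, hne, image_empty, empty_union]
    simp only [iUnion_eq_empty]
    intro e he
    have := initial_mem he
    rw [hne] at this
    exact absurd this (notMem_empty _)
  rcases hw with hw | hw
  · rw [hg] at hw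
    exact hw
  · obtain ⟨c, hc, -⟩ := mem_iUnion₂.1 hw
    have h1 := R.attach2 c (charMap_sphToDisk_mem (n := 1) c (corner 1))
    rw [hc, hg] at h1
    exact h1

variable [T2Space L]

theorem closedCell_subset_skeleton {n m : ℕ} (h : n < m) (c : RelCWComplex.cell (univ : Set L) n) :
    RelCWComplex.closedCell n c ⊆ (RelCWComplex.skeletonLT (univ : Set L) m : Set L) :=
  (RelCWComplex.closedCell_subset_skeletonLT n c).trans
    (RelCWComplex.skeletonLT_mono (by exact_mod_cast h))

theorem disjoint_of_subset_skeleton {n m : ℕ} (h : n ≤ m) {A : Set L}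
    (hA : A ⊆ (RelCWComplex.skeletonLT (univ : Set L) n : Set L))
    (c : RelCWComplex.cell (univ : Set L) m) : Disjoint A (RelCWComplex.openCell m c) :=
  (RelCWComplex.disjoint_skeletonLT_openCell (by exact_mod_cast h)).mono_left hA

theorem vertex_mem_skeleton {m : ℕ} (h : 0 < m) (v : X ⊕ Q) :
    R.vertex v ∈ (RelCWComplex.skeletonLT (univ : Set L) m : Set L) :=
  closedCell_subset_skeleton h _ (RelCWComplex.openCell_subset_closedCell _ _
    (R.vertex_mem_openCell v))

theorem graphOf_subset (z : Z) :
    R.graphOf z ⊆ (RelCWComplex.skeletonLT (univ : Set L) (2 : ℕ) : Set L) := by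
  refine union_subset ?_ (iUnion₂_subset fun e _ => closedCell_subset_skeleton (by omega) _)
  rintro _ ⟨v, -, rfl⟩
  exact R.vertex_mem_skeleton (by omega) v

theorem twoComplexOf_subset (z : Z) :
    R.twoComplexOf z ⊆ (RelCWComplex.skeletonLT (univ : Set L) (3 : ℕ) : Set L) :=
  union_subset ((R.graphOf_subset z).trans (RelCWComplex.skeletonLT_mono (by norm_cast)))
    (iUnion₂_subset fun e _ => closedCell_subset_skeleton (by omega) _)

/-- The union of the 2-complex of `z` and the 3-cells of the `X`-checks which it contains. -/
def threeComplexOf (z : Z) : Set L :=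
  R.twoComplexOf z ∪ ⋃ x : {x : X // Sum.inl x ∈ D.inducedVertices z},
    RelCWComplex.closedCell 3 (R.cell3 x.1)

/-- The union of the 3-complex of `z` and the 4-cells of the qubits in the support of `z`. -/
def supportOf (z : Z) : Set L :=
  R.threeComplexOf z ∪ ⋃ q : {q : Q // D.d2 q z ≠ 0}, RelCWComplex.closedCell 4 (R.cell4 q.1)

theorem threeComplexOf_subset (z : Z) :
    R.threeComplexOf z ⊆ (RelCWComplex.skeletonLT (univ : Set L) (4 : ℕ) : Set L) :=
  union_subset ((R.twoComplexOf_subset z).trans (RelCWComplex.skeletonLT_mono (by norm_cast)))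
    (iUnion_subset fun _ => closedCell_subset_skeleton (by omega) _)

theorem vertex_mem_graphOf {z : Z} {v : X ⊕ Q} (hv : v ∈ D.inducedVertices z) :
    R.vertex v ∈ R.graphOf z := Or.inl ⟨v, hv, rfl⟩

theorem graphOf_subset_twoComplexOf (z : Z) : R.graphOf z ⊆ R.twoComplexOf z := subset_union_left

theorem twoComplexOf_subset_threeComplexOf (z : Z) : R.twoComplexOf z ⊆ R.threeComplexOf z :=
  subset_union_left

theorem threeComplexOf_subset_supportOf (z : Z) : R.threeComplexOf z ⊆ R.supportOf z :=
  subset_union_left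

theorem vertex_mem_supportOf {z : Z} {v : X ⊕ Q} (hv : v ∈ D.inducedVertices z) :
    R.vertex v ∈ R.supportOf z :=
  R.threeComplexOf_subset_supportOf z (R.twoComplexOf_subset_threeComplexOf z
    (R.graphOf_subset_twoComplexOf z (R.vertex_mem_graphOf hv)))

theorem dressedStar_subset {z : Z} {q : Q} (hq : D.d2 q z ≠ 0) :
    R.dressedStar q ⊆ R.threeComplexOf z := by
  refine union_subset ?_ (iUnion_subset fun l => union_subset ?_ ?_)
  · rw [singleton_subset_iff]
    exact R.twoComplexOf_subset_threeComplexOf z (R.graphOf_subset_twoComplexOf z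
      (R.vertex_mem_graphOf hq))
  · refine subset_trans ?_ ((R.graphOf_subset_twoComplexOf z).trans
      (R.twoComplexOf_subset_threeComplexOf z))
    refine subset_trans ?_ subset_union_right
    exact subset_iUnion₂_of_subset (Sum.inl ⟨q, l⟩) hq subset_rfl
  · have hl : Sum.inl l.1 ∈ D.inducedVertices z :=
      initial_mem (G := G) (e := Sum.inl ⟨q, l⟩) hq
    refine subset_trans ?_ subset_union_right
    exact subset_iUnion_of_subset (⟨l.1, hl⟩ : {x : X // Sum.inl x ∈ D.inducedVertices z})
      subset_rfl

/-- `supportOf` arranges the cells by dimension, so that triviality of coverings and sections can be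
carried over its 3-cells and then its 4-cells. -/
theorem fourComplexOf_subset (z : Z) : R.fourComplexOf z ⊆ R.supportOf z := by
  refine union_subset ((R.twoComplexOf_subset_threeComplexOf z).trans
    (R.threeComplexOf_subset_supportOf z)) (iUnion₂_subset fun q hq => union_subset ?_ ?_)
  · exact (R.dressedStar_subset hq).trans (R.threeComplexOf_subset_supportOf z)
  · exact subset_trans (subset_iUnion_of_subset (⟨q, hq⟩ : {q : Q // D.d2 q z ≠ 0}) subset_rfl)
      subset_union_right

theorem attachMap_five_mem (z : Z) (y : Sph 4) :
    charMap 5 (R.cell5 z) (sphToDisk 4 y) ∈ R.supportOf z :=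
  R.fourComplexOf_subset z (R.attach5 z ⟨y, rfl⟩)

theorem isClosed_graphOf (z : Z) : IsClosed (R.graphOf z) := by
  have := R.finite_cell 1
  have : Finite G.Edge := Finite.of_equiv _ R.cell1.symm
  exact ((toFinite _).image _).isClosed.union
    ((toFinite _).isClosed_biUnion fun e _ => RelCWComplex.isClosed_closedCell)

theorem twoComplexOf_eq (z : Z) : R.twoComplexOf z =
    R.graphOf z ∪ ⋃ c : {c // R.label2 c = z}, RelCWComplex.closedCell 2 c.1 := by
  rw [CellLabelling.twoComplexOf, iUnion_subtype]

theorem isClosed_twoComplexOf (z : Z) : IsClosed (R.twoComplexOf z) := by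
  have := R.finite_cell 2
  rw [twoComplexOf_eq]
  exact (R.isClosed_graphOf z).union
    (isClosed_iUnion_of_finite fun _ => RelCWComplex.isClosed_closedCell)

theorem isClosed_threeComplexOf (z : Z) : IsClosed (R.threeComplexOf z) :=
  (R.isClosed_twoComplexOf z).union
    (isClosed_iUnion_of_finite fun _ => RelCWComplex.isClosed_closedCell)

/-- A union of finitely many closed cells is locally path connected. -/
theorem _root_.CellularLift.locallyPathConnectedSpace_of_cells {A : Set L} {ι : Type*} [Finite ι]
    (n : ι → ℕ) (c : ∀ i, RelCWComplex.cell (univ : Set L) (n i))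
    (hA : A = ⋃ i, RelCWComplex.closedCell (n i) (c i)) : LocallyPathConnectedSpace A := by
  have hmem : ∀ x : Σ i, Disk (n i), charMap (n x.1) (c x.1) x.2 ∈ A := fun x =>
    hA ▸ mem_iUnion.2 ⟨x.1, charMap_mem_closedCell _ _ _⟩
  let g : (Σ i, Disk (n i)) → A := fun x => ⟨_, hmem x⟩
  have hg : Continuous g := by
    refine Continuous.subtype_mk (continuous_sigma fun i => ?_) _
    exact (charMap (n i) (c i)).continuous
  have hs : Function.Surjective g := by
    rintro ⟨a, ha⟩
    rw [hA] at ha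
    obtain ⟨i, hi⟩ := mem_iUnion.1 ha
    rw [← range_charMap] at hi
    obtain ⟨v, rfl⟩ := hi
    exact ⟨⟨i, v⟩, rfl⟩
  exact (hg.isClosedMap.isQuotientMap hg hs).locallyPathConnectedSpace

theorem locallyPathConnectedSpace_twoComplexOf (z : Z) :
    LocallyPathConnectedSpace (R.twoComplexOf z) := by
  have := R.finite_cell 2
  have := R.finite_cell 1
  have : Finite G.Edge := Finite.of_equiv _ R.cell1.symm
  have := R.finite_cell
  -- The index set consists of all cells of dimension at most two whose closure lies in the complex.
  refine locallyPathConnectedSpace_of_cells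
    (ι := {c : Σ n : Fin 3, RelCWComplex.cell (univ : Set L) n //
      RelCWComplex.closedCell _ c.2 ⊆ R.twoComplexOf z})
    (fun c => c.1.1) (fun c => c.1.2) (subset_antisymm ?_ (iUnion_subset fun c => c.2))
  have key : ∀ (n : Fin 3) (c : RelCWComplex.cell (univ : Set L) n),
      RelCWComplex.closedCell _ c ⊆ R.twoComplexOf z → ∀ w ∈ RelCWComplex.closedCell _ c,
      w ∈ ⋃ c : {c : Σ n : Fin 3, RelCWComplex.cell (univ : Set L) n //
        RelCWComplex.closedCell _ c.2 ⊆ R.twoComplexOf z}, RelCWComplex.closedCell _ c.1.2 :=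
    fun n c hc w hw => mem_iUnion.2 ⟨⟨⟨n, c⟩, hc⟩, hw⟩
  rintro w ((⟨v, hv, rfl⟩ | hw) | hw)
  · refine key 0 (R.cell0 v) ?_ _ ?_
    · refine (R.closedCell_zero v).subset.trans ?_
      exact singleton_subset_iff.2 (Or.inl (Or.inl ⟨v, hv, rfl⟩))
    · exact RelCWComplex.map_zero_mem_closedCell _ _
  · obtain ⟨e, he, hw⟩ := mem_iUnion₂.1 hw
    exact key 1 (R.cell1 e) (subset_trans (subset_trans (subset_iUnion₂_of_subset e he subset_rfl)
      subset_union_right) (R.graphOf_subset_twoComplexOf z)) w hw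
  · obtain ⟨c, hc, hw⟩ := mem_iUnion₂.1 hw
    exact key 2 c (subset_trans (subset_iUnion₂_of_subset c hc subset_rfl) subset_union_right) w hw

variable {E : Type*} [TopologicalSpace E] {p : E → L}

/-- A lift of the inclusion of the simply connected 2-complex is a section over it. -/
theorem isTrivialOver_twoComplexOf (hp : IsCoveringMap p) (z : Z) :
    IsTrivialOver p (R.twoComplexOf z) := by
  have := R.simplyConnected z
  have := R.locallyPathConnectedSpace_twoComplexOf z
  refine ⟨isPreconnected_iff_preconnectedSpace.2 inferInstance, fun e he => ?_⟩
  obtain ⟨F, hF, hFe⟩ := exists_lift_through hp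
    (⟨Subtype.val, continuous_subtype_val⟩ : C(R.twoComplexOf z, L)) ⟨p e, he⟩ e rfl
  classical
  refine ⟨fun w => if hw : w ∈ R.twoComplexOf z then F ⟨w, hw⟩ else e, ⟨?_, fun a ha => ?_⟩, ?_⟩
  · rw [continuousOn_iff_continuous_domRestrict]
    refine F.continuous.congr fun w => ?_
    simp
  · simp only [dif_pos ha]
    exact hF _
  · simp only [dif_pos he, hFe]

theorem cellFrontier_three_subset {z : Z} (x : {x : X // Sum.inl x ∈ D.inducedVertices z}) :
    RelCWComplex.cellFrontier 3 (R.cell3 x.1) ⊆ R.twoComplexOf z :=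
  (R.cellFrontier_three x.1).trans (singleton_subset_iff.2
    (R.graphOf_subset_twoComplexOf z (R.vertex_mem_graphOf x.2)))

/-- A section over the graph of `z` extends to the subcomplex of `z`. -/
theorem exists_section_supportOf (hp : IsCoveringMap p) (z : Z) {s : L → E}
    (hs : IsSectionOn p (R.graphOf z) s) :
    ∃ s', IsSectionOn p (R.supportOf z) s' ∧ EqOn s' s (R.graphOf z) := by
  have := R.finite_cell 2
  obtain ⟨s₂, h₂, h₂'⟩ := hs.exists_extend hp (m := 1) le_rfl
    (c := fun c : {c // R.label2 c = z} => c.1) Subtype.val_injective (R.isClosed_graphOf z)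
    (fun c => by simpa only [c.2] using R.attach2 c.1)
    (fun c => disjoint_of_subset_skeleton le_rfl (R.graphOf_subset z) _)
  rw [← twoComplexOf_eq] at h₂
  obtain ⟨s₃, h₃, h₃'⟩ := h₂.exists_extend hp (m := 2) (by omega)
    (c := fun x : {x : X // Sum.inl x ∈ D.inducedVertices z} => R.cell3 x.1)
    (R.cell3.injective.comp Subtype.val_injective) (R.isClosed_twoComplexOf z)
    R.cellFrontier_three_subset
    (fun c => disjoint_of_subset_skeleton le_rfl (R.twoComplexOf_subset z) _)
  obtain ⟨s₄, h₄, h₄'⟩ := h₃.exists_extend hp (m := 3) (by omega)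
    (c := fun q : {q : Q // D.d2 q z ≠ 0} => R.cell4 q.1)
    (R.cell4.injective.comp Subtype.val_injective) (R.isClosed_threeComplexOf z)
    (fun q => (R.cellFrontier_four q.1).trans (R.dressedStar_subset q.2))
    (fun c => disjoint_of_subset_skeleton le_rfl (R.threeComplexOf_subset z) _)
  refine ⟨s₄, h₄, fun w hw => ?_⟩
  have hw₂ := R.graphOf_subset_twoComplexOf z hw
  rw [h₄' (R.twoComplexOf_subset_threeComplexOf z hw₂), h₃' hw₂, h₂' hw]

/-- Simple connectivity gives triviality over the 2-complex, and attaching cells of dimension three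
and four preserves it. -/
theorem isTrivialOver_supportOf (hp : IsCoveringMap p) (z : Z) :
    IsTrivialOver p (R.supportOf z) := by
  obtain ⟨v, hv⟩ := nonempty_inducedVertices R z
  have hv₂ := R.graphOf_subset_twoComplexOf z (R.vertex_mem_graphOf hv)
  refine IsTrivialOver.extend hp (m := 3) (by omega)
    (c := fun q : {q : Q // D.d2 q z ≠ 0} => R.cell4 q.1)
    (R.cell4.injective.comp Subtype.val_injective) (R.isClosed_threeComplexOf z)
    ⟨_, R.twoComplexOf_subset_threeComplexOf z hv₂⟩
    (fun q => (R.cellFrontier_four q.1).trans (R.dressedStar_subset q.2))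
    (fun c => disjoint_of_subset_skeleton le_rfl (R.threeComplexOf_subset z) _) ?_
  exact IsTrivialOver.extend hp (m := 2) (by omega)
    (c := fun x : {x : X // Sum.inl x ∈ D.inducedVertices z} => R.cell3 x.1)
    (R.cell3.injective.comp Subtype.val_injective) (R.isClosed_twoComplexOf z) ⟨_, hv₂⟩
    R.cellFrontier_three_subset
    (fun c => disjoint_of_subset_skeleton le_rfl (R.twoComplexOf_subset z) _)
    (R.isTrivialOver_twoComplexOf hp z)

end CellularRealization

namespace CellularRealization

variable {X Q Z : Type*} [Fintype X] [Fintype Q] [Fintype Z] {C : CSSCode X Q Z}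
  {D : ZLift C} {G : OneSkeleton D} {L : Type u} [TopologicalSpace L] [CWComplex (univ : Set L)]
  (R : CellularRealization G L) [T2Space L] {E : Type*} [TopologicalSpace E] {p : E → L}

/-! ## Incidence numbers of lifted 5-cells and 4-cells -/

/-- The frontier of an `n`-cell lies in the lower skeleton, which misses all open `n`-cells. So a
point of an open `n`-cell lies on no other closed `n`-cell. -/
theorem _root_.CellularLift.charMap_eq_charMap_openToDisk {n : ℕ}
    {c c' : RelCWComplex.cell (univ : Set L) n} {w : Disk n} {v : OpenDisk n}
    (h : charMap n c w = charMap n c' (openToDisk n v)) : c = c' ∧ w = openToDisk n v := by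
  have hv := charMap_openToDisk_mem c' v
  have hw : ∃ w' : OpenDisk n, openToDisk n w' = w := by
    rcases lt_or_eq_of_le (mem_closedBall_zero_iff.1 w.2) with hlt | heq
    · exact ⟨⟨w.1, mem_ball_zero_iff.2 hlt⟩, rfl⟩
    · have hfr : charMap n c w ∈ RelCWComplex.cellFrontier n c :=
        ⟨w.1, mem_sphere_zero_iff_norm.2 heq, rfl⟩
      rw [h] at hfr
      exact ((RelCWComplex.disjoint_skeletonLT_openCell le_rfl).le_bot
        ⟨RelCWComplex.cellFrontier_subset_skeletonLT n c hfr, hv⟩).elim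
  obtain ⟨w, rfl⟩ := hw
  have hc : c = c' := cell_eq_of_mem_openCell (h ▸ charMap_openToDisk_mem c w) hv
  subst hc
  exact ⟨rfl, congrArg _ (charMap_openToDisk_injective c w v h)⟩

theorem _root_.CellularLift.LiftedCell.openToDisk_injective {n : ℕ}
    {c : RelCWComplex.cell (univ : Set L) n} (f : LiftedCell p (charMap n c)) (v w : OpenDisk n)
    (h : f.1 (openToDisk n v) = f.1 (openToDisk n w)) : v = w := by
  apply charMap_openToDisk_injective c
  rw [← f.2, ← f.2, h]

theorem charMap_four_corner (q : Q) :
    charMap 4 (R.cell4 q) (sphToDisk 3 (corner 3)) = R.vertex (Sum.inr q) :=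
  R.attachMap_four_basePoint q

theorem charMap_three_sphToDisk (x : X) (y : Sph 2) :
    charMap 3 (R.cell3 x) (sphToDisk 2 y) = R.vertex (Sum.inl x) := R.attach3 x y

theorem closedCell_four_subset {z : Z} {q : Q} (hq : D.d2 q z ≠ 0) :
    RelCWComplex.closedCell 4 (R.cell4 q) ⊆ R.supportOf z :=
  subset_trans (subset_iUnion_of_subset (⟨q, hq⟩ : {q : Q // D.d2 q z ≠ 0}) subset_rfl)
    subset_union_right

theorem d2_ne_zero_of_mem {z : Z} {q : Q} {v : OpenDisk 4}
    (h : charMap 4 (R.cell4 q) (openToDisk 4 v) ∈ R.supportOf z) : D.d2 q z ≠ 0 := by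
  rcases h with h | h
  · exact ((disjoint_of_subset_skeleton le_rfl (R.threeComplexOf_subset z) (R.cell4 q)).le_bot
      ⟨h, charMap_openToDisk_mem _ _⟩).elim
  · obtain ⟨q', hq'⟩ := mem_iUnion.1 h
    rw [← range_charMap] at hq'
    obtain ⟨w, hw⟩ := hq'
    rw [← R.cell4.injective (charMap_eq_charMap_openToDisk hw).1]
    exact q'.2

open Classical in
/-- The incidence numbers of a lift of the 5-cell of `z` with the lifts of 4-cells are those of
the `ℤ`-lift for the 4-cells which meet the same sheet over the subcomplex of `z`. -/
theorem incidence_five_four (hp : IsCoveringMap p) {z : Z} {q : Q}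
    (z' : LiftedCell p (charMap 5 (R.cell5 z))) (q' : LiftedCell p (charMap 4 (R.cell4 q)))
    {s : L → E} (hs : IsSectionOn p (R.supportOf z) s)
    (hsz : s (charMap 5 (R.cell5 z) (sphToDisk 4 (corner 4))) = z'.1 (sphToDisk 4 (corner 4))) :
    incidence z'.1 q'.1 =
      if D.d2 q z ≠ 0 ∧ s (R.vertex (Sum.inr q)) = q'.1 (sphToDisk 3 (corner 3)) then D.d2 q z
      else degree (fun _ : Sph 4 => (OnePoint.infty : OnePoint (OpenDisk 4))) := by
  have := preconnectedSpace_sph (n := 4) (by omega)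
  have hz : ∀ y, s (charMap 5 (R.cell5 z) (sphToDisk 4 y)) = z'.1 (sphToDisk 4 y) := by
    refine lift_unique hp (f := fun y => s (charMap 5 (R.cell5 z) (sphToDisk 4 y)))
      (g := fun y => z'.1 (sphToDisk 4 y)) ?_ (by fun_prop) ?_ (corner 4) hsz
    · exact hs.1.comp_continuous (by fun_prop) (R.attachMap_five_mem z)
    · intro y
      rw [z'.2, hs.2 _ (R.attachMap_five_mem z y)]
  -- A lifted 4-cell over the subcomplex of `z` that meets the sheet `s` in one corresponding point
  -- lies in it entirely.
  have hq : D.d2 q z ≠ 0 → ∀ v₀, s (charMap 4 (R.cell4 q) v₀) = q'.1 v₀ →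
      ∀ v, s (charMap 4 (R.cell4 q) v) = q'.1 v := by
    intro hne v₀ h₀
    have hmem : ∀ v, charMap 4 (R.cell4 q) v ∈ R.supportOf z := fun v =>
      R.closedCell_four_subset hne (charMap_mem_closedCell _ _ _)
    refine lift_unique hp (f := fun v => s (charMap 4 (R.cell4 q) v)) (g := q'.1) ?_
      q'.1.continuous ?_ v₀ h₀
    · exact hs.1.comp_continuous (by fun_prop) hmem
    · intro v
      rw [q'.2, hs.2 _ (hmem v)]
  split_ifs with h
  -- Here both lifted cells are seen through the injective map `s`, so the collapsed boundary map is
  -- the one downstairs.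
  · have hq' := hq h.1 (sphToDisk 3 (corner 3)) (by rw [R.charMap_four_corner, h.2])
    rw [← R.incidence5 z q]
    unfold incidence
    congr 1
    funext y
    refine collapse_eq_collapse q'.openToDisk_injective (charMap_openToDisk_injective _) fun v => ?_
    rw [← hq', ← hz]
    refine ⟨fun h' => ?_, fun h' => congrArg s h'⟩
    have := congrArg p h'
    rwa [hs.2 _ (R.closedCell_four_subset h.1 (charMap_mem_closedCell _ _ _)),
      hs.2 _ (R.attachMap_five_mem z y)] at this
  -- If the boundary met the open lifted 4-cell, that cell would lie in the sheet. Hence the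
  -- collapsed map is constant at infinity. Its degree is left unevaluated, as it is the same for
  -- every covering.
  · unfold incidence
    congr 1
    funext y
    refine collapse_eq_infty fun v hv => h ?_
    have hpv : charMap 4 (R.cell4 q) (openToDisk 4 v) = charMap 5 (R.cell5 z) (sphToDisk 4 y) := by
      rw [← q'.2, hv, z'.2]
    have hne : D.d2 q z ≠ 0 := R.d2_ne_zero_of_mem (hpv ▸ R.attachMap_five_mem z y)
    refine ⟨hne, ?_⟩
    rw [← R.charMap_four_corner]
    refine hq hne (openToDisk 4 v) ?_ _
    rw [hv, hpv, hz]

/-! ## Incidence numbers of lifted 4-cells and 3-cells -/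

theorem dressedStar_subset_skeleton (q : Q) : R.dressedStar q ⊆
    (RelCWComplex.skeletonLT (univ : Set L) (3 : ℕ) : Set L) ∪
      ⋃ x : X, RelCWComplex.closedCell 3 (R.cell3 x) := by
  refine union_subset ?_ (iUnion_subset fun l => union_subset ?_ ?_)
  · exact singleton_subset_iff.2 (Or.inl (R.vertex_mem_skeleton (by omega) _))
  · exact (closedCell_subset_skeleton (by omega) _).trans subset_union_left
  · exact subset_trans (subset_iUnion_of_subset l.1 subset_rfl) subset_union_right

/-- The collapse onto a lifted 3-cell is continuous on maps to the preimage of a dressed star. -/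
theorem continuous_collapse_comp (hp : IsFiniteCovering p) {q : Q} {x : X}
    (x' : LiftedCell p (charMap 3 (R.cell3 x))) {M : Type*} [TopologicalSpace M] (K : C(M, E))
    (hK : ∀ m, p (K m) ∈ R.dressedStar q) : Continuous fun m => collapse x'.1 (K m) := by
  have := t2Space_of_isCoveringMap hp.1
  have hfin : Finite (LiftedCell p (charMap 3 (R.cell3 x))) := by
    have : Finite (p ⁻¹' {charMap 3 (R.cell3 x) (sphToDisk 2 (corner 2))}) := hp.2 _
    exact Finite.of_equiv _ (liftedCellEquiv hp.1 _ (sphToDisk 2 (corner 2))).symm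
  -- The source is covered by two closed sets. On `M₁` the map runs in the lifted cell `x'`. On `M₂`
  -- it lies over `B` or in one of the other lifts of the 3-cell of `x`, finitely many because the
  -- fibres are finite, and the collapse is constant at infinity.
  let B : Set L := (RelCWComplex.skeletonLT (univ : Set L) (3 : ℕ) : Set L) ∪
    ⋃ y : {y : X // y ≠ x}, RelCWComplex.closedCell 3 (R.cell3 y.1)
  have hB : IsClosed B := (RelCWComplex.skeletonLT (univ : Set L) (3 : ℕ)).closed.union
    (isClosed_iUnion_of_finite fun _ => RelCWComplex.isClosed_closedCell)
  let M₁ : Set M := K ⁻¹' range x'.1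
  let M₂ : Set M := K ⁻¹' (p ⁻¹' B ∪ ⋃ x'' : {x'' // x'' ≠ x'}, range x''.1.1)
  have hM₁ : IsClosed M₁ := (isCompact_range x'.1.continuous).isClosed.preimage K.continuous
  have hM₂ : IsClosed M₂ := ((hB.preimage hp.1.continuous).union
    (isClosed_iUnion_of_finite fun x'' =>
      (isCompact_range x''.1.1.continuous).isClosed)).preimage K.continuous
  have hM : M₁ ∪ M₂ = univ := by
    refine eq_univ_of_forall fun m => ?_
    have hx : p (K m) ∈ B ∨ p (K m) ∈ RelCWComplex.closedCell 3 (R.cell3 x) := by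
      rcases R.dressedStar_subset_skeleton q (hK m) with h | h
      · exact Or.inl (Or.inl h)
      · obtain ⟨y, hy⟩ := mem_iUnion.1 h
        by_cases hyx : y = x
        · exact Or.inr (hyx ▸ hy)
        · exact Or.inl (Or.inr (mem_iUnion.2 ⟨⟨y, hyx⟩, hy⟩))
    rcases hx with h | h
    · exact Or.inr (Or.inl h)
    · rw [← range_charMap] at h
      obtain ⟨v, hv⟩ := h
      obtain ⟨f, hf, hfv⟩ := exists_lift_through hp.1 (charMap 3 (R.cell3 x)) v (K m) hv.symm
      by_cases hfx : (⟨f, hf⟩ : LiftedCell p (charMap 3 (R.cell3 x))) = x'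
      · refine Or.inl ⟨v, ?_⟩
        rw [← hfx]
        exact hfv
      · exact Or.inr (Or.inr (mem_iUnion.2 ⟨⟨⟨f, hf⟩, hfx⟩, v, hfv⟩))
  rw [← continuousOn_univ, ← hM]
  refine ContinuousOn.union_of_isClosed ?_ ?_ hM₁ hM₂
  · have h : ContinuousOn (collapse x'.1) (range x'.1) := by
      refine continuousOn_range_of_comp x'.1.continuous ?_
      refine (continuous_collapse_id 3).congr fun w => ?_
      refine collapse_eq_collapse (fun _ _ h => openToDisk_injective 3 h)
        x'.openToDisk_injective fun v => ⟨fun h => congrArg x'.1 h, fun h => ?_⟩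
      refine (charMap_eq_charMap_openToDisk (c := R.cell3 x) (c' := R.cell3 x) ?_).2.symm
      rw [← x'.2, ← x'.2, h]
    exact h.comp K.continuous.continuousOn fun m hm => hm
  · refine continuousOn_const (c := OnePoint.infty).congr fun m hm => ?_
    refine collapse_eq_infty fun v hv => ?_
    have hpv : p (K m) = charMap 3 (R.cell3 x) (openToDisk 3 v) := by rw [← hv, x'.2]
    rcases hm with (hm | hm) | hm
    · rw [hpv] at hm
      exact (RelCWComplex.disjoint_skeletonLT_openCell le_rfl).le_bot
        ⟨hm, charMap_openToDisk_mem _ _⟩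
    · obtain ⟨⟨y, hy⟩, hm⟩ := mem_iUnion.1 hm
      rw [hpv, ← range_charMap] at hm
      obtain ⟨w, hw⟩ := hm
      exact hy (R.cell3.injective (charMap_eq_charMap_openToDisk hw).1)
    · obtain ⟨⟨x'', hne⟩, w, hw⟩ := mem_iUnion.1 hm
      have h1 : charMap 3 (R.cell3 x) w = charMap 3 (R.cell3 x) (openToDisk 3 v) := by
        rw [← x''.2, ← hpv]
        exact congrArg p hw
      have h2 := (charMap_eq_charMap_openToDisk h1).2
      apply hne
      apply (liftedCellEquiv hp.1 _ w).injective
      apply Subtype.ext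
      change x''.1 w = x'.1 w
      rw [h2] at hw ⊢
      exact hw.trans hv.symm

/-- The incidence number of lifts of a 4-cell and a 3-cell can be computed from a lift of the
standard attaching map. -/
theorem exists_lifted_standard (hp : IsFiniteCovering p) {q : Q}
    (q' : LiftedCell p (charMap 4 (R.cell4 q))) :
    ∃ (φ : C(Sph 3, L)) (φ' : C(Sph 3, E)), R.IsStandardAttaching q φ ∧ (∀ y, p (φ' y) = φ y) ∧
      φ' basePoint = q'.1 (sphToDisk 3 (corner 3)) ∧
      ∀ (x : X) (x' : LiftedCell p (charMap 3 (R.cell3 x))),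
        incidence q'.1 x'.1 = degree fun y => collapse x'.1 (φ' y) := by
  obtain ⟨φ, hφ, ⟨F⟩⟩ := R.attach4 q
  have hF₀ : ∀ y, F (0, y) = p (q'.1 (sphToDisk 3 y)) := by
    intro y
    rw [q'.2]
    exact F.apply_zero y
  -- The homotopy to the standard map is lifted starting from the boundary of `q'`. It stays over
  -- the dressed star, where the collapse onto a lifted 3-cell is continuous.
  let K : C(unitInterval × Sph 3, E) :=
    hp.1.liftHomotopy F.toContinuousMap (q'.1.comp (sphToDisk 3)) hF₀
  have hpK : ∀ a, p (K a) = F a := fun a => congrFun (hp.1.liftHomotopy_lifts _ _ hF₀) a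
  have hK₀ : ∀ y, K (0, y) = q'.1 (sphToDisk 3 y) := hp.1.liftHomotopy_zero _ _ hF₀
  have hKs : ∀ a, p (K a) ∈ R.dressedStar q := by
    rintro ⟨t, y⟩
    rw [hpK]
    exact (F.prop t).2 ⟨y, rfl⟩
  refine ⟨φ, K.comp ⟨fun y => (1, y), by fun_prop⟩, hφ, fun y => ?_, ?_, fun x x' => ?_⟩
  · exact (hpK _).trans (F.apply_one y)
  -- The homotopy fixes the base point downstairs, so its lift fixes it upstairs.
  · have h := lift_unique hp.1 (f := fun t => K (t, basePoint)) (g := fun _ => K (0, basePoint))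
      (by fun_prop) continuous_const (fun t => ?_) 0 rfl 1
    · exact h.trans (hK₀ _)
    · rw [hpK, hpK]
      exact (F.prop t).1.trans (F.prop 0).1.symm
  · have hc := R.continuous_collapse_comp hp x' K hKs
    let f₀ : C(Sph 3, OnePoint (OpenDisk 3)) := ⟨fun y => collapse x'.1 (K (0, y)),
      hc.comp (Continuous.prodMk_right 0)⟩
    let f₁ : C(Sph 3, OnePoint (OpenDisk 3)) := ⟨fun y => collapse x'.1 (K (1, y)),
      hc.comp (Continuous.prodMk_right 1)⟩
    have h : f₀.Homotopic f₁ := ⟨⟨⟨_, hc⟩, fun _ => rfl, fun _ => rfl⟩⟩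
    refine Eq.trans ?_ (degree_eq_of_homotopic h)
    unfold incidence
    congr 1
    funext y
    exact congrArg (collapse x'.1) (hK₀ y).symm

end CellularRealization

/-! ## Lifts of the standard attaching map of a 4-cell -/

theorem norm_vec_three_le {a b c r : ℝ} (hr : 0 ≤ r) :
    ‖(![a, b, c] : Fin 3 → ℝ)‖ ≤ r ↔ |a| ≤ r ∧ |b| ≤ r ∧ |c| ≤ r := by
  rw [pi_norm_le_iff_of_nonneg hr, Fin.forall_fin_succ, Fin.forall_fin_succ, Fin.forall_fin_succ]
  simp

theorem abs_apply_le_one {n : ℕ} {v : Fin n → ℝ} (hv : ‖v‖ ≤ 1) (i : Fin n) : |v i| ≤ 1 :=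
  (norm_le_pi_norm v i).trans hv

theorem cons_mem_sphere {a b c : ℝ} (ha : |a| ≤ 1) (hb : |b| ≤ 1) (hc : |c| ≤ 1) {d : ℝ}
    (hd : |d| ≤ 1) (h : |b| = 1 ∨ |d| = 1) :
    (![a, b, c, d] : Fin 4 → ℝ) ∈ sphere (0 : Fin 4 → ℝ) 1 := by
  rw [mem_sphere_zero_iff_norm]
  apply le_antisymm
  · rw [pi_norm_le_iff_of_nonneg zero_le_one, Fin.forall_fin_succ, Fin.forall_fin_succ,
      Fin.forall_fin_succ, Fin.forall_fin_succ]
    simp [ha, hb, hc, hd]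
  · rcases h with h | h
    · exact h.symm.le.trans (norm_le_pi_norm (![a, b, c, d] : Fin 4 → ℝ) 1)
    · exact h.symm.le.trans (norm_le_pi_norm (![a, b, c, d] : Fin 4 → ℝ) 3)

/-- The inverse of `slab`. -/
def unslab (t : ℕ) (i : Fin t) (r : ℝ) : ℝ := (r + (2 * i + 1)) / t - 1

theorem slab_unslab {t : ℕ} (i : Fin t) (r : ℝ) : CellLabelling.slab t i (unslab t i r) = r := by
  have ht : (t : ℝ) ≠ 0 := by exact_mod_cast i.pos.ne'
  unfold CellLabelling.slab unslab
  field_simp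
  ring

theorem unslab_slab {t : ℕ} (i : Fin t) (r : ℝ) : unslab t i (CellLabelling.slab t i r) = r := by
  have ht : (t : ℝ) ≠ 0 := by exact_mod_cast i.pos.ne'
  unfold CellLabelling.slab unslab
  field_simp
  ring

theorem abs_unslab_le {t : ℕ} (i : Fin t) {r : ℝ} (hr : |r| ≤ 1) : |unslab t i r| ≤ 1 := by
  have ht : (0 : ℝ) < t := by exact_mod_cast i.pos
  have hi : (i : ℝ) + 1 ≤ t := by exact_mod_cast i.2
  have hi0 : (0 : ℝ) ≤ i := Nat.cast_nonneg _
  obtain ⟨h1, h2⟩ := abs_le.1 hr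
  unfold unslab
  rw [abs_le]
  constructor
  · have : 0 ≤ (r + (2 * i + 1)) / t := div_nonneg (by linarith) ht.le
    linarith
  · have : (r + (2 * i + 1)) / t ≤ 2 := by
      rw [div_le_iff₀ ht]
      linarith
    linarith

theorem exists_slab {t : ℕ} (ht : 0 < t) {r : ℝ} (hr : |r| ≤ 1) :
    ∃ i : Fin t, |CellLabelling.slab t i r| ≤ 1 := by
  have ht' : (0 : ℝ) < t := by exact_mod_cast ht
  obtain ⟨h1, h2⟩ := abs_le.1 hr
  have h0 : 0 ≤ t * (r + 1) / 2 := by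
    have : 0 ≤ t * (r + 1) := mul_nonneg ht'.le (by linarith)
    linarith
  have hle : t * (r + 1) / 2 ≤ t := by nlinarith
  have hf1 := Nat.floor_le h0
  have hf2 := Nat.lt_floor_add_one (t * (r + 1) / 2)
  rcases lt_or_ge ⌊t * (r + 1) / 2⌋₊ t with h | h
  · refine ⟨⟨_, h⟩, ?_⟩
    unfold CellLabelling.slab
    rw [abs_le]
    constructor <;> simp only <;> linarith
  · have h' : (t : ℝ) ≤ ⌊t * (r + 1) / 2⌋₊ := by exact_mod_cast h
    -- Only the right end `r = 1` reaches this case: there the floor is `t`, and the last slab is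
    -- the right one.
    refine ⟨⟨t - 1, by omega⟩, ?_⟩
    unfold CellLabelling.slab
    rw [abs_le]
    push_cast [Nat.cast_sub ht]
    constructor <;> linarith

/-- The embedding of the cube onto the `i`-th of `t` slabs of the top face of the 4-cube. -/
def slabFace (t : ℕ) (i : Fin t) : C(Disk 3, Sph 3) where
  toFun w := ⟨![unslab t i (w.1 0), w.1 1, w.1 2, 1], by
    have hw : ‖w.1‖ ≤ 1 := mem_closedBall_zero_iff.1 w.2
    exact cons_mem_sphere (abs_unslab_le i (abs_apply_le_one hw 0)) (abs_apply_le_one hw 1)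
      (abs_apply_le_one hw 2) (by simp) (Or.inr (by simp))⟩
  continuous_toFun := by
    refine Continuous.subtype_mk (continuous_pi fun j => ?_) _
    have h : ∀ k : Fin 3, Continuous fun w : Disk 3 => w.1 k := fun k =>
      (continuous_apply k).comp continuous_subtype_val
    fin_cases j
    · exact (((h 0).add continuous_const).div_const _).sub continuous_const
    · exact h 1
    · exact h 2
    · exact continuous_const

/-- The segment in the boundary of the 4-cube from the base point to the corner of a slab. -/
def slabSegment (t : ℕ) (i : Fin t) : C(Disk 1, Sph 3) where
  -- The second coordinate stays `-1`, which keeps the segment on the boundary. The last coordinate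
  -- is `1` only at the final point, so a standard map is constant on the segment before it reaches
  -- the slab.
  toFun r := ⟨![-1 + (r.1 0 + 1) / 2 * (unslab t i (-1) + 1), -1, -1, r.1 0], by
    have hr := abs_apply_le_one (mem_closedBall_zero_iff.1 r.2) 0
    refine cons_mem_sphere ?_ (by simp) (by simp) hr (Or.inl (by simp))
    have hu := abs_le.1 (abs_unslab_le i (r := -1) (by simp))
    have hr' := abs_le.1 hr
    rw [abs_le]
    constructor <;> nlinarith⟩
  continuous_toFun := by
    refine Continuous.subtype_mk (continuous_pi fun j => ?_) _
    have h : Continuous fun w : Disk 1 => w.1 0 :=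
      (continuous_apply 0).comp continuous_subtype_val
    fin_cases j
    · exact continuous_const.add (((h.add continuous_const).div_const _).mul continuous_const)
    · exact continuous_const
    · exact continuous_const
    · exact h

namespace CellularRealization

variable {X Q Z : Type*} [Fintype X] [Fintype Q] [Fintype Z] {C : CSSCode X Q Z}
  {D : ZLift C} {G : OneSkeleton D} {L : Type u} [TopologicalSpace L] [CWComplex (univ : Set L)]
  (R : CellularRealization G L) [T2Space L] {E : Type*} [TopologicalSpace E] {p : E → L}

/-- The lift of the edge of the leg `l` which ends at `b` starts at `a`. -/
def IsLegLift (p : E → L) (q : Q) (l : D.Leg q) (a b : E) : Prop :=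
  ∃ γ : LiftedCell p (charMap 1 (R.cell1 (Sum.inl ⟨q, l⟩))),
    γ.1 (endpoint false) = a ∧ γ.1 (endpoint true) = b

theorem standard_slabFace {q : Q} {φ : C(Sph 3, L)} (hφ : R.IsStandardAttaching q φ)
    (l : D.Leg q) (w : Disk 3) :
    φ (slabFace _ (Fintype.equivFin (D.Leg q) l) w) = R.legMap q l w.1 := by
  have hw : ‖w.1‖ ≤ 1 := mem_closedBall_zero_iff.1 w.2
  have h := hφ.1 (slabFace _ (Fintype.equivFin (D.Leg q) l) w) l rfl
  have h0 : CellLabelling.slab _ (Fintype.equivFin (D.Leg q) l)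
      ((slabFace _ (Fintype.equivFin (D.Leg q) l) w).1 0) = w.1 0 := slab_unslab _ _
  rw [h0] at h
  rw [h (abs_apply_le_one hw 0)]
  congr 1
  funext j
  fin_cases j <;> rfl

theorem eq_slabFace {q : Q} (l : D.Leg q) (y : Sph 3) (hy : y.1 3 = 1)
    (h : |CellLabelling.slab _ (Fintype.equivFin (D.Leg q) l) (y.1 0)| ≤ 1) :
    ∃ w, slabFace _ (Fintype.equivFin (D.Leg q) l) w = y := by
  have hy1 : ‖y.1‖ ≤ 1 := (mem_sphere_zero_iff_norm.1 y.2).le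
  refine ⟨⟨![CellLabelling.slab _ (Fintype.equivFin (D.Leg q) l) (y.1 0), y.1 1, y.1 2], ?_⟩, ?_⟩
  · rw [mem_closedBall_zero_iff, norm_vec_three_le zero_le_one]
    exact ⟨h, abs_apply_le_one hy1 1, abs_apply_le_one hy1 2⟩
  · apply Subtype.ext
    funext j
    fin_cases j
    · exact unslab_slab _ _
    · rfl
    · rfl
    · exact hy.symm

/-- A point outside all slabs is sent to the vertex `q`. -/
theorem standard_cases {q : Q} {φ : C(Sph 3, L)} (hφ : R.IsStandardAttaching q φ) (y : Sph 3) :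
    φ y = R.vertex (Sum.inr q) ∨
      ∃ (l : D.Leg q) (w : Disk 3), slabFace _ (Fintype.equivFin (D.Leg q) l) w = y := by
  by_cases h : y.1 3 = 1 → IsEmpty (D.Leg q)
  · exact Or.inl (hφ.2 y h)
  · push Not at h
    obtain ⟨hy, hne⟩ := h
    have hy1 : ‖y.1‖ ≤ 1 := (mem_sphere_zero_iff_norm.1 y.2).le
    obtain ⟨i, hi⟩ := exists_slab (t := Fintype.card (D.Leg q)) Fintype.card_pos
      (abs_apply_le_one hy1 0)
    refine Or.inr ⟨(Fintype.equivFin (D.Leg q)).symm i, eq_slabFace _ y hy ?_⟩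
    rwa [Equiv.apply_symm_apply]

/-! ### Inner cube and shell of a slab -/

/-- The change of coordinates on the 3-cube by the sign of the leg `l`. -/
def signFlip (q : Q) (l : D.Leg q) (a : Fin 3 → ℝ) : Fin 3 → ℝ :=
  ![((D.d1 l.1 q).sign : ℝ) * a 0, a 1, a 2]

theorem sign_mul_sign (q : Q) (l : D.Leg q) :
    ((D.d1 l.1 q).sign : ℝ) * ((D.d1 l.1 q).sign : ℝ) = 1 := by
  obtain ⟨x, i⟩ := l
  have h : D.d1 x q ≠ 0 := fun h => absurd i.2 (by simp [h])
  rcases lt_or_gt_of_ne h with h | h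
  · simp [Int.sign_eq_neg_one_of_neg h]
  · simp [Int.sign_eq_one_of_pos h]

theorem signFlip_signFlip (q : Q) (l : D.Leg q) (a : Fin 3 → ℝ) :
    signFlip q l (signFlip q l a) = a := by
  funext j
  fin_cases j
  · simp [signFlip, ← mul_assoc, sign_mul_sign]
  · rfl
  · rfl

theorem abs_sign (q : Q) (l : D.Leg q) : |((D.d1 l.1 q).sign : ℝ)| = 1 := by
  have h := sign_mul_sign q l
  rw [← abs_mul_abs_self] at h
  nlinarith [abs_nonneg ((D.d1 l.1 q).sign : ℝ)]

theorem norm_signFlip (q : Q) (l : D.Leg q) (a : Fin 3 → ℝ) : ‖signFlip q l a‖ = ‖a‖ := by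
  have key : ∀ a, ‖signFlip q l a‖ ≤ ‖a‖ := by
    intro a
    rw [signFlip, norm_vec_three_le (norm_nonneg _), abs_mul, abs_sign, one_mul]
    exact ⟨norm_le_pi_norm a 0, norm_le_pi_norm a 1, norm_le_pi_norm a 2⟩
  refine le_antisymm (key a) ?_
  conv_lhs => rw [← signFlip_signFlip q l a]
  exact key _

theorem continuous_signFlip (q : Q) (l : D.Leg q) : Continuous (signFlip q l) := by
  refine continuous_pi fun j => ?_
  fin_cases j
  · exact continuous_const.mul (continuous_apply 0)
  · exact continuous_apply 1
  · exact continuous_apply 2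

/-- The point of the inner cube of a slab which is sent to the point `a` of the 3-cell. -/
def innerPoint (q : Q) (l : D.Leg q) : C(Disk 3, Disk 3) where
  toFun a := ⟨(1 / 2 : ℝ) • signFlip q l a.1, by
    have ha : ‖a.1‖ ≤ 1 := mem_closedBall_zero_iff.1 a.2
    rw [mem_closedBall_zero_iff, norm_smul, norm_signFlip, Real.norm_of_nonneg (by norm_num)]
    linarith⟩
  continuous_toFun := by
    have h : Continuous fun a : Disk 3 => signFlip q l a.1 :=
      (continuous_signFlip q l).comp continuous_subtype_val
    exact (h.const_smul (1 / 2 : ℝ)).subtype_mk _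

theorem norm_innerPoint (q : Q) (l : D.Leg q) (a : Disk 3) : ‖(innerPoint q l a).1‖ = ‖a.1‖ / 2 := by
  change ‖(1 / 2 : ℝ) • signFlip q l a.1‖ = _
  rw [norm_smul, norm_signFlip, Real.norm_of_nonneg (by norm_num)]
  ring

theorem legMap_innerPoint (q : Q) (l : D.Leg q) (a : Disk 3) :
    R.legMap q l (innerPoint q l a).1 = charMap 3 (R.cell3 l.1) a := by
  have ha : ‖a.1‖ ≤ 1 := mem_closedBall_zero_iff.1 a.2
  have hn : ‖(innerPoint q l a).1‖ ≤ 1 / 2 := by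
    rw [norm_innerPoint]
    linarith
  unfold CellLabelling.legMap
  rw [if_pos hn]
  refine congrArg (RelCWComplex.map 3 (R.cell3 l.1)) ?_
  funext j
  fin_cases j
  · change 2 * ((D.d1 l.1 q).sign : ℝ) * (1 / 2 * (((D.d1 l.1 q).sign : ℝ) * a.1 0)) = a.1 0
    linear_combination a.1 0 * sign_mul_sign q l
  · change 2 * (1 / 2 * a.1 1) = a.1 1
    ring
  · change 2 * (1 / 2 * a.1 2) = a.1 2
    ring

theorem exists_innerPoint (q : Q) (l : D.Leg q) (w : Disk 3) (hw : ‖w.1‖ ≤ 1 / 2) :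
    ∃ a, innerPoint q l a = w := by
  refine ⟨⟨signFlip q l ((2 : ℝ) • w.1), ?_⟩, ?_⟩
  · rw [mem_closedBall_zero_iff, norm_signFlip, norm_smul, Real.norm_of_nonneg (by norm_num)]
    linarith
  · apply Subtype.ext
    change (1 / 2 : ℝ) • signFlip q l (signFlip q l ((2 : ℝ) • w.1)) = w.1
    rw [signFlip_signFlip, smul_smul]
    norm_num

/-- The ray of the shell of the 3-cube through the boundary point `y`. -/
def shellRay (y : Sph 2) : C(Disk 1, Disk 3) where
  -- The radius runs from `1/2` to `1`, inverting the edge parameter `4 * ‖v‖ - 3` of `legMap`.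
  toFun r := ⟨((r.1 0 + 3) / 4) • y.1, by
    have hy : ‖y.1‖ = 1 := mem_sphere_zero_iff_norm.1 y.2
    have hr := abs_le.1 (abs_apply_le_one (mem_closedBall_zero_iff.1 r.2) 0)
    rw [mem_closedBall_zero_iff, norm_smul, hy, Real.norm_of_nonneg (by linarith)]
    linarith⟩
  continuous_toFun := by
    have h : Continuous fun w : Disk 1 => w.1 0 :=
      (continuous_apply 0).comp continuous_subtype_val
    exact Continuous.subtype_mk
      (((h.add continuous_const).div_const _).smul continuous_const) _

theorem shellRay_true (y : Sph 2) : shellRay y (endpoint true) = sphToDisk 2 y := by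
  apply Subtype.ext
  change ((1 + 3 : ℝ) / 4) • y.1 = y.1
  norm_num

theorem shellRay_false (q : Q) (l : D.Leg q) (y : Sph 2) :
    ∃ y', shellRay y (endpoint false) = innerPoint q l (sphToDisk 2 y') := by
  have hy : ‖y.1‖ = 1 := mem_sphere_zero_iff_norm.1 y.2
  refine ⟨⟨signFlip q l y.1, by rw [mem_sphere_zero_iff_norm, norm_signFlip, hy]⟩, ?_⟩
  apply Subtype.ext
  change ((-1 + 3 : ℝ) / 4) • y.1 = (1 / 2 : ℝ) • signFlip q l (signFlip q l y.1)
  rw [signFlip_signFlip]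
  norm_num

theorem legMap_shellRay (q : Q) (l : D.Leg q) (y : Sph 2) (r : Disk 1) :
    R.legMap q l (shellRay y r).1 = charMap 1 (R.cell1 (Sum.inl ⟨q, l⟩)) r := by
  have hy : ‖y.1‖ = 1 := mem_sphere_zero_iff_norm.1 y.2
  have hr := abs_le.1 (abs_apply_le_one (mem_closedBall_zero_iff.1 r.2) 0)
  have hn : ‖(shellRay y r).1‖ = (r.1 0 + 3) / 4 := by
    change ‖((r.1 0 + 3) / 4) • y.1‖ = _
    rw [norm_smul, hy, Real.norm_of_nonneg (by linarith), mul_one]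
  -- At radius exactly `1/2`, `legMap` uses its inner branch. The values agree because the boundary
  -- of the 3-cell is collapsed to the initial vertex of the edge.
  by_cases h : (r.1 0 + 3) / 4 ≤ 1 / 2
  · have hr1 : r = endpoint false := by
      apply Subtype.ext
      funext j
      rw [Subsingleton.elim j 0]
      change r.1 0 = -1
      linarith
    subst hr1
    obtain ⟨y', hy'⟩ := shellRay_false q l y
    rw [hy', legMap_innerPoint, R.charMap_three_sphToDisk, R.charMap_endpoint_false]
    rfl
  · unfold CellLabelling.legMap
    rw [hn, if_neg h]
    refine congrArg (RelCWComplex.map 1 (R.cell1 (Sum.inl ⟨q, l⟩))) ?_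
    funext j
    rw [Subsingleton.elim j 0]
    ring

theorem exists_shellRay (w : Disk 3) (hw : 1 / 2 ≤ ‖w.1‖) : ∃ y r, shellRay y r = w := by
  have hw1 : ‖w.1‖ ≤ 1 := mem_closedBall_zero_iff.1 w.2
  have h0 : ‖w.1‖ ≠ 0 := by linarith
  refine ⟨⟨‖w.1‖⁻¹ • w.1, ?_⟩, ⟨fun _ => 4 * ‖w.1‖ - 3, ?_⟩, ?_⟩
  · rw [mem_sphere_zero_iff_norm, norm_smul, norm_inv, norm_norm, inv_mul_cancel₀ h0]
  · rw [mem_closedBall_zero_iff, pi_norm_const, Real.norm_eq_abs, abs_le]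
    constructor <;> linarith
  · apply Subtype.ext
    change ((4 * ‖w.1‖ - 3 + 3) / 4) • ‖w.1‖⁻¹ • w.1 = w.1
    rw [smul_smul, show (4 * ‖w.1‖ - 3 + 3) / 4 * ‖w.1‖⁻¹ = 1 by field_simp; ring, one_smul]

/-! ### Lifts of the standard map on a single slab -/

section Lift

variable {q : Q} {φ : C(Sph 3, L)} (hφ : R.IsStandardAttaching q φ) (hp : IsCoveringMap p)
  {φ' : C(Sph 3, E)} (hφ' : ∀ y, p (φ' y) = φ y) (l : D.Leg q)

include hφ hp hφ'

/-- The standard map is constant on the boundary of the slab and on the segment joining it to the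
base point. A lift of a constant map on a connected space is constant. -/
theorem lift_slabFace_sphToDisk (y : Sph 2) :
    φ' (slabFace _ (Fintype.equivFin (D.Leg q) l) (sphToDisk 2 y)) = φ' basePoint := by
  have := preconnectedSpace_sph (n := 2) (by omega)
  set i := Fintype.equivFin (D.Leg q) l with hi
  have hφb : ∀ y, φ (slabFace _ i (sphToDisk 2 y)) = R.vertex (Sum.inr q) := by
    intro y
    rw [hi, R.standard_slabFace hφ, ← shellRay_true, legMap_shellRay, R.charMap_endpoint_true]
    rfl
  have h1 : slabSegment _ i (endpoint true) = slabFace _ i (sphToDisk 2 (corner 2)) := by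
    apply Subtype.ext
    funext j
    fin_cases j
    · change -1 + (1 + 1) / 2 * (unslab _ i (-1) + 1) = unslab _ i (-1)
      ring
    · rfl
    · rfl
    · rfl
  have h2 : slabSegment _ i (endpoint false) = basePoint := by
    apply Subtype.ext
    funext j
    fin_cases j
    · change -1 + (-1 + 1) / 2 * (unslab _ i (-1) + 1) = (-1 : ℝ)
      ring
    · rfl
    · rfl
    · rfl
  have h3 : ∀ r, φ (slabSegment _ i r) = R.vertex (Sum.inr q) := by
    intro r
    by_cases hr : r.1 0 = 1
    · have : r = endpoint true := by
        apply Subtype.ext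
        funext j
        rw [Subsingleton.elim j 0]
        exact hr
      rw [this, h1, hφb]
    · exact hφ.2 _ fun h => absurd h hr
  have h4 : φ' (slabSegment _ i (endpoint true)) = φ' (slabSegment _ i (endpoint false)) :=
    hp.const_of_comp (g := fun r => φ' (slabSegment _ i r)) (by fun_prop)
      (fun a b => by rw [hφ', hφ', h3, h3]) _ _
  rw [← h2, ← h4, h1]
  exact hp.const_of_comp (g := fun y => φ' (slabFace _ i (sphToDisk 2 y))) (by fun_prop)
      (fun a b => by rw [hφ', hφ', hφb, hφb]) _ _

/-- Every ray of the shell lifts the same edge with the same final point. -/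
theorem lift_slabFace_shellRay (γ : LiftedCell p (charMap 1 (R.cell1 (Sum.inl ⟨q, l⟩))))
    (hγ : γ.1 (endpoint true) = φ' basePoint) (y : Sph 2) (r : Disk 1) :
    φ' (slabFace _ (Fintype.equivFin (D.Leg q) l) (shellRay y r)) = γ.1 r := by
  refine lift_unique hp
    (f := fun r => φ' (slabFace _ (Fintype.equivFin (D.Leg q) l) (shellRay y r))) (g := γ.1)
    (by fun_prop) γ.1.continuous (fun r => ?_) (endpoint true) ?_ r
  · rw [hφ', R.standard_slabFace hφ, legMap_shellRay, γ.2]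
  · rw [shellRay_true, hγ]
    exact R.lift_slabFace_sphToDisk hφ hp hφ' l y

/-- Both sides lift the 3-cell. They agree at one boundary point, because `ξ` is constant on the
boundary sphere and the rays of the shell bring the lift to the initial point of `γ`. -/
theorem lift_slabFace_innerPoint (γ : LiftedCell p (charMap 1 (R.cell1 (Sum.inl ⟨q, l⟩))))
    (hγ : γ.1 (endpoint true) = φ' basePoint) (ξ : LiftedCell p (charMap 3 (R.cell3 l.1)))
    (hξ : ξ.1 (sphToDisk 2 (corner 2)) = γ.1 (endpoint false)) (a : Disk 3) :
    φ' (slabFace _ (Fintype.equivFin (D.Leg q) l) (innerPoint q l a)) = ξ.1 a := by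
  have := preconnectedSpace_sph (n := 2) (by omega)
  obtain ⟨y', hy'⟩ := shellRay_false q l (corner 2)
  refine lift_unique hp
    (f := fun a => φ' (slabFace _ (Fintype.equivFin (D.Leg q) l) (innerPoint q l a))) (g := ξ.1)
    (by fun_prop) ξ.1.continuous (fun a => ?_) (sphToDisk 2 y') ?_ a
  · rw [hφ', R.standard_slabFace hφ, legMap_innerPoint, ξ.2]
  · have h : ξ.1 (sphToDisk 2 y') = ξ.1 (sphToDisk 2 (corner 2)) :=
      hp.const_of_comp (g := fun y => ξ.1 (sphToDisk 2 y)) (by fun_prop)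
        (fun a b => by rw [ξ.2, ξ.2, R.charMap_three_sphToDisk, R.charMap_three_sphToDisk]) _ _
    rw [h, hξ, ← hy']
    exact R.lift_slabFace_shellRay hφ hp hφ' l γ hγ _ _

end Lift

/-- The points which a lift of the standard map sends to the interior of a lifted 3-cell. -/
theorem eq_lifted_standard_iff {q : Q} {φ : C(Sph 3, L)} (hφ : R.IsStandardAttaching q φ)
    (hp : IsCoveringMap p) {φ' : C(Sph 3, E)} (hφ' : ∀ y, p (φ' y) = φ y) {x : X}
    (x' : LiftedCell p (charMap 3 (R.cell3 x))) (y : Sph 3) (v : OpenDisk 3) :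
    x'.1 (openToDisk 3 v) = φ' y ↔ ∃ l : D.Leg q, l.1 = x ∧
      R.IsLegLift p q l (x'.1 (sphToDisk 2 (corner 2))) (φ' basePoint) ∧
      slabFace _ (Fintype.equivFin (D.Leg q) l) (innerPoint q l (openToDisk 3 v)) = y := by
  constructor
  · intro h
    have hpv : φ y = charMap 3 (R.cell3 x) (openToDisk 3 v) := by rw [← hφ', ← h, x'.2]
    have hopen := charMap_openToDisk_mem (R.cell3 x) v
    rw [← hpv] at hopen
    have hd := disjoint_of_subset_skeleton (n := 3) le_rfl subset_rfl (R.cell3 x)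
    -- Vertices and edges miss the open 3-cells, so only points of the inner cube of some slab are
    -- possible.
    rcases R.standard_cases hφ y with hy | ⟨l, w, rfl⟩
    · rw [hy] at hopen
      exact (hd.le_bot ⟨R.vertex_mem_skeleton (by omega) _, hopen⟩).elim
    · rcases le_total ‖w.1‖ (1 / 2) with hw | hw
      · obtain ⟨a, rfl⟩ := exists_innerPoint q l w hw
        rw [R.standard_slabFace hφ, legMap_innerPoint] at hpv
        obtain ⟨hc, rfl⟩ := charMap_eq_charMap_openToDisk hpv
        have hx := R.cell3.injective hc
        subst hx
        refine ⟨l, rfl, ?_, rfl⟩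
        have hb : p (φ' basePoint) =
            charMap 1 (R.cell1 (Sum.inl ⟨q, l⟩)) (endpoint true) := by
          rw [hφ', hφ.2 basePoint (fun h => by norm_num [basePoint] at h),
            R.charMap_endpoint_true]
          rfl
        obtain ⟨γ, hγ, hγ1⟩ := exists_lift_through hp _ _ _ hb
        have hc : p (γ (endpoint false)) =
            charMap 3 (R.cell3 l.1) (sphToDisk 2 (corner 2)) := by
          rw [hγ, R.charMap_endpoint_false, R.charMap_three_sphToDisk]
          rfl
        obtain ⟨ξ, hξ, hξ1⟩ := exists_lift_through hp _ _ _ hc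
        have key := R.lift_slabFace_innerPoint hφ hp hφ' l ⟨γ, hγ⟩ hγ1 ⟨ξ, hξ⟩ hξ1 (openToDisk 3 v)
        refine ⟨⟨γ, hγ⟩, ?_, hγ1⟩
        change γ (endpoint false) = _
        rw [← hξ1]
        -- The 3-cell at the far end of the lifted leg shares an interior point with `x'`, so the
        -- two lifts coincide.
        refine lift_unique hp ξ.continuous x'.1.continuous (fun a => ?_) (openToDisk 3 v) ?_ _
        · rw [hξ, x'.2]
        · rw [h, key]
      · obtain ⟨y, r, rfl⟩ := exists_shellRay w hw
        rw [R.standard_slabFace hφ, legMap_shellRay] at hopen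
        exact (hd.le_bot ⟨closedCell_subset_skeleton (by omega) _
          (charMap_mem_closedCell _ _ _), hopen⟩).elim
  · rintro ⟨l, rfl, ⟨γ, hγ0, hγ1⟩, rfl⟩
    exact (R.lift_slabFace_innerPoint hφ hp hφ' l γ hγ1 x' hγ0.symm _).symm

end CellularRealization

/-- The incidence numbers of lifted 4-cells and 3-cells only depend on the lifted legs. -/
theorem incidence_four_three_eq {X Q Z : Type*} [Fintype X] [Fintype Q] [Fintype Z]
    {C : CSSCode X Q Z} {D : ZLift C} {G : OneSkeleton D} {L₁ L₂ : Type u}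
    [TopologicalSpace L₁] [CWComplex (univ : Set L₁)] [T2Space L₁]
    [TopologicalSpace L₂] [CWComplex (univ : Set L₂)] [T2Space L₂]
    (R₁ : CellularRealization G L₁) (R₂ : CellularRealization G L₂)
    {E₁ E₂ : Type*} [TopologicalSpace E₁] [TopologicalSpace E₂] {p₁ : E₁ → L₁} {p₂ : E₂ → L₂}
    (hp₁ : IsFiniteCovering p₁) (hp₂ : IsFiniteCovering p₂) {q : Q} {x : X}
    (q₁ : LiftedCell p₁ (charMap 4 (R₁.cell4 q))) (q₂ : LiftedCell p₂ (charMap 4 (R₂.cell4 q)))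
    (x₁ : LiftedCell p₁ (charMap 3 (R₁.cell3 x))) (x₂ : LiftedCell p₂ (charMap 3 (R₂.cell3 x)))
    (h : ∀ l : D.Leg q, l.1 = x →
      (R₁.IsLegLift p₁ q l (x₁.1 (sphToDisk 2 (corner 2))) (q₁.1 (sphToDisk 3 (corner 3))) ↔
        R₂.IsLegLift p₂ q l (x₂.1 (sphToDisk 2 (corner 2))) (q₂.1 (sphToDisk 3 (corner 3))))) :
    incidence q₁.1 x₁.1 = incidence q₂.1 x₂.1 := by
  obtain ⟨φ₁, φ₁', h₁, h₁', hb₁, hi₁⟩ := R₁.exists_lifted_standard hp₁ q₁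
  obtain ⟨φ₂, φ₂', h₂, h₂', hb₂, hi₂⟩ := R₂.exists_lifted_standard hp₂ q₂
  rw [hi₁, hi₂]
  -- The collapsed maps are equal as functions: `slabFace` and `innerPoint` depend only on the
  -- `ℤ`-lift, and the coverings enter only through the lifted legs.
  congr 1
  funext y
  refine collapse_eq_collapse x₁.openToDisk_injective x₂.openToDisk_injective fun v => ?_
  rw [R₁.eq_lifted_standard_iff h₁ hp₁.1 h₁', R₂.eq_lifted_standard_iff h₂ hp₂.1 h₂', hb₁, hb₂]
  refine exists_congr fun l => and_congr_right fun hl => ?_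
  rw [h l hl]

/-! ## The classifying map of a finite covering -/

/-- The product of copies of the line indexed by the continuous functions on `E`. -/
abbrev FunSpace (E : Type*) [TopologicalSpace E] : Type _ := C(E, ℝ) → ℝ

/-- The evaluation map into sequences in the space `FunSpace E`. -/
def evalSeq {E : Type*} [TopologicalSpace E] (e : E) : ℕ → FunSpace E := fun _ φ => φ e

theorem continuous_evalSeq {E : Type*} [TopologicalSpace E] :
    Continuous (evalSeq : E → ℕ → FunSpace E) :=
  continuous_pi fun _ => continuous_pi fun φ => φ.continuous

/-- Continuous functions separate the points of a compact Hausdorff space, and coordinate zero of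
the constant sequence already records all of them. Sequences are used only to make room for the
shift. -/
theorem evalSeq_injective {E : Type*} [TopologicalSpace E] [CompactSpace E] [T2Space E] :
    Function.Injective (evalSeq : E → ℕ → FunSpace E) := by
  intro a b h
  by_contra hab
  obtain ⟨φ, hφ, hne⟩ := separatesPoints_continuous_of_t35Space (X := E) hab
  exact hne (congrFun (congrFun h 0) ⟨φ, hφ⟩)

/-- The map classifying a finite covering of a compact Hausdorff space. -/
def fiberMap {E L : Type*} [TopologicalSpace E] [TopologicalSpace L] {p : E → L}
    (hp : IsFiniteCovering p) (b : L) : FinSub (ℕ → FunSpace E) :=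
  ⟨evalSeq '' (p ⁻¹' {b}), (hp.2 b).image _⟩

/-- Over an evenly covered set the sheets form a finite family of continuous functions with distinct
values. -/
theorem continuous_fiberMap {E L : Type*} [TopologicalSpace E] [CompactSpace E] [T2Space E]
    [TopologicalSpace L] {p : E → L} (hp : IsFiniteCovering p) : Continuous (fiberMap hp) := by
  refine continuous_iff_continuousAt.2 fun b => ?_
  obtain ⟨-, U, hb, hU, -, H, hH⟩ := hp.1 b
  have : Finite (p ⁻¹' {b}) := hp.2 b
  have hc : Continuous fun a : U => FinSub.ofFamily fun i : p ⁻¹' {b} =>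
      evalSeq (H.symm (a, i)).1 := by
    refine continuous_range_family (fun i => continuous_evalSeq.comp (by fun_prop)) fun a i j h => ?_
    have := H.symm.injective (Subtype.ext (evalSeq_injective h))
    exact (Prod.ext_iff.1 this).2
  have hpU : ∀ y, p (H.symm y).1 = y.1.1 := fun y => by rw [← hH]; simp
  have heq : U.domRestrict (fiberMap hp) = fun a : U => FinSub.ofFamily fun i : p ⁻¹' {b} =>
      evalSeq (H.symm (a, i)).1 := by
    funext a
    apply FinSub.ext
    change evalSeq '' (p ⁻¹' {a.1}) = range _
    refine subset_antisymm ?_ (range_subset_iff.2 fun i => ⟨_, hpU _, rfl⟩)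
    rintro _ ⟨e, he, rfl⟩
    have he' : p e = a.1 := he
    refine ⟨(H ⟨e, by rw [mem_preimage, he']; exact a.2⟩).2, ?_⟩
    have : (a, (H ⟨e, by rw [mem_preimage, he']; exact a.2⟩).2) =
        H ⟨e, by rw [mem_preimage, he']; exact a.2⟩ := by
      refine Prod.ext (Subtype.ext ?_) rfl
      rw [hH]
      exact he'.symm
    simp only
    rw [this, H.symm_apply_apply]
  have hon : ContinuousOn (fiberMap hp) U := by
    rw [continuousOn_iff_continuous_domRestrict, heq]
    exact hc
  exact hon.continuousAt (hU.mem_nhds hb)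

/-! ### Extension of maps over skeletons -/

/-- Extension of a map from the `n`-skeleton to the `n`-cells. -/
theorem exists_extend_skeleton {L : Type u} [TopologicalSpace L] [CWComplex (univ : Set L)]
    [T2Space L] {Y : Type*} [TopologicalSpace Y] (n : ℕ)
    [Finite (RelCWComplex.cell (univ : Set L) n)] {s : L → Y}
    (hs : ContinuousOn s (RelCWComplex.skeletonLT (univ : Set L) (n : ℕ)))
    (h : RelCWComplex.cell (univ : Set L) n → C(Disk n, Y))
    (hh : ∀ c (v : Disk n), ‖v.1‖ = 1 → h c v = s (charMap n c v)) :
    ∃ s' : L → Y, EqOn s' s (RelCWComplex.skeletonLT (univ : Set L) (n : ℕ)) ∧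
      (∀ c v, s' (charMap n c v) = h c v) ∧
      ContinuousOn s' (RelCWComplex.skeletonLT (univ : Set L) (n + 1 : ℕ)) := by
  have hd := CellularRealization.disjoint_of_subset_skeleton (L := L) (n := n) le_rfl subset_rfl
  obtain ⟨s', h1, h2, h3⟩ := exists_glue Function.injective_id
    (RelCWComplex.skeletonLT (univ : Set L) (n : ℕ)).closed' hs
    (fun c => RelCWComplex.cellFrontier_subset_skeletonLT n c)
    hd h fun c v hv => hh c v <| by
      refine le_antisymm (mem_closedBall_zero_iff.1 v.2) (not_lt.1 fun hlt => ?_)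
      exact (hd c).le_bot ⟨hv, charMap_openToDisk_mem c ⟨v.1, mem_ball_zero_iff.2 hlt⟩⟩
  refine ⟨s', h1, h2, ?_⟩
  rw [Nat.cast_add_one,
    ← RelCWComplex.skeletonLT_union_iUnion_closedCell_eq_skeletonLT_succ (C := (univ : Set L)) n]
  exact h3

/-- Extension of a map from a skeleton to the cells of the next dimension, cell by cell. -/
theorem exists_extend_skeleton_succ {L : Type u} [TopologicalSpace L] [CWComplex (univ : Set L)]
    [T2Space L] {Y : Type*} [TopologicalSpace Y] (n : ℕ)
    [Finite (RelCWComplex.cell (univ : Set L) (n + 1))] {s : L → Y}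
    (hs : ContinuousOn s (RelCWComplex.skeletonLT (univ : Set L) (n + 1 : ℕ)))
    (h : ∀ c : RelCWComplex.cell (univ : Set L) (n + 1),
      (Continuous fun y => s (charMap (n + 1) c (sphToDisk n y))) →
      ∃ h : Disk (n + 1) → Y, Continuous h ∧
        ∀ y, h (sphToDisk n y) = s (charMap (n + 1) c (sphToDisk n y))) :
    ∃ s' : L → Y, EqOn s' s (RelCWComplex.skeletonLT (univ : Set L) (n + 1 : ℕ)) ∧
      ContinuousOn s' (RelCWComplex.skeletonLT (univ : Set L) (n + 1 + 1 : ℕ)) := by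
  choose g hg hgs using fun c => h c (hs.comp_continuous (by fun_prop) fun y =>
    RelCWComplex.cellFrontier_subset_skeletonLT (n + 1) c (charMap_sphToDisk_mem c y))
  obtain ⟨s', h1, -, h3⟩ := exists_extend_skeleton (n + 1) hs (fun c => ⟨g c, hg c⟩)
    (fun c v hv => hgs c ⟨v.1, mem_sphere_zero_iff_norm.2 hv⟩)
  exact ⟨s', h1, h3⟩

namespace CellularRealization

variable {X Q Z : Type*} [Fintype X] [Fintype Q] [Fintype Z] {C : CSSCode X Q Z}
  {D : ZLift C} {G : OneSkeleton D} {L : Type u} [TopologicalSpace L] [CWComplex (univ : Set L)]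
  (R : CellularRealization G L) [T2Space L] {E : Type*} [TopologicalSpace E] {p : E → L}

include R in
-- The total space is the union of the finitely many lifted cells, each the image of a disk.
theorem compactSpace_of_isFiniteCovering (hp : IsFiniteCovering p) : CompactSpace E := by
  have hfin : ∀ n (c : RelCWComplex.cell (univ : Set L) n),
      Finite (LiftedCell p (charMap n c)) := by
    intro n c
    have : Finite (p ⁻¹' {charMap n c 0}) := hp.2 _
    exact Finite.of_equiv _ (liftedCellEquiv hp.1 (charMap n c) 0).symm
  have h : (univ : Set E) = ⋃ n : Fin 6, ⋃ c : RelCWComplex.cell (univ : Set L) n,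
      ⋃ f : LiftedCell p (charMap n c), range f.1 := by
    refine subset_antisymm (fun e _ => ?_) (subset_univ _)
    have hw : p e ∈ (univ : Set L) := mem_univ _
    rw [← CWComplex.union (C := (univ : Set L))] at hw
    obtain ⟨n, c, hw⟩ := mem_iUnion₂.1 hw
    have hn : n < 6 := by
      by_contra hn
      exact (R.isEmpty_cell n (by omega)).false c
    rw [← range_charMap] at hw
    obtain ⟨v, hv⟩ := hw
    obtain ⟨f, hf, hfv⟩ := exists_lift_through hp.1 (charMap n c) v e hv.symm
    exact mem_iUnion₂.2 ⟨⟨n, hn⟩, c, mem_iUnion.2 ⟨⟨f, hf⟩, v, hfv⟩⟩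
  refine ⟨h ▸ isCompact_iUnion fun n => ?_⟩
  have := R.finite_cell n
  refine isCompact_iUnion fun c => ?_
  have := hfin n c
  exact isCompact_iUnion fun f => isCompact_range f.1.continuous

include R in
theorem isEmpty_of_isEmpty_vertices [IsEmpty (X ⊕ Q)] : IsEmpty L := by
  have hZ : IsEmpty Z := ⟨fun z => isEmptyElim (R.nonempty_inducedVertices z).some⟩
  have hX : IsEmpty X := ⟨fun x => isEmptyElim (Sum.inl x : X ⊕ Q)⟩
  have hQ : IsEmpty Q := ⟨fun q => isEmptyElim (Sum.inr q : X ⊕ Q)⟩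
  refine ⟨fun w => ?_⟩
  have hw : w ∈ (univ : Set L) := mem_univ _
  rw [← CWComplex.union (C := (univ : Set L))] at hw
  obtain ⟨n, c, -⟩ := mem_iUnion₂.1 hw
  match n, c with
  | 0, c => exact isEmptyElim (R.cell0.symm c)
  | 1, c => exact isEmptyElim (G.initial (R.cell1.symm c))
  | 2, c => exact isEmptyElim (R.label2 c)
  | 3, c => exact isEmptyElim (R.cell3.symm c)
  | 4, c => exact isEmptyElim (R.cell4.symm c)
  | 5, c => exact isEmptyElim (R.cell5.symm c)
  | n + 6, c => exact (R.isEmpty_cell (n + 6) (by omega)).false c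

/-! ### Transfer of the covering along the common 1-skeleton -/

section Two

variable {L₁ L₂ : Type u}
    [TopologicalSpace L₁] [CWComplex (univ : Set L₁)] [T2Space L₁]
    [TopologicalSpace L₂] [CWComplex (univ : Set L₂)] [T2Space L₂]
    (R₁ : CellularRealization G L₁) (R₂ : CellularRealization G L₂)

/-- `κ` is the identification of the common 1-skeleton of two realizations. -/
structure IsSkeletonMap (κ : L₂ → L₁) : Prop where
  continuousOn : ContinuousOn κ (RelCWComplex.skeletonLT (univ : Set L₂) (2 : ℕ))
  vertex : ∀ v, κ (R₂.vertex v) = R₁.vertex v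
  edge : ∀ e t, κ (charMap 1 (R₂.cell1 e) t) = charMap 1 (R₁.cell1 e) t

theorem exists_isSkeletonMap : ∃ κ, R₁.IsSkeletonMap R₂ κ := by
  have hf := R₂.finite_cell
  -- Any function will do as a start, since `skeletonLT` at `0` is empty. Its values off the
  -- 1-skeleton play no role.
  obtain ⟨s₀⟩ : Nonempty (L₂ → L₁) := by
    rcases isEmpty_or_nonempty (X ⊕ Q) with h | h
    · have := R₂.isEmpty_of_isEmpty_vertices
      exact ⟨isEmptyElim⟩
    · exact ⟨fun _ => R₁.vertex h.some⟩
  have h₀ : ContinuousOn s₀ (RelCWComplex.skeletonLT (univ : Set L₂) (0 : ℕ)) := by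
    have : (RelCWComplex.skeletonLT (univ : Set L₂) (0 : ℕ) : Set L₂) = ∅ := by
      rw [Nat.cast_zero]
      exact RelCWComplex.skeletonLT_zero_eq_base
    rw [this]
    exact continuousOn_empty _
  have := hf 0
  obtain ⟨s₁, -, hv, h₁⟩ := exists_extend_skeleton 0 h₀
    (fun c => .const _ (R₁.vertex (R₂.cell0.symm c))) fun c v hv => by
      rw [Subsingleton.elim v.1 0, norm_zero] at hv
      exact absurd hv zero_ne_one
  have hv₁ : ∀ v, s₁ (R₂.vertex v) = R₁.vertex v := by
    intro v
    rw [← R₂.charMap_zero v ⟨0, by simp⟩, hv, Equiv.symm_apply_apply]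
    rfl
  have := hf 1
  obtain ⟨s₂, h₂', he, h₂⟩ := exists_extend_skeleton 1 h₁
    (fun c => charMap 1 (R₁.cell1 (R₂.cell1.symm c))) fun c v hv => by
      obtain ⟨e, rfl⟩ := R₂.cell1.surjective c
      rw [Equiv.symm_apply_apply]
      rcases eq_endpoint_of_norm_eq_one hv with rfl | rfl
      · rw [R₁.charMap_endpoint_false, R₂.charMap_endpoint_false, hv₁]
      · rw [R₁.charMap_endpoint_true, R₂.charMap_endpoint_true, hv₁]
  refine ⟨s₂, h₂, fun v => ?_, fun e t => ?_⟩
  · rw [h₂' (R₂.vertex_mem_skeleton (by omega) v), hv₁]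
  · rw [he, Equiv.symm_apply_apply]

variable {R₁ R₂}

theorem IsSkeletonMap.mapsTo_graphOf {κ : L₂ → L₁} (hκ : R₁.IsSkeletonMap R₂ κ) (z : Z) :
    MapsTo κ (R₂.graphOf z) (R₁.graphOf z) := by
  rintro w (⟨v, hv, rfl⟩ | hw)
  · rw [hκ.vertex]
    exact R₁.vertex_mem_graphOf hv
  · obtain ⟨e, he, hw⟩ := mem_iUnion₂.1 hw
    rw [← range_charMap] at hw
    obtain ⟨t, rfl⟩ := hw
    rw [hκ.edge]
    exact Or.inr (mem_iUnion₂.2 ⟨e, he, charMap_mem_closedCell _ _ _⟩)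

/-- The only obstruction is at the 2-cells. It vanishes because the 2-cells of `z` in both
realizations are attached to the same graph, which in `L₁` lies in a simply connected complex. The
fillings themselves may differ. -/
theorem IsSkeletonMap.exists_classifying {κ : L₂ → L₁} (hκ : R₁.IsSkeletonMap R₂ κ) {E₁ : Type u}
    [TopologicalSpace E₁] {p₁ : E₁ → L₁} (hp₁ : IsFiniteCovering p₁) :
    ∃ f : L₂ → FinSub (ℕ → FunSpace E₁), Continuous f ∧
      ∀ w ∈ RelCWComplex.skeletonLT (univ : Set L₂) (2 : ℕ), f w = fiberMap hp₁ (κ w) := by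
  have := t2Space_of_isCoveringMap hp₁.1
  have := R₁.compactSpace_of_isFiniteCovering hp₁
  have hf := R₂.finite_cell
  have hf₂ := hf 2
  have hf₃ := hf 3
  have hf₄ := hf 4
  have hf₅ := hf 5
  -- `skeletonLT` bounds dimensions strictly, so the index `1 + 1` denotes the 1-skeleton.
  have h₁ : ContinuousOn (fun w => fiberMap hp₁ (κ w))
      (RelCWComplex.skeletonLT (univ : Set L₂) (1 + 1 : ℕ)) :=
    (continuous_fiberMap hp₁).comp_continuousOn hκ.continuousOn
  obtain ⟨f₂, he₂, h₂⟩ := exists_extend_skeleton_succ 1 h₁ fun c hc => by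
    refine exists_extend_finSub le_rfl hc ?_
    rintro y₀ _ ⟨e, he, rfl⟩
    have hκc : ∀ y, κ (charMap 2 c (sphToDisk 1 y)) ∈ R₁.graphOf (R₂.label2 c) := fun y =>
      hκ.mapsTo_graphOf _ (R₂.attach2 c (charMap_sphToDisk_mem c y))
    have he' : p₁ e = κ (charMap 2 c (sphToDisk 1 y₀)) := he
    have htr := R₁.isTrivialOver_twoComplexOf hp₁.1 (R₂.label2 c)
    obtain ⟨s, hs, hse⟩ := htr.2 e (by
      rw [he']
      exact R₁.graphOf_subset_twoComplexOf _ (hκc y₀))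
    have hcκ : Continuous fun y => κ (charMap 2 c (sphToDisk 1 y)) :=
      hκ.continuousOn.comp_continuous (by fun_prop) fun y =>
        RelCWComplex.cellFrontier_subset_skeletonLT 2 c (charMap_sphToDisk_mem c y)
    refine ⟨⟨fun y => evalSeq (s (κ (charMap 2 c (sphToDisk 1 y)))), ?_⟩, fun y => ?_, ?_⟩
    · exact continuous_evalSeq.comp (hs.1.comp_continuous hcκ fun y =>
        R₁.graphOf_subset_twoComplexOf _ (hκc y))
    · exact ⟨_, hs.2 _ (R₁.graphOf_subset_twoComplexOf _ (hκc y)), rfl⟩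
    · change evalSeq (s (κ _)) = _
      rw [← he', hse]
  obtain ⟨f₃, he₃, h₃⟩ := exists_extend_skeleton_succ 2 h₂ fun c hc =>
    exists_extend_finSub_of_two_le (by omega) hc
  obtain ⟨f₄, he₄, h₄⟩ := exists_extend_skeleton_succ 3 h₃ fun c hc =>
    exists_extend_finSub_of_two_le (by omega) hc
  obtain ⟨f₅, he₅, h₅⟩ := exists_extend_skeleton_succ 4 h₄ fun c hc =>
    exists_extend_finSub_of_two_le (by omega) hc
  have hmono : ∀ {m : ℕ}, 2 ≤ m → ∀ {w : L₂},
      w ∈ RelCWComplex.skeletonLT (univ : Set L₂) (2 : ℕ) →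
      w ∈ RelCWComplex.skeletonLT (univ : Set L₂) (m : ℕ) := fun h w hw =>
    RelCWComplex.skeletonLT_mono (by exact_mod_cast h) hw
  refine ⟨f₅, ?_, fun w hw => ?_⟩
  · rw [← continuousOn_univ]
    refine h₅.mono fun w hw => ?_
    rw [← CWComplex.union (C := (univ : Set L₂))] at hw
    obtain ⟨n, c, hw⟩ := mem_iUnion₂.1 hw
    refine closedCell_subset_skeleton ?_ c hw
    by_contra hn
    exact (R₂.isEmpty_cell n (by omega)).false c
  · rw [he₅ (hmono (by omega) hw), he₄ (hmono (by omega) hw), he₃ (hmono (by omega) hw), he₂ hw]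

end Two

end CellularRealization

/-! ## Comparison of the cellular lifts -/

/-- The lifts of a cell correspond to the points over the image of a point of the disk. -/
def liftedCellEquivFiber {E L : Type*} [TopologicalSpace E] [TopologicalSpace L]
    {p : E → L} (hp : IsCoveringMap p) {n : ℕ} (c : C(Disk n, L)) (v : Disk n) {b : L}
    (h : c v = b) : LiftedCell p c ≃ p ⁻¹' {b} :=
  (liftedCellEquiv hp c v).trans (Equiv.setCongr (by rw [h]))

/-- Transport along sections: a sheet is determined by its value at any one point. -/
theorem IsTrivialOver.exists_fiber_equiv {E L : Type u} [TopologicalSpace E] [TopologicalSpace L]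
    {p : E → L} (hp : IsCoveringMap p) {A : Set L} (hA : IsTrivialOver p A) {a b : L} (ha : a ∈ A)
    (hb : b ∈ A) : ∃ τ : p ⁻¹' {a} ≃ p ⁻¹' {b}, ∀ s, IsSectionOn p A s → ∀ e, s a = e.1 →
      s b = (τ e).1 := by
  have hex : ∀ {c : L} (_ : c ∈ A) (e : p ⁻¹' {c}), ∃ s, IsSectionOn p A s ∧ s c = e.1 := by
    rintro c hc ⟨e, rfl⟩
    exact hA.2 e hc
  choose s hs hse using fun e => hex ha e
  choose t ht hte using fun e => hex hb e
  refine ⟨⟨fun e => ⟨s e b, (hs e).2 b hb⟩, fun e => ⟨t e a, (ht e).2 a ha⟩, fun e => ?_,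
    fun e => ?_⟩, fun r hr e hre => ?_⟩
  · exact Subtype.ext ((hA.eqOn hp (ht _) (hs e) hb (hte _) ha).trans (hse e))
  · exact Subtype.ext ((hA.eqOn hp (hs _) (ht e) ha (hse _) hb).trans (hte e))
  · exact hA.eqOn hp hr (hs e) ha (hre.trans (hse e).symm) hb

namespace CellularRealization

variable {X Q Z : Type*} [Fintype X] [Fintype Q] [Fintype Z] {C : CSSCode X Q Z}
  {D : ZLift C} {G : OneSkeleton D} {L₁ L₂ : Type u}
  [TopologicalSpace L₁] [CWComplex (univ : Set L₁)] [T2Space L₁]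
  [TopologicalSpace L₂] [CWComplex (univ : Set L₂)] [T2Space L₂]
  {R₁ : CellularRealization G L₁} {R₂ : CellularRealization G L₂}

variable (R₁ R₂) in
/-- A family of bijections between the fibres of two coverings over the vertices which is
compatible with the lifts of the legs and with the sheets over the subcomplexes of the
`Z`-checks. -/
structure FiberEquiv {E₁ E₂ : Type u} [TopologicalSpace E₁] [TopologicalSpace E₂]
    (p₁ : E₁ → L₁) (p₂ : E₂ → L₂) where
  toEquiv : ∀ v, p₁ ⁻¹' {R₁.vertex v} ≃ p₂ ⁻¹' {R₂.vertex v}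
  leg : ∀ q (l : D.Leg q) a b, R₁.IsLegLift p₁ q l a.1 b.1 →
    R₂.IsLegLift p₂ q l (toEquiv (Sum.inl l.1) a).1 (toEquiv (Sum.inr q) b).1
  sheet : ∀ z s, IsSectionOn p₁ (R₁.supportOf z) s → ∃ s', IsSectionOn p₂ (R₂.supportOf z) s' ∧
    ∀ v ∈ D.inducedVertices z, ∀ h : p₁ (s (R₁.vertex v)) = R₁.vertex v,
      s' (R₂.vertex v) = (toEquiv v ⟨_, h⟩).1

/-- Over the 1-skeleton, the fibre of the classified covering at `w` is the image under `evalSeq` of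
the fibre of `p₁` at `κ w`. Lifted legs and sections over the graphs are therefore carried across by
`evalSeq`. -/
theorem IsSkeletonMap.exists_covering {κ : L₂ → L₁} (hκ : R₁.IsSkeletonMap R₂ κ) {E₁ : Type u}
    [TopologicalSpace E₁] {p₁ : E₁ → L₁} (hp₁ : IsFiniteCovering p₁) :
    ∃ (E₂ : Type u) (_ : TopologicalSpace E₂) (p₂ : E₂ → L₂), IsFiniteCovering p₂ ∧
      Nonempty (FiberEquiv R₁ R₂ p₁ p₂) := by
  have := t2Space_of_isCoveringMap hp₁.1
  have := R₁.compactSpace_of_isFiniteCovering hp₁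
  obtain ⟨f, hf, hfκ⟩ := hκ.exists_classifying hp₁
  have hp₂ : IsFiniteCovering (TotalSpace.proj f) := ⟨isCoveringMap_proj hf, finite_fiber_proj f⟩
  refine ⟨TotalSpace f, inferInstance, TotalSpace.proj f, hp₂, ?_⟩
  have hmem : ∀ {w : L₂} {e : E₁}, w ∈ RelCWComplex.skeletonLT (univ : Set L₂) (2 : ℕ) →
      p₁ e = κ w → evalSeq e ∈ (f w).1 := by
    intro w e hw he
    rw [hfκ w hw]
    exact ⟨e, he, rfl⟩
  have hmv : ∀ v, ∀ e : p₁ ⁻¹' {R₁.vertex v}, evalSeq e.1 ∈ (f (R₂.vertex v)).1 := fun v e =>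
    hmem (R₂.vertex_mem_skeleton (by omega) v) ((show p₁ e.1 = _ from e.2).trans (hκ.vertex v).symm)
  let θ : ∀ v, p₁ ⁻¹' {R₁.vertex v} ≃ TotalSpace.proj f ⁻¹' {R₂.vertex v} := fun v =>
    Equiv.ofBijective (fun e => ⟨⟨(R₂.vertex v, evalSeq e.1), hmv v e⟩, rfl⟩) <| by
      constructor
      · intro a b h
        exact Subtype.ext (evalSeq_injective
          (congrArg (fun x : TotalSpace.proj f ⁻¹' {R₂.vertex v} => x.1.1.2) h))
      · rintro ⟨⟨⟨w, x⟩, hx⟩, hw⟩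
        obtain rfl : w = R₂.vertex v := hw
        have hx' : x ∈ (f (R₂.vertex v)).1 := hx
        rw [hfκ _ (R₂.vertex_mem_skeleton (by omega) v)] at hx'
        obtain ⟨e, he, rfl⟩ := hx'
        exact ⟨⟨e, (show p₁ e = _ from he).trans (hκ.vertex v)⟩, rfl⟩
  refine ⟨⟨θ, ?_, ?_⟩⟩
  · rintro q l a b ⟨γ, ha, hb⟩
    have hm : ∀ t, evalSeq (γ.1 t) ∈ (f (charMap 1 (R₂.cell1 (Sum.inl ⟨q, l⟩)) t)).1 := fun t =>
      hmem (closedCell_subset_skeleton (by omega) _ (charMap_mem_closedCell _ _ _))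
        ((γ.2 t).trans (hκ.edge _ t).symm)
    refine ⟨⟨⟨fun t => ⟨(charMap 1 (R₂.cell1 (Sum.inl ⟨q, l⟩)) t, evalSeq (γ.1 t)), hm t⟩, ?_⟩,
      fun t => rfl⟩, ?_, ?_⟩
    · exact Continuous.subtype_mk ((map_continuous _).prodMk
        (continuous_evalSeq.comp γ.1.continuous)) _
    · refine Subtype.ext (Prod.ext (R₂.charMap_endpoint_false _) ?_)
      exact congrArg evalSeq ha
    · refine Subtype.ext (Prod.ext (R₂.charMap_endpoint_true _) ?_)
      exact congrArg evalSeq hb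
  · intro z s hs
    have hg : ∀ w ∈ R₂.graphOf z, κ w ∈ R₁.supportOf z := fun w hw =>
      R₁.twoComplexOf_subset_threeComplexOf z (R₁.graphOf_subset_twoComplexOf z
        (hκ.mapsTo_graphOf z hw)) |> R₁.threeComplexOf_subset_supportOf z
    have hm : ∀ w ∈ R₂.graphOf z, evalSeq (s (κ w)) ∈ (f w).1 := fun w hw =>
      hmem (R₂.graphOf_subset z hw) (hs.2 _ (hg w hw))
    obtain ⟨v₀, hv₀⟩ := R₂.nonempty_inducedVertices z
    classical
    obtain ⟨s', hs', he⟩ := R₂.exists_section_supportOf hp₂.1 z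
      (s := fun w => if hw : w ∈ R₂.graphOf z then ⟨(w, evalSeq (s (κ w))), hm w hw⟩
        else ⟨(_, _), hm _ (R₂.vertex_mem_graphOf hv₀)⟩) ⟨by
          rw [continuousOn_iff_continuous_domRestrict]
          have hc : Continuous fun w : R₂.graphOf z => s (κ w.1) :=
            (hs.1.comp (hκ.continuousOn.mono (R₂.graphOf_subset z)) hg).comp_continuous
              continuous_subtype_val fun w => w.2
          refine (Continuous.subtype_mk (continuous_subtype_val.prodMk
            (continuous_evalSeq.comp hc)) fun w => hm w.1 w.2).congr fun w => ?_
          simp [w.2], fun w hw => by simp only [dif_pos hw]; rfl⟩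
    refine ⟨s', hs', fun v hv h => ?_⟩
    rw [he (R₂.vertex_mem_graphOf hv)]
    simp only [dif_pos (R₂.vertex_mem_graphOf hv)]
    exact Subtype.ext (Prod.ext rfl (congrArg (fun w => evalSeq (s w)) (hκ.vertex v)))

section Compare

variable {E₁ E₂ : Type u} [TopologicalSpace E₁] [TopologicalSpace E₂] {p₁ : E₁ → L₁} {p₂ : E₂ → L₂}

/-- For the converse, the leg is lifted from `a`. Its image has the same initial point as the given
lift in `E₂`, hence the same final point, and injectivity over `q` identifies that point with `b`.
-/
theorem FiberEquiv.isLegLift_iff (θ : FiberEquiv R₁ R₂ p₁ p₂) (hp₁ : IsCoveringMap p₁)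
    (hp₂ : IsCoveringMap p₂) (q : Q) (l : D.Leg q) (a : p₁ ⁻¹' {R₁.vertex (Sum.inl l.1)})
    (b : p₁ ⁻¹' {R₁.vertex (Sum.inr q)}) : R₁.IsLegLift p₁ q l a.1 b.1 ↔
      R₂.IsLegLift p₂ q l (θ.toEquiv (Sum.inl l.1) a).1 (θ.toEquiv (Sum.inr q) b).1 := by
  refine ⟨θ.leg q l a b, ?_⟩
  rintro ⟨γ, ha, hb⟩
  obtain ⟨δ, hδ, hδa⟩ := exists_lift_through hp₁ (charMap 1 (R₁.cell1 (Sum.inl ⟨q, l⟩)))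
    (endpoint false) a.1 ((show p₁ a.1 = _ from a.2).trans (R₁.charMap_endpoint_false (Sum.inl ⟨q, l⟩)).symm)
  have hδb : p₁ (δ (endpoint true)) = R₁.vertex (Sum.inr q) :=
    (hδ _).trans (R₁.charMap_endpoint_true _)
  obtain ⟨γ', ha', hb'⟩ := θ.leg q l a ⟨_, hδb⟩ ⟨⟨δ, hδ⟩, hδa, rfl⟩
  have h := lift_unique hp₂ γ.1.continuous γ'.1.continuous
    (fun t => (γ.2 t).trans (γ'.2 t).symm) _ (ha.trans ha'.symm) (endpoint true)
  rw [hb, hb'] at h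
  have h' := (θ.toEquiv _).injective (Subtype.ext h)
  refine ⟨⟨δ, hδ⟩, hδa, ?_⟩
  rw [h']

/-- A lifted 5-cell is determined by the sheet containing its boundary, and a sheet by its point
over one vertex of `z`. The bijection goes from the corner to this vertex, across by `θ`, and back
to the corner. -/
theorem FiberEquiv.exists_equiv_five (θ : FiberEquiv R₁ R₂ p₁ p₂) (hp₁ : IsCoveringMap p₁)
    (hp₂ : IsCoveringMap p₂) (z : Z) :
    ∃ e : LiftedCell p₁ (charMap 5 (R₁.cell5 z)) ≃ LiftedCell p₂ (charMap 5 (R₂.cell5 z)),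
      ∀ z', ∃ s₁ s₂, IsSectionOn p₁ (R₁.supportOf z) s₁ ∧ IsSectionOn p₂ (R₂.supportOf z) s₂ ∧
        s₁ (charMap 5 (R₁.cell5 z) (sphToDisk 4 (corner 4))) = z'.1 (sphToDisk 4 (corner 4)) ∧
        s₂ (charMap 5 (R₂.cell5 z) (sphToDisk 4 (corner 4))) = (e z').1 (sphToDisk 4 (corner 4)) ∧
        ∀ v ∈ D.inducedVertices z, ∀ h : p₁ (s₁ (R₁.vertex v)) = R₁.vertex v,
          s₂ (R₂.vertex v) = (θ.toEquiv v ⟨_, h⟩).1 := by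
  obtain ⟨v, hv⟩ := R₁.nonempty_inducedVertices z
  have ht₁ := R₁.isTrivialOver_supportOf hp₁ z
  have ht₂ := R₂.isTrivialOver_supportOf hp₂ z
  obtain ⟨τ₁, h₁⟩ := ht₁.exists_fiber_equiv hp₁ (R₁.attachMap_five_mem z (corner 4))
    (R₁.vertex_mem_supportOf hv)
  obtain ⟨τ₂, h₂⟩ := ht₂.exists_fiber_equiv hp₂ (R₂.vertex_mem_supportOf hv)
    (R₂.attachMap_five_mem z (corner 4))
  refine ⟨(liftedCellEquiv hp₁ _ (sphToDisk 4 (corner 4))).trans (τ₁.trans ((θ.toEquiv v).trans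
    (τ₂.trans (liftedCellEquiv hp₂ _ (sphToDisk 4 (corner 4))).symm))), fun z' => ?_⟩
  obtain ⟨s₁, hs₁, hs₁z⟩ := ht₁.2 (z'.1 (sphToDisk 4 (corner 4))) (by
    rw [z'.2]
    exact R₁.attachMap_five_mem z _)
  rw [z'.2] at hs₁z
  obtain ⟨s₂, hs₂, hs₂v⟩ := θ.sheet z s₁ hs₁
  refine ⟨s₁, s₂, hs₁, hs₂, hs₁z, ?_, hs₂v⟩
  have hv₁ := h₁ s₁ hs₁ (liftedCellEquiv hp₁ _ (sphToDisk 4 (corner 4)) z') hs₁z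
  have hv₂ := hs₂v v hv (hs₁.2 _ (R₁.vertex_mem_supportOf hv))
  have hsub : (⟨_, hs₁.2 _ (R₁.vertex_mem_supportOf hv)⟩ : p₁ ⁻¹' {R₁.vertex v}) = τ₁ _ :=
    Subtype.ext hv₁
  rw [hsub] at hv₂
  rw [h₂ s₂ hs₂ _ hv₂, ← liftedCellEquiv_coe hp₂]
  simp

/-- Lifted 3- and 4-cells are matched through the images of their corners over the vertices `x` and
`q`, lifted 5-cells through their sheets. Both kinds of incidence number have been expressed in
these terms. -/
theorem FiberEquiv.exists_reindex_lift_eq (θ : FiberEquiv R₁ R₂ p₁ p₂) (hp₁ : IsFiniteCovering p₁)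
    (hp₂ : IsFiniteCovering p₂) :
    ∃ (eX : ∀ x : X, LiftedCell p₁ (charMap 3 (R₁.cell3 x)) ≃
          LiftedCell p₂ (charMap 3 (R₂.cell3 x)))
      (eQ : ∀ q : Q, LiftedCell p₁ (charMap 4 (R₁.cell4 q)) ≃
          LiftedCell p₂ (charMap 4 (R₂.cell4 q)))
      (eZ : ∀ z : Z, LiftedCell p₁ (charMap 5 (R₁.cell5 z)) ≃
          LiftedCell p₂ (charMap 5 (R₂.cell5 z))),
      (R₁.lift p₁).reindex (Equiv.sigmaCongrRight eX) (Equiv.sigmaCongrRight eQ)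
        (Equiv.sigmaCongrRight eZ) = R₂.lift p₂ := by
  choose eZ hZ using θ.exists_equiv_five hp₁.1 hp₂.1
  let bX₁ := fun x => liftedCellEquivFiber hp₁.1 _ _ (R₁.charMap_three_sphToDisk x (corner 2))
  let bX₂ := fun x => liftedCellEquivFiber hp₂.1 _ _ (R₂.charMap_three_sphToDisk x (corner 2))
  let bQ₁ := fun q => liftedCellEquivFiber hp₁.1 _ _ (R₁.charMap_four_corner q)
  let bQ₂ := fun q => liftedCellEquivFiber hp₂.1 _ _ (R₂.charMap_four_corner q)
  let eX := fun x => (bX₁ x).trans ((θ.toEquiv (Sum.inl x)).trans (bX₂ x).symm)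
  let eQ := fun q => (bQ₁ q).trans ((θ.toEquiv (Sum.inr q)).trans (bQ₂ q).symm)
  have hX : ∀ x x', (eX x x').1 (sphToDisk 2 (corner 2)) = (θ.toEquiv (Sum.inl x) (bX₁ x x')).1 :=
    fun x x' => congrArg Subtype.val ((bX₂ x).apply_symm_apply _)
  have hQ : ∀ q q', (eQ q q').1 (sphToDisk 3 (corner 3)) = (θ.toEquiv (Sum.inr q) (bQ₁ q q')).1 :=
    fun q q' => congrArg Subtype.val ((bQ₂ q).apply_symm_apply _)
  have h43 : ∀ q q' x x', incidence (eQ q q').1 (eX x x').1 = incidence q'.1 x'.1 := by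
    intro q q' x x'
    refine (incidence_four_three_eq R₁ R₂ hp₁ hp₂ _ _ _ _ fun l hl => ?_).symm
    subst hl
    rw [hX, hQ]
    exact θ.isLegLift_iff hp₁.1 hp₂.1 q l (bX₁ l.1 x') (bQ₁ q q')
  have h54 : ∀ z z' q q', incidence (eZ z z').1 (eQ q q').1 = incidence z'.1 q'.1 := by
    intro z z' q q'
    obtain ⟨s₁, s₂, hs₁, hs₂, hz₁, hz₂, hv⟩ := hZ z z'
    rw [R₁.incidence_five_four hp₁.1 z' q' hs₁ hz₁,
      R₂.incidence_five_four hp₂.1 (eZ z z') (eQ q q') hs₂ hz₂]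
    have hiff : D.d2 q z ≠ 0 →
        (s₂ (R₂.vertex (Sum.inr q)) = (eQ q q').1 (sphToDisk 3 (corner 3)) ↔
          s₁ (R₁.vertex (Sum.inr q)) = q'.1 (sphToDisk 3 (corner 3))) := by
      intro hq
      have hmem : (Sum.inr q : X ⊕ Q) ∈ D.inducedVertices z := hq
      have hp := hs₁.2 _ (R₁.vertex_mem_supportOf hmem)
      rw [hv _ hmem hp, hQ]
      exact Subtype.val_injective.eq_iff.trans
        ((θ.toEquiv (Sum.inr q)).injective.eq_iff.trans Subtype.ext_iff)
    classical
    exact if_congr (and_congr_right hiff) rfl rfl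
  refine ⟨eX, eQ, eZ, ParityChecks.ext ?_ ?_⟩
  · ext x q
    obtain ⟨x, rfl⟩ := (Equiv.sigmaCongrRight eX).surjective x
    obtain ⟨q, rfl⟩ := (Equiv.sigmaCongrRight eQ).surjective q
    simp only [ParityChecks.reindex, Matrix.reindex_apply, Matrix.submatrix_apply,
      Equiv.symm_apply_apply]
    exact congrArg Int.cast (h43 q.1 q.2 x.1 x.2).symm
  · ext z q
    obtain ⟨z, rfl⟩ := (Equiv.sigmaCongrRight eZ).surjective z
    obtain ⟨q, rfl⟩ := (Equiv.sigmaCongrRight eQ).surjective q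
    simp only [ParityChecks.reindex, Matrix.reindex_apply, Matrix.submatrix_apply,
      Equiv.symm_apply_apply]
    exact congrArg Int.cast (h54 z.1 z.2 q.1 q.2).symm

end Compare

variable (R₁ R₂) in
/-- Every cellular lift of the first realization is one of the second realization. -/
theorem exists_covering_reindex_lift_eq {E₁ : Type u} [TopologicalSpace E₁] {p₁ : E₁ → L₁}
    (hp₁ : IsFiniteCovering p₁) :
    ∃ (E₂ : Type u) (_ : TopologicalSpace E₂) (p₂ : E₂ → L₂), IsFiniteCovering p₂ ∧
      ∃ (eX : ∀ x : X, LiftedCell p₁ (charMap 3 (R₁.cell3 x)) ≃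
            LiftedCell p₂ (charMap 3 (R₂.cell3 x)))
        (eQ : ∀ q : Q, LiftedCell p₁ (charMap 4 (R₁.cell4 q)) ≃
            LiftedCell p₂ (charMap 4 (R₂.cell4 q)))
        (eZ : ∀ z : Z, LiftedCell p₁ (charMap 5 (R₁.cell5 z)) ≃
            LiftedCell p₂ (charMap 5 (R₂.cell5 z))),
        (R₁.lift p₁).reindex (Equiv.sigmaCongrRight eX) (Equiv.sigmaCongrRight eQ)
          (Equiv.sigmaCongrRight eZ) = R₂.lift p₂ := by
  obtain ⟨κ, hκ⟩ := R₁.exists_isSkeletonMap R₂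
  obtain ⟨E₂, _, p₂, hp₂, ⟨θ⟩⟩ := hκ.exists_covering hp₁
  exact ⟨E₂, _, p₂, hp₂, θ.exists_reindex_lift_eq hp₁ hp₂⟩

variable (R₁ R₂) in
theorem IsCellularLift.of_same_skeleton {X' Q' Z' : Type*} {P : ParityChecks X' Q' Z'}
    (h : R₁.IsCellularLift P) : R₂.IsCellularLift P := by
  obtain ⟨E₁, _, p₁, hp₁, eX', eQ', eZ', rfl⟩ := h
  obtain ⟨E₂, _, p₂, hp₂, eX, eQ, eZ, h⟩ := R₁.exists_covering_reindex_lift_eq R₂ hp₁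
  refine ⟨E₂, _, p₂, hp₂, (Equiv.sigmaCongrRight eX).symm.trans eX',
    (Equiv.sigmaCongrRight eQ).symm.trans eQ', (Equiv.sigmaCongrRight eZ).symm.trans eZ', ?_⟩
  rw [← h]
  generalize Equiv.sigmaCongrRight eX = fX, Equiv.sigmaCongrRight eQ = fQ,
    Equiv.sigmaCongrRight eZ = fZ
  apply ParityChecks.ext <;> ext a b <;> simp [ParityChecks.reindex]

end CellularRealization

end CellularLift

end

theorem mainTheorem3 {X Q Z : Type*} [Fintype X] [Fintype Q] [Fintype Z]
    (C : CellularLift.CSSCode X Q Z) (D : CellularLift.ZLift C) (G : CellularLift.OneSkeleton D)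
    {L₁ L₂ : Type u} [TopologicalSpace L₁] [T2Space L₁] [CWComplex (Set.univ : Set L₁)]
    [TopologicalSpace L₂] [T2Space L₂] [CWComplex (Set.univ : Set L₂)]
    (R₁ : CellularLift.CellularRealization G L₁) (R₂ : CellularLift.CellularRealization G L₂) :
    (∀ (E₁ : Type u) [TopologicalSpace E₁] (p₁ : E₁ → L₁), CellularLift.IsFiniteCovering p₁ →
      ∃ (E₂ : Type u) (_ : TopologicalSpace E₂) (p₂ : E₂ → L₂), CellularLift.IsFiniteCovering p₂ ∧
        ∃ (eX : ∀ x : X, CellularLift.LiftedCell p₁ (CellularLift.charMap 3 (R₁.cell3 x)) ≃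
              CellularLift.LiftedCell p₂ (CellularLift.charMap 3 (R₂.cell3 x)))
          (eQ : ∀ q : Q, CellularLift.LiftedCell p₁ (CellularLift.charMap 4 (R₁.cell4 q)) ≃
              CellularLift.LiftedCell p₂ (CellularLift.charMap 4 (R₂.cell4 q)))
          (eZ : ∀ z : Z, CellularLift.LiftedCell p₁ (CellularLift.charMap 5 (R₁.cell5 z)) ≃
              CellularLift.LiftedCell p₂ (CellularLift.charMap 5 (R₂.cell5 z))),
          (R₁.lift p₁).reindex (Equiv.sigmaCongrRight eX) (Equiv.sigmaCongrRight eQ)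
            (Equiv.sigmaCongrRight eZ) = R₂.lift p₂) ∧
    (∀ (X' Q' Z' : Type*) (P : CellularLift.ParityChecks X' Q' Z'),
      R₁.IsCellularLift P ↔ R₂.IsCellularLift P) := by 
  exact ⟨fun E₁ _ p₁ hp₁ => R₁.exists_covering_reindex_lift_eq R₂ hp₁, fun X' Q' Z' P =>
    ⟨CellularLift.CellularRealization.IsCellularLift.of_same_skeleton R₁ R₂,
      CellularLift.CellularRealization.IsCellularLift.of_same_skeleton R₂ R₁⟩⟩
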